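/- Let $\Omega\subset\mathbb R^2$ be a bounded open set with Lipschitz boundary, and let $f:S^1\times S^1\to\mathbb R$ be bounded with $f(u,v)=f(v,u)$ and $f(u,v)=f(u,-v)=f(-u,v)$ for all $u,v\in S^1$. Let $K$ be the set of positive semidefinite matrices of trace $1$ in the space $\mathbb M^{2\times2}_{sym}$ of symmetric $2\times2$ matrices (with the Frobenius norm $|\cdot|$), and let $W=[-\frac12,\frac12)^2$. For $A\subset\mathbb R^2$ and $\varepsilon>0$ let $\mathbb Z_\varepsilon(A)=\{i\in\mathbb Z^2:\varepsilon i\in A\}$, and for $u:\mathbb Z_\varepsilon(A)\to S^1$ set $$E_\varepsilon(u;A)=\sum_{i,j\in\mathbb Z_\varepsilon(A),\ |i-j|=1}\varepsilon^2 f(u_i,u_j),$$ the sum being over ordered pairs $(i,j)$. Define $F_\varepsilon:L^\infty(\Omega;\mathbb M^{2\times2}_{sym})\to\mathbb R\cup\{+\infty\}$ by $F_\varepsilon(Q)=E_\varepsilon(u;\Omega)$ if $Q(x)\in K$ for a.e. $x\in\Omega$ and there is $u:\mathbb Z_\varepsilon(\Omega)\to S^1$ with $Q=u_i\otimes u_i$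 a.e. on $\Omega\cap\varepsilon(i+W)$ for every $i\in\mathbb Z_\varepsilon(\Omega)$ (the value does not depend on the choice of $u$), and $F_\varepsilon(Q)=+\infty$ otherwise. Define $\widehat f:K\to\mathbb R$ by $$\widehat f(Q)=\begin{cases} f(u,v) & \text{if } Q=\frac{u\otimes u+v\otimes v}2\neq\frac12 I,\\ \inf\{f(u,v):u,v\in S^1,\ u\cdot v=0\} & \text{if } Q=\frac12 I\end{cases}$$ (this is well defined, and the infimum is the minimum whenever it is attained), and let $\widehat f^{**}:K\to\mathbb R$ be the largest convex lower semicontinuous function on $K$ below $\widehat f$. Then, as $\varepsilon\to0^+$, the functionals $F_\varepsilon$ $\Gamma$-converge with respect to the weak$^*$ topology of $L^\infty(\Omega;\mathbb M^{2\times2}_{sym})$ to $$F(Q)=\begin{cases}4\displaystyle\int_\Omega\widehat f^{**}(Q(x))\,dx & \text{if } Q\in L^\infty(\Omega;K),\\ +\infty&\text{otherwise;}\end{cases}$$ that is, for every $Q\in L^\infty(\Omega;\mathbb M^{2\times2}_{sym})$, the number $F(Q)$ is at most the lower limit of $F_\varepsilon(R)$ as $\varepsilon\to0^+$ and $R\to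 Q$ weakly$^*$ (jointly), and there is a family $Q_\varepsilon\to Q$ weakly$^*$ with $\limsup_{\varepsilon\to0^+}F_\varepsilon(Q_\varepsilon)\le F(Q)$. Moreover $f_{\rm hom}=4\widehat f^{**}$ on $K$, where $f_{\rm hom}$ is given by the homogenization formula $$f_{\rm hom}(Q)=\lim_{\rho\to0^+}\ \lim_{h\to+\infty}\ \frac1{h^2}\inf\Bigl\{E_1(u;hW)\ :\ u:\mathbb Z_1(hW)\to S^1,\ \Bigl|\frac1{\#\mathbb Z_1(hW)}\sum_{i\in\mathbb Z_1(hW)}u_i\otimes u_i-Q\Bigr|\le\rho\Bigr\},$$ and both limits exist for every $Q\in K$. -/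

import Mathlib

open MeasureTheory Filter Topology Set
open scoped NNReal ENNReal

noncomputable section

/-! ## The plane, the unit circle, symmetric matrices, Q-tensors -/

abbrev Plane : Type := EuclideanSpace ℝ (Fin 2)

/-- The unit circle `S¹` of the plane. -/
abbrev Circ : Type := Metric.sphere (0 : Plane) 1

/-- The space of real symmetric `2 × 2` matrices. -/
def symMatrices : Submodule ℝ (Matrix (Fin 2) (Fin 2) ℝ) where
  carrier := {A | A.IsSymm}
  add_mem' := fun {_ _} ha hb => Matrix.IsSymm.add ha hb
  zero_mem' := Matrix.isSymm_zero
  smul_mem' := fun c _ ha => Matrix.IsSymm.smul ha c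

/-- The same space, normed by the Frobenius norm. -/
def SymMat : Type := symMatrices

section

attribute [local instance] Matrix.frobeniusNormedAddCommGroup Matrix.frobeniusNormedSpace

instance : NormedAddCommGroup SymMat := symMatrices.normedAddCommGroup

instance : NormedSpace ℝ SymMat := symMatrices.normedSpace

end

/-- The symmetric matrix underlying an element of `SymMat`. -/
def SymMat.toMatrix (A : SymMat) : Matrix (Fin 2) (Fin 2) ℝ :=
  Subtype.val (p := fun B => B ∈ symMatrices) A

/-- The tensor product `u ⊗ u`. -/
def tensorSq (u : Circ) : SymMat :=
  (⟨Matrix.of fun a b => (u : Plane) a * (u : Plane) b, by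
    ext a b
    simp [Matrix.transpose, mul_comm]⟩ : symMatrices)

/-- The matrix `I / 2`. -/
def halfId : SymMat :=
  (⟨(1 / 2 : ℝ) • (1 : Matrix (Fin 2) (Fin 2) ℝ), Matrix.isSymm_one.smul _⟩ : symMatrices)

/-- The matrix `(u ⊗ u + v ⊗ v) / 2`. -/
def pairTensor (u v : Circ) : SymMat := (1 / 2 : ℝ) • (tensorSq u + tensorSq v)

/-- The set `K` of positive semidefinite symmetric matrices of trace one. -/
def tensorBody : Set SymMat :=
  {Q | Q.toMatrix.PosSemidef ∧ Q.toMatrix.trace = 1}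

/-! ## Domains with Lipschitz boundary -/

/-- Near each boundary point, and after an orthogonal change of coordinates, the set is the open
region above the graph of a Lipschitz function. -/
def HasLipschitzBoundary (Ω : Set Plane) : Prop :=
  ∀ x ∈ frontier Ω, ∃ (T : Plane ≃ₗᵢ[ℝ] Plane) (γ : ℝ → ℝ) (L : ℝ≥0) (r : ℝ),
    LipschitzWith L γ ∧ 0 < r ∧ ∀ y ∈ Metric.ball x r, (y ∈ Ω ↔ γ (T y 0) < T y 1)

/-! ## Gamma-convergence -/

/-- Gamma-convergence of a family `F i` along the filter `l`, in a topological space `X`: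
the lower bound holds along all `(i, y) → (l, x)`, that is,
`G x ≤ sup over neighbourhoods U of x of liminf over i of inf over U of F i`, and every point has
a recovery family. It implies both the topological and the sequential form of Gamma-convergence. -/
structure GammaConverges {ι X : Type*} [TopologicalSpace X] (l : Filter ι)
    (F : ι → X → EReal) (G : X → EReal) : Prop where
  lower_bound : ∀ x, G x ≤ liminf (fun p : ι × X => F p.1 p.2) (l ×ˢ 𝓝 x)
  recovery : ∀ x, ∃ y : ι → X, Tendsto y l (𝓝 x) ∧ limsup (fun i => F i (y i)) l ≤ G x

/-! ## The space `L^∞(Ω; Sym)` with its weak* topology -/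

/-- The space `L^∞(Ω; Sym)`, as a type that carries the weak* topology. -/
def LinftySym (Ω : Set Plane) : Type := Lp SymMat ∞ (volume.restrict Ω)

/-- The underlying class of functions. -/
def LinftySym.toLp {Ω : Set Plane} (Q : LinftySym Ω) : Lp SymMat ∞ (volume.restrict Ω) := Q

instance (Ω : Set Plane) : CoeFun (LinftySym Ω) (fun _ => Plane → SymMat) :=
  ⟨fun Q => ⇑Q.toLp⟩

/-- The Frobenius scalar product `A : B`. -/
def frobInner (A B : SymMat) : ℝ := ∑ a, ∑ b, A.toMatrix a b * B.toMatrix a b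

/-- The weak* topology `σ(L^∞, L^1)`: the coarsest topology for which `Q ↦ ∫_Ω Φ : Q dx` is
continuous for every `Φ` in `L^1(Ω; Sym)`. -/
instance (Ω : Set Plane) : TopologicalSpace (LinftySym Ω) :=
  TopologicalSpace.induced
    (fun (Q : LinftySym Ω) (Φ : {Φ : Plane → SymMat // Integrable Φ (volume.restrict Ω)}) =>
      ∫ x in Ω, frobInner (Φ.1 x) (Q x))
    inferInstance

/-! ## The lattice energies -/

/-- The points `i` of `ℤ²` with `ε i ∈ Ω`. -/
def latticePoints (ε : ℝ) (Ω : Set Plane) : Set (Fin 2 → ℤ) :=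
  {i | (WithLp.toLp 2 fun a => ε * (i a : ℝ)) ∈ Ω}

/-- The nearest-neighbour energy `∑ ε² f(u_i, u_j)` over the ordered pairs `(i, j)` of points of
`ℤ²` with `ε i, ε j ∈ Ω` and `|i - j| = 1`. -/
def spinEnergy (f : Circ → Circ → ℝ) (ε : ℝ) (Ω : Set Plane) (u : (Fin 2 → ℤ) → Circ) : ℝ :=
  ∑ᶠ p ∈ {p : (Fin 2 → ℤ) × (Fin 2 → ℤ) | p.1 ∈ latticePoints ε Ω ∧ p.2 ∈ latticePoints ε Ω ∧
    ∑ a, (p.1 a - p.2 a) ^ 2 = 1}, ε ^ 2 * f (u p.1) (u p.2)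

/-- The cell `ε (i + [-1/2, 1/2)²)`. -/
def cell (ε : ℝ) (i : Fin 2 → ℤ) : Set Plane :=
  {x | ∀ a, ε * ((i a : ℝ) - 1 / 2) ≤ x a ∧ x a < ε * ((i a : ℝ) + 1 / 2)}

/-- `Q` belongs to `C_ε(Ω; K)` with nodal values `u_i ⊗ u_i`: it takes values in `K`, and equals
`u_i ⊗ u_i` on the part in `Ω` of the cell of each lattice point of `Ω`. -/
def IsInterpolation (ε : ℝ) (Ω : Set Plane) (u : (Fin 2 → ℤ) → Circ) (Q : LinftySym Ω) : Prop :=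
  (∀ᵐ x ∂(volume.restrict Ω), Q x ∈ tensorBody) ∧
  ∀ i ∈ latticePoints ε Ω, ∀ᵐ x ∂(volume.restrict Ω), x ∈ cell ε i → Q x = tensorSq (u i)

/-- The functional `F_ε` on `L^∞(Ω; Sym)`: the energy of `u` if `Q` is the interpolation of some
`u`, and `+∞` otherwise. For an open `Ω` the function `Q` determines each `u_i` up to sign, so for
`f` invariant under changes of sign all admissible `u` have the same energy and the infimum is
over a single value, or over the empty set. -/
def discreteFunctional (f : Circ → Circ → ℝ) (Ω : Set Plane) (ε : ℝ) (Q : LinftySym Ω) : EReal :=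
  ⨅ (u : (Fin 2 → ℤ) → Circ) (_ : IsInterpolation ε Ω u Q), ((spinEnergy f ε Ω u : ℝ) : EReal)

/-! ## The limit density -/

open Classical in
/-- The function `f̂` on `K`: the value `f(u, v)` at `(u ⊗ u + v ⊗ v) / 2 ≠ I / 2`, and the infimum
of `f` over orthogonal pairs at `I / 2`. The value outside `K` is irrelevant. -/
def fHat (f : Circ → Circ → ℝ) (Q : SymMat) : ℝ :=
  if Q = halfId then
    sInf {t | ∃ u v : Circ, inner ℝ (u : Plane) (v : Plane) = 0 ∧ t = f u v}
  else if h : ∃ p : Circ × Circ, pairTensor p.1 p.2 = Q then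
    f h.choose.1 h.choose.2
  else 0

theorem circ_sq (u : Circ) : (u : Plane) 0 ^ 2 + (u : Plane) 1 ^ 2 = 1 := by
  have h : ‖(u : Plane)‖ = 1 := by simp
  have h2 := EuclideanSpace.real_norm_sq_eq (u : Plane)
  rw [h, Fin.sum_univ_two] at h2
  linarith

theorem pairTensor_apply (u v : Circ) (a b : Fin 2) : (pairTensor u v).toMatrix a b =
    (1 / 2 : ℝ) * ((u : Plane) a * (u : Plane) b + (v : Plane) a * (v : Plane) b) := rfl

/-- Unit vectors with the same tensor square agree up to sign. -/
theorem circ_eq_or_neg (u w : Circ)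
    (h0 : (u : Plane) 0 ^ 2 = (w : Plane) 0 ^ 2)
    (h1 : (u : Plane) 0 * (u : Plane) 1 = (w : Plane) 0 * (w : Plane) 1) :
    w = u ∨ w = -u := by
  have hu := circ_sq u
  have hw := circ_sq w
  have key : ((w : Plane) 0 = (u : Plane) 0 ∧ (w : Plane) 1 = (u : Plane) 1) ∨
      ((w : Plane) 0 = -(u : Plane) 0 ∧ (w : Plane) 1 = -(u : Plane) 1) := by
    generalize (u : Plane) 0 = a at *
    generalize (u : Plane) 1 = b at *
    generalize (w : Plane) 0 = c at *
    generalize (w : Plane) 1 = d at *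
    have e1 : d ^ 2 = b ^ 2 := by linarith
    by_cases ha : a = 0
    · subst ha
      have hc : c = 0 := by
        have : c ^ 2 = 0 := by linarith
        exact pow_eq_zero_iff two_ne_zero |>.mp this
      subst hc
      rcases sq_eq_sq_iff_eq_or_eq_neg.mp e1 with h | h
      · exact Or.inl ⟨rfl, h⟩
      · exact Or.inr ⟨by simp, h⟩
    · rcases sq_eq_sq_iff_eq_or_eq_neg.mp h0.symm with h | h
      · subst h
        exact Or.inl ⟨rfl, (mul_left_cancel₀ ha h1).symm⟩
      · subst h
        refine Or.inr ⟨rfl, ?_⟩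
        have : a * (b + d) = 0 := by linarith
        rcases mul_eq_zero.mp this with h | h
        · exact absurd h ha
        · linarith
  rcases key with ⟨k0, k1⟩ | ⟨k0, k1⟩
  · left
    apply Subtype.ext
    ext a
    fin_cases a
    · exact k0
    · exact k1
  · right
    apply Subtype.ext
    ext a
    fin_cases a
    · simpa using k0
    · simpa using k1

/-- Away from `I / 2` the decomposition is unique, up to signs and the order. -/
theorem pairTensor_eq (u v z w : Circ) (h : pairTensor u v = pairTensor z w)
    (hne : pairTensor u v ≠ halfId) :
    ((z = u ∨ z = -u) ∧ (w = v ∨ w = -v)) ∨ ((z = v ∨ z = -v) ∧ (w = u ∨ w = -u)) := by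
  have e (a b : Fin 2) := congrArg (fun Q : SymMat => Q.toMatrix a b) h
  simp only [pairTensor_apply] at e
  have h00 := e 0 0
  have h01 := e 0 1
  have hu := circ_sq u
  have hv := circ_sq v
  have hz := circ_sq z
  have hw := circ_sq w
  have hne' : ¬ ((u : Plane) 0 ^ 2 + (v : Plane) 0 ^ 2 = 1 ∧
      (u : Plane) 0 * (u : Plane) 1 + (v : Plane) 0 * (v : Plane) 1 = 0) := by
    rintro ⟨g0, g1⟩
    apply hne
    apply Subtype.val_injective
    ext a b
    change (pairTensor u v).toMatrix a b = (1 / 2 : ℝ) * (1 : Matrix (Fin 2) (Fin 2) ℝ) a b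
    rw [pairTensor_apply]
    fin_cases a <;> fin_cases b <;> simp <;> linarith
  have key : ((u : Plane) 0 ^ 2 = (z : Plane) 0 ^ 2 ∧
        (u : Plane) 0 * (u : Plane) 1 = (z : Plane) 0 * (z : Plane) 1) ∨
      ((u : Plane) 0 ^ 2 = (w : Plane) 0 ^ 2 ∧
        (u : Plane) 0 * (u : Plane) 1 = (w : Plane) 0 * (w : Plane) 1) := by
    generalize (u : Plane) 0 = u0 at *
    generalize (u : Plane) 1 = u1 at *
    generalize (v : Plane) 0 = v0 at *
    generalize (v : Plane) 1 = v1 at *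
    generalize (z : Plane) 0 = z0 at *
    generalize (z : Plane) 1 = z1 at *
    generalize (w : Plane) 0 = w0 at *
    generalize (w : Plane) 1 = w1 at *
    -- the doubled angles, as unit complex numbers
    let U : ℂ := ⟨2 * u0 ^ 2 - 1, 2 * (u0 * u1)⟩
    let V : ℂ := ⟨2 * v0 ^ 2 - 1, 2 * (v0 * v1)⟩
    let Z : ℂ := ⟨2 * z0 ^ 2 - 1, 2 * (z0 * z1)⟩
    let W : ℂ := ⟨2 * w0 ^ 2 - 1, 2 * (w0 * w1)⟩
    have unit (a b : ℝ) (hab : a ^ 2 + b ^ 2 = 1) :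
        (⟨2 * a ^ 2 - 1, 2 * (a * b)⟩ : ℂ) *
          (starRingEnd ℂ) (⟨2 * a ^ 2 - 1, 2 * (a * b)⟩ : ℂ) = 1 := by
      have hb : b ^ 2 = 1 - a ^ 2 := by linarith
      apply Complex.ext
      · simp
        linear_combination 4 * a ^ 2 * hb
      · simp
        ring
    have hU : U * (starRingEnd ℂ) U = 1 := unit u0 u1 hu
    have hV : V * (starRingEnd ℂ) V = 1 := unit v0 v1 hv
    have hZ : Z * (starRingEnd ℂ) Z = 1 := unit z0 z1 hz
    have hW : W * (starRingEnd ℂ) W = 1 := unit w0 w1 hw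
    have hs : U + V = Z + W := by
      apply Complex.ext
      · simp [U, V, Z, W]
        linarith
      · simp [U, V, Z, W]
        linarith
    have hs' : (starRingEnd ℂ) U + (starRingEnd ℂ) V = (starRingEnd ℂ) Z + (starRingEnd ℂ) W := by
      rw [← map_add, hs, map_add]
    have hs0 : U + V ≠ 0 := by
      intro h0
      apply hne'
      have r := congrArg Complex.re h0
      have i := congrArg Complex.im h0
      simp [U, V] at r i
      constructor <;> linarith
    have hp : U * V = Z * W := by
      have a1 : U + V = U * V * ((starRingEnd ℂ) U + (starRingEnd ℂ) V) := by
        linear_combination (-V) * hU - U * hV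
      have a2 : Z + W = Z * W * ((starRingEnd ℂ) U + (starRingEnd ℂ) V) := by
        rw [hs']
        linear_combination (-W) * hZ - Z * hW
      have c0 : (starRingEnd ℂ) U + (starRingEnd ℂ) V ≠ 0 := by
        intro h0
        apply hs0
        rw [a1, h0, mul_zero]
      apply mul_right_cancel₀ c0
      rw [← a1, ← a2, hs]
    have hf : (U - Z) * (U - W) = 0 := by linear_combination U * hs - hp
    rcases mul_eq_zero.mp hf with h0 | h0
    · left
      have r := congrArg Complex.re h0
      have i := congrArg Complex.im h0
      simp [U, Z] at r i
      constructor <;> linarith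
    · right
      have r := congrArg Complex.re h0
      have i := congrArg Complex.im h0
      simp [U, W] at r i
      constructor <;> linarith
  rcases key with ⟨k0, k1⟩ | ⟨k0, k1⟩
  · exact Or.inl ⟨circ_eq_or_neg u z k0 k1, circ_eq_or_neg v w (by linarith) (by linarith)⟩
  · exact Or.inr ⟨circ_eq_or_neg v z (by linarith) (by linarith), circ_eq_or_neg u w k0 k1⟩

/-- Under the symmetries of `f`, the value of `f̂` does not depend on the choice of the pair. -/
theorem fHat_pairTensor (f : Circ → Circ → ℝ) (hf_exchange : ∀ u v, f u v = f v u)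
    (hf_headtail : ∀ u v, f u (-v) = f u v ∧ f (-u) v = f u v) (u v : Circ)
    (hne : pairTensor u v ≠ halfId) : fHat f (pairTensor u v) = f u v := by
  have h : ∃ p : Circ × Circ, pairTensor p.1 p.2 = pairTensor u v := ⟨(u, v), rfl⟩
  rw [fHat, if_neg hne, dif_pos h]
  rcases pairTensor_eq u v _ _ h.choose_spec.symm hne with ⟨h1 | h1, h2 | h2⟩ | ⟨h1 | h1, h2 | h2⟩
  all_goals
    rw [h1, h2]
    try simp only [(hf_headtail _ _).1, (hf_headtail _ _).2]
    try exact hf_exchange v u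

/-- The convex lower semicontinuous envelope, on a set `C`, of a real function `g` on `C` (that is,
of the function equal to `g` on `C` and to `+∞` elsewhere): the pointwise supremum of the convex
lower semicontinuous functions below `g`. -/
def convexLscEnvelope (C : Set SymMat) (g : SymMat → ℝ) (Q : SymMat) : ℝ :=
  sSup {t | ∃ φ : SymMat → ℝ, ConvexOn ℝ C φ ∧ LowerSemicontinuousOn φ C ∧
    (∀ P ∈ C, φ P ≤ g P) ∧ t = φ Q}

/-- The function `f̂**` on `K`. -/
def fHatEnvelope (f : Circ → Circ → ℝ) : SymMat → ℝ := convexLscEnvelope tensorBody (fHat f)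

open Classical in
/-- The limit functional: `4 ∫_Ω f̂**(Q) dx` on `L^∞(Ω; K)`, and `+∞` elsewhere. -/
def limitFunctional (f : Circ → Circ → ℝ) (Ω : Set Plane) (Q : LinftySym Ω) : EReal :=
  if ∀ᵐ x ∂(volume.restrict Ω), Q x ∈ tensorBody then
    ((4 * ∫ x in Ω, fHatEnvelope f (Q x) : ℝ) : EReal)
  else ⊤

/-! ## The homogenization formula -/

/-- The cube `h W = [-h/2, h/2)²`. -/
def bigCube (h : ℝ) : Set Plane := {x | ∀ a, -(h / 2) ≤ x a ∧ x a < h / 2}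

/-- The average of `u_i ⊗ u_i` over the points `i` of `ℤ²` in `A`. -/
def discreteAverage (A : Set Plane) (u : (Fin 2 → ℤ) → Circ) : SymMat :=
  ((latticePoints 1 A).ncard : ℝ)⁻¹ • ∑ᶠ i ∈ latticePoints 1 A, tensorSq (u i)

/-- `h⁻²` times the infimum of the energies on the cube `h W`, with lattice spacing one, of the
configurations whose discrete average lies in the closed ball of center `Q` and radius `ρ`. -/
def cellProblem (f : Circ → Circ → ℝ) (Q : SymMat) (ρ h : ℝ) : EReal :=
  ⨅ (u : (Fin 2 → ℤ) → Circ)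
    (_ : discreteAverage (bigCube h) u ∈ Metric.closedBall Q ρ),
    ((1 / h ^ 2 * spinEnergy f 1 (bigCube h) u : ℝ) : EReal)

/-- `f_hom(Q) = c`, where `f_hom(Q) = lim_{ρ → 0} lim_{h → ∞}` of the cell problems; both limits
are required to exist. -/
def HasHomogenizedDensity (f : Circ → Circ → ℝ) (Q : SymMat) (c : ℝ) : Prop :=
  ∃ m : ℝ → EReal, (∀ ρ > 0, Tendsto (fun h : ℝ => cellProblem f Q ρ h) atTop (𝓝 (m ρ))) ∧
    Tendsto m (𝓝[>] 0) (𝓝 (c : EReal))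

end

/-! To a bond (i, j) attach the matrix (u_i ⊗ u_i + u_j ⊗ u_j)/2. In terms of doubled angles K is a
disc whose boundary circle consists of the tensor squares, and each point of the disc is the
midpoint of a chord; so these matrices fill K (`exists_pairTensor_eq`). The density f̂ is thus
defined on all of K, and the factor 4 is the number of directed bonds that start at a site.

Everything rests on a dual description of f̂**. Since matrices in K have trace one, affine functions
on K have the form Q ↦ A : Q, and f̂** is the supremum of these over the A with A : (u ⊗ u + v ⊗
v)/2 ≤ f(u, v) for all u, v (`fHatEnvelope_eq`). By Hahn-Banach
(`mem_closure_convexHull_pairEpigraph`), the point (Q, f̂**(Q)) is also a limit of convex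
combinations of points above pairs, and Carathéodory's theorem bounds the number of terms
(`exists_convex_combination`).

Lower bound. If A is a continuous field of such minorants, then f(u_i, u_j) is at least A(εi) paired
with the bond matrix. Exchanging the two ends of each bond, a site collects 4 A(εi) : u_i ⊗ u_i, up
to the oscillation of A at scale ε and the bonds that leave Ω (`sum_minorants_le_bondSum`,
`field_le_spinEnergy`). The resulting bound 4 ∫ A : Q is weak* continuous in Q, and its supremum
over A is 4 ∫ f̂**(Q) (`exists_field`). If Q leaves K on a set of positive measure, a weak*
continuous functional separates it from all K-valued functions (`exists_separating_pairing`).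

Upper bound. A convex combination of pairs is realised on an n × n square by parallel strips whose
widths are the weights; within a strip the two vectors of a pair form a checkerboard, so that every
bond inside the strip sees exactly that pair. Interfaces and rounding cost O(n) against n²
(`exists_pattern`). Filling blocks of side εn with patterns for the block averages of Q and applying
Jensen's inequality gives the recovery family (`exists_block_recovery`), with n of order ε^(-1/2).
Lipschitz regularity makes ∂Ω a null set, so all boundary layers vanish in the limit
(`tendsto_layerArea`).

The homogenization formula uses the same two bounds on a single cube, with a constant minorant and a
single pattern (`hasHomogenizedDensity`). -/

noncomputable section

/-! ## Coordinates on `SymMat` -/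

section coordinates

theorem SymMat.toMatrix_comm (A : SymMat) (a b : Fin 2) : A.toMatrix a b = A.toMatrix b a :=
  Matrix.IsSymm.apply (Subtype.prop (p := fun B => B ∈ symMatrices) A) b a

theorem SymMat.ext_entries {A B : SymMat} (h0 : A.toMatrix 0 0 = B.toMatrix 0 0)
    (h1 : A.toMatrix 0 1 = B.toMatrix 0 1) (h2 : A.toMatrix 1 1 = B.toMatrix 1 1) : A = B := by
  apply Subtype.val_injective
  ext a b
  change A.toMatrix a b = B.toMatrix a b
  fin_cases a <;> fin_cases b
  · exact h0
  · exact h1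
  · exact (A.toMatrix_comm 1 0).trans (h1.trans (B.toMatrix_comm 0 1))
  · exact h2

theorem SymMat.toMatrix_add (A B : SymMat) (a b : Fin 2) :
    (A + B).toMatrix a b = A.toMatrix a b + B.toMatrix a b := rfl

theorem SymMat.toMatrix_smul (c : ℝ) (A : SymMat) (a b : Fin 2) :
    (c • A).toMatrix a b = c * A.toMatrix a b := rfl

theorem tensorSq_apply (u : Circ) (a b : Fin 2) :
    (tensorSq u).toMatrix a b = (u : Plane) a * (u : Plane) b := rfl

/-- The symmetric matrix with diagonal `p, r` and off-diagonal entry `q`. -/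
def symOf (p q r : ℝ) : SymMat :=
  (⟨!![p, q; q, r], by ext a b; fin_cases a <;> fin_cases b <;> rfl⟩ : symMatrices)

@[simp] theorem symOf_zero_zero (p q r : ℝ) : (symOf p q r).toMatrix 0 0 = p := rfl
@[simp] theorem symOf_zero_one (p q r : ℝ) : (symOf p q r).toMatrix 0 1 = q := rfl
@[simp] theorem symOf_one_one (p q r : ℝ) : (symOf p q r).toMatrix 1 1 = r := rfl

instance : FiniteDimensional ℝ SymMat :=
  inferInstanceAs (FiniteDimensional ℝ symMatrices)

/-- An entry, as a linear functional. -/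
def entryL (a b : Fin 2) : SymMat →L[ℝ] ℝ :=
  LinearMap.toContinuousLinearMap
    { toFun := fun A => A.toMatrix a b
      map_add' := fun _ _ => rfl
      map_smul' := fun _ _ => rfl }

theorem entryL_apply (a b : Fin 2) (A : SymMat) : entryL a b A = A.toMatrix a b := rfl

theorem SymMat.norm_sq (A : SymMat) : ‖A‖ ^ 2 =
    A.toMatrix 0 0 ^ 2 + 2 * A.toMatrix 0 1 ^ 2 + A.toMatrix 1 1 ^ 2 := by
  have h : ‖A‖ = (∑ a, ∑ b, ‖A.toMatrix a b‖ ^ (2 : ℝ)) ^ (1 / 2 : ℝ) :=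
    Matrix.frobenius_norm_def _
  rw [h, ← Real.sqrt_eq_rpow, Real.sq_sqrt (by positivity)]
  simp only [Fin.sum_univ_two, Real.rpow_two, Real.norm_eq_abs, sq_abs]
  rw [A.toMatrix_comm 1 0]
  ring

theorem frobInner_eq (A B : SymMat) : frobInner A B = A.toMatrix 0 0 * B.toMatrix 0 0 +
    2 * (A.toMatrix 0 1 * B.toMatrix 0 1) + A.toMatrix 1 1 * B.toMatrix 1 1 := by
  simp only [frobInner, Fin.sum_univ_two]
  rw [A.toMatrix_comm 1 0, B.toMatrix_comm 1 0]
  ring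

/-- The Frobenius scalar product, as a continuous bilinear form. -/
def frobL : SymMat →L[ℝ] SymMat →L[ℝ] ℝ :=
  LinearMap.mkContinuous₂
    (LinearMap.mk₂ ℝ frobInner
      (fun A A' B => by simp only [frobInner_eq, SymMat.toMatrix_add]; ring)
      (fun c A B => by simp only [frobInner_eq, SymMat.toMatrix_smul, smul_eq_mul]; ring)
      (fun A B B' => by simp only [frobInner_eq, SymMat.toMatrix_add]; ring)
      (fun c A B => by simp only [frobInner_eq, SymMat.toMatrix_smul, smul_eq_mul]; ring)) 1
    (fun A B => by
      rw [LinearMap.mk₂_apply, Real.norm_eq_abs, one_mul, frobInner_eq]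
      apply abs_le_of_sq_le_sq _ (by positivity)
      rw [mul_pow, A.norm_sq, B.norm_sq]
      generalize A.toMatrix 0 0 = a
      generalize A.toMatrix 0 1 = b
      generalize A.toMatrix 1 1 = c
      generalize B.toMatrix 0 0 = x
      generalize B.toMatrix 0 1 = y
      generalize B.toMatrix 1 1 = z
      -- Lagrange's identity with weights 1, 2, 1: the gap is 2(ay - bx)² + (az - cx)² + 2(bz -
      -- cy)².
      nlinarith [sq_nonneg (a * y - b * x), sq_nonneg (a * z - c * x), sq_nonneg (b * z - c * y)])

theorem frobL_apply (A B : SymMat) : frobL A B = frobInner A B := rfl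

theorem abs_frobL_le (A B : SymMat) : |frobL A B| ≤ ‖A‖ * ‖B‖ := by
  have h : ‖frobL‖ ≤ 1 := LinearMap.mkContinuous₂_norm_le _ zero_le_one _
  calc |frobL A B| = ‖frobL A B‖ := rfl
    _ ≤ ‖frobL‖ * ‖A‖ * ‖B‖ := frobL.le_opNorm₂ A B
    _ ≤ 1 * ‖A‖ * ‖B‖ := by gcongr
    _ = _ := by ring

/-- Every linear functional is a Frobenius scalar product. -/
theorem exists_frobL_eq (l : SymMat →L[ℝ] ℝ) : ∃ A, ∀ B, frobL A B = l B := by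
  refine ⟨symOf (l (symOf 1 0 0)) (l (symOf 0 1 0) / 2) (l (symOf 0 0 1)), fun B => ?_⟩
  have hB : B = B.toMatrix 0 0 • symOf 1 0 0 + B.toMatrix 0 1 • symOf 0 1 0 +
      B.toMatrix 1 1 • symOf 0 0 1 := by
    apply SymMat.ext_entries <;> simp [SymMat.toMatrix_add, SymMat.toMatrix_smul]
  rw [frobL_apply, frobInner_eq]
  conv_rhs => rw [hB]
  simp only [map_add, map_smul, smul_eq_mul, symOf_zero_zero, symOf_zero_one, symOf_one_one]
  ring

end coordinates

/-! ## The body `K` -/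

section body

/-- In this form K is an intersection of sets cut out by conditions affine in Q, from which
convexity and closedness can be read off. -/
theorem mem_tensorBody_iff {Q : SymMat} : Q ∈ tensorBody ↔
    Q.toMatrix 0 0 + Q.toMatrix 1 1 = 1 ∧ ∀ a b : ℝ,
      0 ≤ a ^ 2 * Q.toMatrix 0 0 + 2 * (a * b * Q.toMatrix 0 1) + b ^ 2 * Q.toMatrix 1 1 := by
  have htr : Q.toMatrix.trace = Q.toMatrix 0 0 + Q.toMatrix 1 1 := by
    simp [Matrix.trace, Fin.sum_univ_two]
  have hsum (a b : ℝ) : star ![a, b] ⬝ᵥ (Q.toMatrix.mulVec ![a, b]) =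
      a ^ 2 * Q.toMatrix 0 0 + 2 * (a * b * Q.toMatrix 0 1) + b ^ 2 * Q.toMatrix 1 1 := by
    simp only [dotProduct, Matrix.mulVec, Fin.sum_univ_two]
    rw [Q.toMatrix_comm 1 0]
    simp
    ring
  constructor
  · rintro ⟨h1, h2⟩
    refine ⟨htr ▸ h2, fun a b => ?_⟩
    rw [← hsum]
    exact h1.dotProduct_mulVec_nonneg _
  · rintro ⟨h1, h2⟩
    refine ⟨Matrix.PosSemidef.of_dotProduct_mulVec_nonneg ?_ fun x => ?_, htr.trans h1⟩
    · ext a b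
      simp only [Matrix.conjTranspose_apply, star_trivial]
      exact Q.toMatrix_comm b a
    · have hx : x = ![x 0, x 1] := by ext a; fin_cases a <;> rfl
      rw [hx, hsum]
      exact h2 _ _

theorem convex_tensorBody : Convex ℝ tensorBody := by
  intro P hP Q hQ s t hs ht hst
  rw [mem_tensorBody_iff] at *
  simp only [SymMat.toMatrix_add, SymMat.toMatrix_smul]
  refine ⟨by linear_combination s * hP.1 + t * hQ.1 + hst, fun a b => ?_⟩
  have h1 := mul_nonneg hs (hP.2 a b)
  have h2 := mul_nonneg ht (hQ.2 a b)
  linarith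

theorem isClosed_tensorBody : IsClosed tensorBody := by
  have h : tensorBody = {Q | entryL 0 0 Q + entryL 1 1 Q = 1} ∩ ⋂ (a : ℝ) (b : ℝ),
      {Q | 0 ≤ a ^ 2 * entryL 0 0 Q + 2 * (a * b * entryL 0 1 Q) + b ^ 2 * entryL 1 1 Q} := by
    ext Q
    simp only [mem_tensorBody_iff, mem_inter_iff, mem_ofPred_eq, mem_iInter, entryL_apply]
  rw [h]
  refine (isClosed_eq (by fun_prop) continuous_const).inter ?_
  exact isClosed_iInter fun a => isClosed_iInter fun b =>
    isClosed_le continuous_const (by fun_prop)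

theorem det_nonneg_of_mem_tensorBody {Q : SymMat} (hQ : Q ∈ tensorBody) :
    Q.toMatrix 0 1 ^ 2 ≤ Q.toMatrix 0 0 * Q.toMatrix 1 1 := by
  have h := (mem_tensorBody_iff.mp hQ).2
  have h2 := discrim_le_zero (a := Q.toMatrix 0 0) (b := 2 * Q.toMatrix 0 1)
    (c := Q.toMatrix 1 1) fun x => by linarith [h x 1]
  rw [discrim] at h2
  linarith

/-- The squared Frobenius norm is the squared trace minus twice the determinant. -/
theorem norm_le_one_of_mem_tensorBody {Q : SymMat} (hQ : Q ∈ tensorBody) : ‖Q‖ ≤ 1 := by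
  have h1 := (mem_tensorBody_iff.mp hQ).1
  have h2 := det_nonneg_of_mem_tensorBody hQ
  have h3 : ‖Q‖ ^ 2 ≤ 1 ^ 2 := by
    rw [Q.norm_sq]
    nlinarith
  exact (sq_le_sq₀ (norm_nonneg _) zero_le_one).mp h3

theorem tensorSq_mem (u : Circ) : tensorSq u ∈ tensorBody := by
  rw [mem_tensorBody_iff]
  simp only [tensorSq_apply]
  refine ⟨by linarith [circ_sq u], fun a b => ?_⟩
  nlinarith [sq_nonneg (a * (u : Plane) 0 + b * (u : Plane) 1)]

theorem pairTensor_mem (u v : Circ) : pairTensor u v ∈ tensorBody := by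
  rw [pairTensor, smul_add]
  exact convex_tensorBody (tensorSq_mem u) (tensorSq_mem v) (by norm_num) (by norm_num)
    (by norm_num)

theorem norm_tensorSq_le (u : Circ) : ‖tensorSq u‖ ≤ 1 :=
  norm_le_one_of_mem_tensorBody (tensorSq_mem u)

/-- The point of the circle at a given angle. -/
def circAngle (t : ℝ) : Circ :=
  ⟨!₂[Real.cos t, Real.sin t], by
    rw [mem_sphere_zero_iff_norm, ← sq_eq_sq₀ (norm_nonneg _) zero_le_one,
      EuclideanSpace.real_norm_sq_eq]
    simp⟩

/-- Every element of `K` is the mean of two tensor squares. -/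
theorem exists_pairTensor_eq {Q : SymMat} (hQ : Q ∈ tensorBody) : ∃ u v, pairTensor u v = Q := by
  have h1 := (mem_tensorBody_iff.mp hQ).1
  have h2 := det_nonneg_of_mem_tensorBody hQ
  -- The tensor square of the vector at angle t corresponds to exp(2it), and Q to z in the closed
  -- unit disc. With cos α = |z| and θ = arg z, the point z is the midpoint of exp(i(θ + α)) and
  -- exp(i(θ - α)); halving these angles gives u and v.
  set z : ℂ := ⟨2 * Q.toMatrix 0 0 - 1, 2 * Q.toMatrix 0 1⟩ with hz
  have hz1 : ‖z‖ ≤ 1 := by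
    have : ‖z‖ ^ 2 ≤ 1 := by
      rw [← Complex.normSq_eq_norm_sq, Complex.normSq_apply]
      have : Q.toMatrix 1 1 = 1 - Q.toMatrix 0 0 := by linarith
      rw [this] at h2
      simp only [hz]
      nlinarith
    nlinarith [norm_nonneg z]
  set α := Real.arccos ‖z‖
  set θ := z.arg
  have hα : Real.cos α = ‖z‖ := Real.cos_arccos (by linarith [norm_nonneg z]) hz1
  have hre : ‖z‖ * Real.cos θ = 2 * Q.toMatrix 0 0 - 1 := Complex.norm_mul_cos_arg z
  have him : ‖z‖ * Real.sin θ = 2 * Q.toMatrix 0 1 := Complex.norm_mul_sin_arg z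
  have c0 (t : ℝ) : ((circAngle t : Circ) : Plane) 0 = Real.cos t := rfl
  have c1 (t : ℝ) : ((circAngle t : Circ) : Plane) 1 = Real.sin t := rfl
  have s1 := Real.sin_sq_add_cos_sq ((θ + α) / 2)
  have s2 := Real.sin_sq_add_cos_sq ((θ - α) / 2)
  have e1 : Real.cos ((θ + α) / 2) ^ 2 + Real.cos ((θ - α) / 2) ^ 2 = 2 * Q.toMatrix 0 0 := by
    rw [Real.cos_sq, Real.cos_sq, show 2 * ((θ + α) / 2) = θ + α by ring,
      show 2 * ((θ - α) / 2) = θ - α by ring, Real.cos_add, Real.cos_sub, hα]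
    linarith
  have e2 : Real.cos ((θ + α) / 2) * Real.sin ((θ + α) / 2) +
      Real.cos ((θ - α) / 2) * Real.sin ((θ - α) / 2) = 2 * Q.toMatrix 0 1 := by
    have a1 := Real.sin_two_mul ((θ + α) / 2)
    have a2 := Real.sin_two_mul ((θ - α) / 2)
    rw [show 2 * ((θ + α) / 2) = θ + α by ring, Real.sin_add, hα] at a1
    rw [show 2 * ((θ - α) / 2) = θ - α by ring, Real.sin_sub, hα] at a2
    linarith
  refine ⟨circAngle ((θ + α) / 2), circAngle ((θ - α) / 2), ?_⟩
  apply SymMat.ext_entries <;> rw [pairTensor_apply] <;> simp only [c0, c1] <;> linarith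

theorem frobL_pairTensor (A : SymMat) (u v : Circ) :
    frobL A (pairTensor u v) = (frobL A (tensorSq u) + frobL A (tensorSq v)) / 2 := by
  rw [pairTensor, map_smul, map_add, smul_eq_mul]
  ring

/-- Multiples of the identity pair to constants on K because of the trace condition. Hence linear
functionals already represent all affine functions on K, and no constant term is carried along. -/
theorem frobL_symOf_of_mem (c : ℝ) {Q : SymMat} (hQ : Q ∈ tensorBody) :
    frobL (symOf c 0 c) Q = c := by
  have h := (mem_tensorBody_iff.mp hQ).1
  rw [frobL_apply, frobInner_eq]
  simp only [symOf_zero_zero, symOf_zero_one, symOf_one_one]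
  linear_combination c * h

theorem inner_eq_zero_iff_pairTensor (u v : Circ) :
    inner ℝ (u : Plane) (v : Plane) = 0 ↔ pairTensor u v = halfId := by
  have hu := circ_sq u
  have hv := circ_sq v
  have hin : inner ℝ (u : Plane) (v : Plane) =
      (u : Plane) 0 * (v : Plane) 0 + (u : Plane) 1 * (v : Plane) 1 := by
    simp [PiLp.inner_apply, Fin.sum_univ_two, mul_comm]
  have h00 : halfId.toMatrix 0 0 = 1 / 2 := by change (1 / 2 : ℝ) * _ = _; simp
  have h01 : halfId.toMatrix 0 1 = 0 := by change (1 / 2 : ℝ) * _ = _; simp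
  have h11 : halfId.toMatrix 1 1 = 1 / 2 := by change (1 / 2 : ℝ) * _ = _; simp
  rw [hin]
  generalize ha : (u : Plane) 0 = a at *
  generalize hb : (u : Plane) 1 = b at *
  generalize hc : (v : Plane) 0 = c at *
  generalize hd : (v : Plane) 1 = d at *
  constructor
  · intro h
    -- The determinant t = ad - bc of two orthonormal vectors is ±1, and v is t times the quarter
    -- turn (-b, a) of u.
    have ht : (a * d - b * c) ^ 2 = 1 := by
      linear_combination (c ^ 2 + d ^ 2) * hu + hv - (a * c + b * d) * h
    have hc' : c = -b * (a * d - b * c) := by linear_combination (-c) * hu + a * h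
    have hd' : d = a * (a * d - b * c) := by linear_combination (-d) * hu + b * h
    generalize a * d - b * c = t at *
    subst hc' hd'
    apply SymMat.ext_entries <;> rw [pairTensor_apply] <;> simp only [ha, hb, hc, hd, h00, h01, h11]
    · linear_combination (1 / 2 : ℝ) * hu + b ^ 2 / 2 * ht
    · linear_combination (-(a * b) / 2) * ht
    · linear_combination (1 / 2 : ℝ) * hu + a ^ 2 / 2 * ht
  · intro h
    have g0 := congrArg (fun Q : SymMat => Q.toMatrix 0 0) h
    have g1 := congrArg (fun Q : SymMat => Q.toMatrix 0 1) h
    simp only [pairTensor_apply, ha, hb, hc, hd, h00, h01] at g0 g1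
    have : (a * c + b * d) ^ 2 = 0 := by
      have hb2 : b ^ 2 = 1 - a ^ 2 := by linarith
      have hc2 : c ^ 2 = 1 - a ^ 2 := by linarith
      have hd2 : d ^ 2 = a ^ 2 := by linarith
      have : c * d = - (a * b) := by linarith
      calc (a * c + b * d) ^ 2 = a ^ 2 * c ^ 2 + b ^ 2 * d ^ 2 + 2 * (a * b) * (c * d) := by ring
        _ = _ := by rw [this]; linear_combination a ^ 2 * hc2 + b ^ 2 * hd2 + (-2*a^2+a^2)*hb2 
    exact pow_eq_zero_iff two_ne_zero |>.mp this

end body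

/-! ## The envelope as a supremum of linear functionals -/

section envelope

variable {f : Circ → Circ → ℝ} {C : ℝ}

/-- The linear functionals that lie below `f` on all pairs. As matrices in `K` have trace one,
these represent all affine minorants. -/
def minorants (f : Circ → Circ → ℝ) : Set SymMat :=
  {A | ∀ u v, frobL A (pairTensor u v) ≤ f u v}

/-- The supremum of the affine minorants. -/
def supMinorants (f : Circ → Circ → ℝ) (Q : SymMat) : ℝ :=
  sSup ((fun A => frobL A Q) '' minorants f)

/-- Convexity is what allows minorants to be glued by continuous weights in
`exists_field_partialSups`. -/
theorem convex_minorants : Convex ℝ (minorants f) := by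
  intro A hA B hB s t hs ht hst u v
  have h1 := mul_le_mul_of_nonneg_left (hA u v) hs
  have h2 := mul_le_mul_of_nonneg_left (hB u v) ht
  simp only [map_add, map_smul, add_apply, smul_apply,
    smul_eq_mul]
  calc _ ≤ s * f u v + t * f u v := add_le_add h1 h2
    _ = f u v := by rw [← add_mul, hst, one_mul]

theorem const_mem_minorants (hC : ∀ u v, |f u v| ≤ C) : symOf (-C) 0 (-C) ∈ minorants f :=
  fun u v => by
    rw [frobL_symOf_of_mem _ (pairTensor_mem u v)]
    exact neg_le_of_abs_le (hC u v)

/-- The constraint is imposed on pairs only, but the pairs exhaust K. -/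
theorem minorants_le (hC : ∀ u v, |f u v| ≤ C) {A Q : SymMat} (hA : A ∈ minorants f)
    (hQ : Q ∈ tensorBody) : frobL A Q ≤ C := by
  obtain ⟨u, v, rfl⟩ := exists_pairTensor_eq hQ
  exact (hA u v).trans (le_of_abs_le (hC u v))

theorem le_supMinorants (hC : ∀ u v, |f u v| ≤ C) {A Q : SymMat} (hA : A ∈ minorants f)
    (hQ : Q ∈ tensorBody) : frobL A Q ≤ supMinorants f Q :=
  le_csSup ⟨C, by rintro _ ⟨B, hB, rfl⟩; exact minorants_le hC hB hQ⟩ ⟨A, hA, rfl⟩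

theorem supMinorants_le (hC : ∀ u v, |f u v| ≤ C) {Q : SymMat} {t : ℝ}
    (h : ∀ A ∈ minorants f, frobL A Q ≤ t) : supMinorants f Q ≤ t :=
  csSup_le ⟨_, _, const_mem_minorants hC, rfl⟩ (by rintro _ ⟨B, hB, rfl⟩; exact h B hB)

theorem exists_lt_frobL (hC : ∀ u v, |f u v| ≤ C) {Q : SymMat} {t : ℝ}
    (h : t < supMinorants f Q) : ∃ A ∈ minorants f, t < frobL A Q := by
  by_contra! h'
  exact (supMinorants_le hC h').not_gt h

theorem abs_supMinorants_le (hC : ∀ u v, |f u v| ≤ C) {Q : SymMat} (hQ : Q ∈ tensorBody) :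
    |supMinorants f Q| ≤ C := by
  refine abs_le.mpr ⟨?_, supMinorants_le hC fun A hA => minorants_le hC hA hQ⟩
  have h := le_supMinorants hC (const_mem_minorants hC) hQ
  rwa [frobL_symOf_of_mem _ hQ] at h

theorem convexOn_supMinorants (hC : ∀ u v, |f u v| ≤ C) :
    ConvexOn ℝ tensorBody (supMinorants f) := by
  refine ⟨convex_tensorBody, fun P hP Q hQ s t hs ht _ => supMinorants_le hC fun A hA => ?_⟩
  rw [map_add, map_smul, map_smul]
  exact add_le_add (mul_le_mul_of_nonneg_left (le_supMinorants hC hA hP) hs)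
    (mul_le_mul_of_nonneg_left (le_supMinorants hC hA hQ) ht)

/-- The epigraph of `f` over the pairs, as a subset of `SymMat × ℝ`. -/
def pairEpigraph (f : Circ → Circ → ℝ) : Set (SymMat × ℝ) :=
  {p | ∃ u v, p.1 = pairTensor u v ∧ f u v ≤ p.2}

/-- The primal form of the envelope. A functional (A, b) that strictly separates the point from the
hull would, after division by b, give an affine minorant with a value at Q above the supremum of all
minorants. -/
theorem mem_closure_convexHull_pairEpigraph (hC : ∀ u v, |f u v| ≤ C) {Q : SymMat}
    (hQ : Q ∈ tensorBody) :
    (Q, supMinorants f Q) ∈ closure (convexHull ℝ (pairEpigraph f)) := by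
  by_contra hmem
  obtain ⟨l, c, hl1, hl2⟩ := geometric_hahn_banach_point_closed
    (convex_convexHull ℝ (pairEpigraph f)).closure isClosed_closure hmem
  obtain ⟨A, hA⟩ := exists_frobL_eq (l.comp (ContinuousLinearMap.inl ℝ SymMat ℝ))
  set b := l (0, 1)
  have hl (P : SymMat) (t : ℝ) : l (P, t) = frobL A P + t * b := by
    rw [hA]
    have : ((P, t) : SymMat × ℝ) = (P, 0) + t • (0, 1) := by simp
    rw [this, map_add, map_smul]
    simp [b]
  have hpair (u v : Circ) (t : ℝ) (ht : f u v ≤ t) : c < frobL A (pairTensor u v) + t * b := by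
    rw [← hl]
    exact hl2 _ (subset_closure (subset_convexHull ℝ _ ⟨u, v, rfl, ht⟩))
  rw [hl] at hl1
  obtain ⟨u, v, huv⟩ := exists_pairTensor_eq hQ
  -- The epigraph is unbounded upwards, so a negative b would make the functional unbounded below on
  -- it.
  have hb0 : 0 ≤ b := by
    by_contra! hb
    have h := hpair u v (max (f u v) ((c - frobL A (pairTensor u v)) / b)) (le_max_left _ _)
    have h2 : max (f u v) ((c - frobL A (pairTensor u v)) / b) * b ≤
        (c - frobL A (pairTensor u v)) / b * b :=
      mul_le_mul_of_nonpos_right (le_max_right _ _) hb.le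
    rw [div_mul_cancel₀ _ hb.ne] at h2
    linarith
  -- A vertical hyperplane, b = 0, would separate Q from all pair tensors, although Q is one of
  -- them.
  rcases hb0.eq_or_lt with hb | hb
  · have h := hpair u v _ le_rfl
    rw [← hb, mul_zero, add_zero] at h hl1
    rw [huv] at h
    exact lt_asymm h hl1
  -- The affine function (c - A : P)/b lies below f on pairs; the constant c/b enters as a multiple
  -- of the identity.
  · have hmin : symOf (c / b) 0 (c / b) - b⁻¹ • A ∈ minorants f := by
      intro u v
      rw [map_sub, sub_apply, frobL_symOf_of_mem _ (pairTensor_mem u v),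
        map_smul, smul_apply, smul_eq_mul, div_eq_inv_mul, ← mul_sub,
        inv_mul_le_iff₀ hb]
      linarith [hpair u v _ le_rfl]
    have h := le_supMinorants hC hmin hQ
    rw [map_sub, sub_apply, frobL_symOf_of_mem _ hQ, map_smul,
      smul_apply, smul_eq_mul, div_eq_inv_mul, ← mul_sub,
      inv_mul_le_iff₀ hb] at h
    linarith

theorem fHat_pairTensor_le (hC : ∀ u v, |f u v| ≤ C) (hf_exchange : ∀ u v, f u v = f v u)
    (hf_headtail : ∀ u v, f u (-v) = f u v ∧ f (-u) v = f u v) (u v : Circ) :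
    fHat f (pairTensor u v) ≤ f u v := by
  by_cases h : pairTensor u v = halfId
  · rw [fHat, if_pos h]
    refine csInf_le ⟨-C, ?_⟩ ⟨u, v, (inner_eq_zero_iff_pairTensor u v).mpr h, rfl⟩
    rintro _ ⟨u', v', -, rfl⟩
    exact neg_le_of_abs_le (hC u' v')
  · exact (fHat_pairTensor f hf_exchange hf_headtail u v h).le

/-- At I/2 the infimum in f̂ runs over orthogonal pairs, which are exactly the pairs with tensor
I/2; elsewhere the pair is unique up to order and signs. -/
theorem minorants_le_fHat (hf_exchange : ∀ u v, f u v = f v u)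
    (hf_headtail : ∀ u v, f u (-v) = f u v ∧ f (-u) v = f u v) {A Q : SymMat}
    (hA : A ∈ minorants f) (hQ : Q ∈ tensorBody) : frobL A Q ≤ fHat f Q := by
  obtain ⟨u, v, rfl⟩ := exists_pairTensor_eq hQ
  by_cases h : pairTensor u v = halfId
  · rw [fHat, if_pos h]
    refine le_csInf ⟨_, u, v, (inner_eq_zero_iff_pairTensor u v).mpr h, rfl⟩ ?_
    rintro _ ⟨u', v', h', rfl⟩
    rw [h, ← (inner_eq_zero_iff_pairTensor u' v').mp h']
    exact hA u' v'
  · rw [fHat_pairTensor f hf_exchange hf_headtail u v h]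
    exact hA u v

/-- On `K`, the convex lower semicontinuous envelope of `f̂` is the supremum of its affine
minorants. -/
theorem fHatEnvelope_eq (hC : ∀ u v, |f u v| ≤ C) (hf_exchange : ∀ u v, f u v = f v u)
    (hf_headtail : ∀ u v, f u (-v) = f u v ∧ f (-u) v = f u v) {Q : SymMat}
    (hQ : Q ∈ tensorBody) : fHatEnvelope f Q = supMinorants f Q := by
  have hmem (A : SymMat) (hA : A ∈ minorants f) : ∃ φ : SymMat → ℝ, ConvexOn ℝ tensorBody φ ∧
      LowerSemicontinuousOn φ tensorBody ∧ (∀ P ∈ tensorBody, φ P ≤ fHat f P) ∧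
      frobL A Q = φ Q :=
    ⟨frobL A, (frobL A).toLinearMap.convexOn convex_tensorBody,
      (frobL A).continuous.lowerSemicontinuous.lowerSemicontinuousOn _,
      fun P hP => minorants_le_fHat hf_exchange hf_headtail hA hP, rfl⟩
  apply le_antisymm
  · refine csSup_le ⟨_, hmem _ (const_mem_minorants hC)⟩ ?_
    rintro _ ⟨φ, hφc, hφl, hφf, rfl⟩
    by_contra! hlt
    obtain ⟨c, hc1, hc2⟩ := exists_between hlt
    -- A convex function below f̂ has a convex epigraph containing all pairs, hence their convex
    -- hull.
    have hepi : ∀ p ∈ convexHull ℝ (pairEpigraph f), p.1 ∈ tensorBody ∧ φ p.1 ≤ p.2 := by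
      have hconv : Convex ℝ {p : SymMat × ℝ | p.1 ∈ tensorBody ∧ φ p.1 ≤ p.2} :=
        hφc.convex_epigraph
      refine fun p hp => convexHull_min (t := {p : SymMat × ℝ | p.1 ∈ tensorBody ∧ φ p.1 ≤ p.2})
        ?_ hconv hp
      rintro ⟨P, t⟩ ⟨u, v, rfl, hu⟩
      exact ⟨pairTensor_mem u v, (hφf _ (pairTensor_mem u v)).trans
        ((fHat_pairTensor_le hC hf_exchange hf_headtail u v).trans hu)⟩
    -- Lower semicontinuity carries the inequality from the hull to its closure, which contains (Q,
    -- `supMinorants f Q`).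
    have h1 : ∀ᶠ P in 𝓝[tensorBody] Q, c < φ P := hφl Q hQ c hc2
    rw [eventually_nhdsWithin_iff] at h1
    have h2 : ∀ᶠ p : SymMat × ℝ in 𝓝 (Q, supMinorants f Q),
        (p.1 ∈ tensorBody → c < φ p.1) ∧ p.2 < c := by
      have k1 : Tendsto Prod.fst (𝓝 (Q, supMinorants f Q)) (𝓝 Q) := continuous_fst.tendsto _
      have k2 : Tendsto Prod.snd (𝓝 (Q, supMinorants f Q)) (𝓝 (supMinorants f Q)) :=
        continuous_snd.tendsto _
      exact (k1.eventually h1).and (k2.eventually (gt_mem_nhds hc1))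
    obtain ⟨p, hp1, hp2⟩ := (mem_closure_iff_frequently.mp
      (mem_closure_convexHull_pairEpigraph hC hQ)).and_eventually h2 |>.exists
    have := hepi p hp1
    linarith [hp2.1 this.1, hp2.2]
  · refine supMinorants_le hC fun A hA => le_csSup ⟨fHat f Q, ?_⟩ (hmem A hA)
    rintro _ ⟨φ, -, -, hφf, rfl⟩
    exact hφf Q hQ

/-- Near each point of `K`, the envelope is nearly attained by a convex combination of a bounded
number of pairs. -/
theorem exists_convex_combination (hC : ∀ u v, |f u v| ≤ C) : ∃ N : ℕ, ∀ Q ∈ tensorBody,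
    ∀ δ > 0, ∃ (M : ℕ) (w : ℕ → ℝ) (u v : ℕ → Circ), M ≤ N ∧ (∀ m, 0 ≤ w m) ∧
      ∑ m ∈ Finset.range M, w m = 1 ∧
      ‖∑ m ∈ Finset.range M, w m • pairTensor (u m) (v m) - Q‖ ≤ δ ∧
      ∑ m ∈ Finset.range M, w m * f (u m) (v m) ≤ supMinorants f Q + δ := by
  -- Carathéodory's theorem: an affinely independent family in this space has at most dimension plus
  -- one members. The bound depends on neither Q nor δ, which later makes the error constant of the
  -- patterns uniform.
  refine ⟨Module.finrank ℝ (SymMat × ℝ) + 1, fun Q hQ δ hδ => ?_⟩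
  obtain ⟨p, hp, hpd⟩ := Metric.mem_closure_iff.mp
    (mem_closure_convexHull_pairEpigraph hC hQ) δ hδ
  obtain ⟨ι, _, z, w, hz, hind, hw, hw1, hsum⟩ := eq_pos_convex_span_of_mem_convexHull hp
  have hcard : Fintype.card ι ≤ Module.finrank ℝ (SymMat × ℝ) + 1 :=
    hind.card_le_finrank_succ.trans (by gcongr; exact Submodule.finrank_le _)
  let e := (Fintype.equivFin ι).symm
  have hz' : ∀ m, ∃ u v, (z (e m)).1 = pairTensor u v ∧ f u v ≤ (z (e m)).2 :=
    fun m => hz ⟨_, rfl⟩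
  choose u v h1 h2 using hz'
  rw [dist_comm, dist_eq_norm] at hpd
  have hp1 : p.1 = ∑ m, w (e m) • pairTensor (u m) (v m) := by
    rw [← hsum, Prod.fst_sum, ← e.sum_comp]
    exact Finset.sum_congr rfl fun m _ => by rw [← h1]; rfl
  have hp2 : p.2 = ∑ m, w (e m) * (z (e m)).2 := by
    rw [← hsum, Prod.snd_sum, ← e.sum_comp]
    rfl
  -- Indexing by ℕ, with weight zero and an arbitrary vector beyond the actual terms.
  let W : ℕ → ℝ := fun m => if h : m < Fintype.card ι then w (e ⟨m, h⟩) else 0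
  let U : ℕ → Circ := fun m => if h : m < Fintype.card ι then u ⟨m, h⟩ else circAngle 0
  let V : ℕ → Circ := fun m => if h : m < Fintype.card ι then v ⟨m, h⟩ else circAngle 0
  have hW (m : Fin (Fintype.card ι)) : W m = w (e m) := dif_pos m.2
  have hU (m : Fin (Fintype.card ι)) : U m = u m := dif_pos m.2
  have hV (m : Fin (Fintype.card ι)) : V m = v m := dif_pos m.2
  refine ⟨Fintype.card ι, W, U, V, hcard, fun m => ?_, ?_, ?_, ?_⟩
  · by_cases h : m < Fintype.card ι
    · exact (dif_pos h : W m = _).ge.trans' (hw _).le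
    · exact (dif_neg h : W m = _).ge
  · simp only [Finset.sum_range, hW]
    rw [e.sum_comp w, hw1]
  · simp only [Finset.sum_range, hW, hU, hV]
    rw [← hp1]
    exact (norm_fst_le (p - (Q, supMinorants f Q))).trans hpd.le
  · have h3 : |p.2 - supMinorants f Q| ≤ δ :=
      (norm_snd_le (p - (Q, supMinorants f Q))).trans hpd.le
    have h4 : ∑ m, w (e m) * f (u m) (v m) ≤ p.2 := by
      rw [hp2]
      exact Finset.sum_le_sum fun m _ => mul_le_mul_of_nonneg_left (h2 m) (hw _).le
    simp only [Finset.sum_range, hW, hU, hV]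
    linarith [le_of_abs_le h3]

end envelope

/-! ## Sums over bonds -/

section bonds

variable {f : Circ → Circ → ℝ} {C : ℝ}

/-- The four unit vectors of the square lattice. -/
def dirs : Finset (Fin 2 → ℤ) := {![1, 0], ![-1, 0], ![0, 1], ![0, -1]}

theorem sum_dirs {M : Type*} [AddCommMonoid M] (g : (Fin 2 → ℤ) → M) :
    ∑ d ∈ dirs, g d = g ![1, 0] + (g ![-1, 0] + (g ![0, 1] + g ![0, -1])) := by
  rw [dirs, Finset.sum_insert (by decide), Finset.sum_insert (by decide),
    Finset.sum_insert (by decide), Finset.sum_singleton]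

theorem mem_dirs_iff (d : Fin 2 → ℤ) : d ∈ dirs ↔ ∑ a, d a ^ 2 = 1 := by
  have hd : d = ![d 0, d 1] := by ext a; fin_cases a <;> rfl
  rw [Fin.sum_univ_two]
  constructor
  · intro h
    simp only [dirs, Finset.mem_insert, Finset.mem_singleton] at h
    rcases h with rfl | rfl | rfl | rfl <;> simp
  · intro h
    rw [hd]
    generalize d 0 = x at *
    generalize d 1 = y at *
    have hx : x ≤ 1 := by nlinarith [sq_nonneg y]
    have hx' : -1 ≤ x := by nlinarith [sq_nonneg y]
    have hy : y ≤ 1 := by nlinarith [sq_nonneg x]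
    have hy' : -1 ≤ y := by nlinarith [sq_nonneg x]
    interval_cases x <;> interval_cases y <;> simp_all [dirs]

theorem neg_mem_dirs {d : Fin 2 → ℤ} (h : d ∈ dirs) : -d ∈ dirs := by
  rw [mem_dirs_iff] at *
  simpa using h

theorem card_dirs : dirs.card = 4 := by decide

/-- The sum of `f` over the ordered pairs of neighbours in `L`, with first point in `J`. -/
def bondSum (f : Circ → Circ → ℝ) (J L : Finset (Fin 2 → ℤ)) (u : (Fin 2 → ℤ) → Circ) : ℝ :=
  ∑ i ∈ J, ∑ d ∈ dirs, if i + d ∈ L then f (u i) (u (i + d)) else 0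

/-- The number of directed bonds that leave `L`. -/
def boundaryCount (L : Finset (Fin 2 → ℤ)) : ℝ :=
  ∑ i ∈ L, ∑ d ∈ dirs, if i + d ∈ L then (0 : ℝ) else 1

/-- Listing an ordered pair as a site and a direction makes the sum local. Only membership in `L` is
prescribed, so that explicit squares and the points of a general Ω are both covered. -/
theorem spinEnergy_eq_bondSum {ε : ℝ} {Ω : Set Plane} {L : Finset (Fin 2 → ℤ)}
    (hL : ∀ i, i ∈ L ↔ i ∈ latticePoints ε Ω) (u : (Fin 2 → ℤ) → Circ) :
    spinEnergy f ε Ω u = ε ^ 2 * bondSum f L L u := by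
  let e : (Fin 2 → ℤ) × (Fin 2 → ℤ) → (Fin 2 → ℤ) × (Fin 2 → ℤ) := fun p => (p.1, p.1 + p.2)
  have he : Function.Injective e := by
    rintro ⟨i, d⟩ ⟨j, d'⟩ h
    simp only [e, Prod.mk.injEq] at h
    obtain ⟨rfl, h⟩ := h
    simpa using h
  have hset : {p : (Fin 2 → ℤ) × (Fin 2 → ℤ) | p.1 ∈ latticePoints ε Ω ∧
      p.2 ∈ latticePoints ε Ω ∧ ∑ a, (p.1 a - p.2 a) ^ 2 = 1} =
      (((L ×ˢ dirs).filter fun p => p.1 + p.2 ∈ L).image e : Finset _) := by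
    ext ⟨i, j⟩
    simp only [mem_ofPred_eq, Finset.coe_image, Finset.coe_filter, mem_image, Finset.mem_product,
      Prod.exists, e, Prod.mk.injEq, ← hL]
    constructor
    · rintro ⟨hi, hj, hd⟩
      refine ⟨i, j - i, ⟨⟨hi, ?_⟩, by simpa using hj⟩, rfl, by simp⟩
      rw [mem_dirs_iff, ← hd]
      exact Finset.sum_congr rfl fun a _ => by simp only [Pi.sub_apply]; ring
    · rintro ⟨i', d, ⟨⟨hi, hd⟩, hj⟩, rfl, rfl⟩
      refine ⟨hi, hj, ?_⟩
      rw [mem_dirs_iff] at hd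
      rw [← hd]
      exact Finset.sum_congr rfl fun a _ => by simp only [Pi.add_apply]; ring
  rw [spinEnergy, hset, finsum_mem_coe_finset, Finset.sum_image he.injOn, Finset.sum_filter,
    Finset.sum_product, bondSum, Finset.mul_sum]
  refine Finset.sum_congr rfl fun i _ => ?_
  rw [Finset.mul_sum]
  exact Finset.sum_congr rfl fun d _ => by simp only [e]; split_ifs <;> simp

/-- Summing over directed bonds and their reversals gives the same result, also when bonds that
leave `L` are replaced by loops. -/
theorem sum_bonds_swap (L : Finset (Fin 2 → ℤ)) (G : (Fin 2 → ℤ) → (Fin 2 → ℤ) → ℝ) :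
    ∑ i ∈ L, ∑ d ∈ dirs, G i (if i + d ∈ L then i + d else i) =
      ∑ i ∈ L, ∑ d ∈ dirs, G (if i + d ∈ L then i + d else i) i := by
  rw [← Finset.sum_product', ← Finset.sum_product']
  -- The involution that reverses a bond inside `L` and fixes a bond that leaves it.
  let r : (Fin 2 → ℤ) × (Fin 2 → ℤ) → (Fin 2 → ℤ) × (Fin 2 → ℤ) := fun p =>
    if p.1 + p.2 ∈ L then (p.1 + p.2, -p.2) else p
  have hr : ∀ p ∈ L ×ˢ dirs, r p ∈ L ×ˢ dirs := by
    rintro ⟨i, d⟩ h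
    rw [Finset.mem_product] at h
    by_cases hd : i + d ∈ L
    · simpa [r, hd] using neg_mem_dirs h.2
    · simpa [r, hd] using h
  have hrr : ∀ p ∈ L ×ˢ dirs, r (r p) = p := by
    rintro ⟨i, d⟩ h
    rw [Finset.mem_product] at h
    have h1 : i ∈ L := h.1
    by_cases hd : i + d ∈ L
    · simp [r, hd, h1]
    · simp [r, hd]
  refine Finset.sum_nbij' r r hr hr hrr hrr ?_
  rintro ⟨i, d⟩ h
  rw [Finset.mem_product] at h
  have h1 : i ∈ L := h.1
  by_cases hd : i + d ∈ L
  · simp [r, hd, h1]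
  · simp [r, hd]

/-- Lower bound for the energy by a slowly varying field of affine minorants. -/
theorem sum_minorants_le_bondSum (hC : ∀ u v, |f u v| ≤ C) {L : Finset (Fin 2 → ℤ)}
    {A : (Fin 2 → ℤ) → SymMat} (hA : ∀ i, A i ∈ minorants f) {ω : ℝ} (hω0 : 0 ≤ ω)
    (hω : ∀ i ∈ L, ∀ d ∈ dirs, i + d ∈ L → ‖A (i + d) - A i‖ ≤ ω) (u : (Fin 2 → ℤ) → Circ) :
    4 * ∑ i ∈ L, frobL (A i) (tensorSq (u i)) ≤
      bondSum f L L u + C * boundaryCount L + 2 * ω * L.card := by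
  set T : (Fin 2 → ℤ) → SymMat := fun i => tensorSq (u i)
  -- A missing neighbour is replaced by the site itself, so that each site has exactly four bonds. A
  -- loop contributes A_i : u_i ⊗ u_i ≤ f(u_i, u_i) ≤ C, whence the boundary term.
  let s : (Fin 2 → ℤ) → (Fin 2 → ℤ) → (Fin 2 → ℤ) := fun i d => if i + d ∈ L then i + d else i
  have h1 : ∑ i ∈ L, ∑ d ∈ dirs, (frobL (A i) (T i) + frobL (A i) (T (s i d))) / 2 ≤
      bondSum f L L u + C * boundaryCount L := by
    rw [bondSum, boundaryCount, Finset.mul_sum, ← Finset.sum_add_distrib]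
    refine Finset.sum_le_sum fun i _ => ?_
    rw [Finset.mul_sum, ← Finset.sum_add_distrib]
    refine Finset.sum_le_sum fun d _ => ?_
    rw [← frobL_pairTensor]
    refine (hA i _ _).trans ?_
    by_cases hd : i + d ∈ L
    · simp [s, hd]
    · simpa [s, hd] using le_of_abs_le (hC (u i) (u i))
  -- Reversing the bonds moves the tensor back to the site i and the minorant to the neighbour;
  -- returning the minorant to i costs ω per directed bond. With four bonds and the factor 1/2 this
  -- gives 2ω per site.
  have h2 : ∑ i ∈ L, ∑ d ∈ dirs, frobL (A i) (T (s i d)) =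
      ∑ i ∈ L, ∑ d ∈ dirs, frobL (A (s i d)) (T i) :=
    sum_bonds_swap L fun i j => frobL (A i) (T j)
  have h3 : ∑ i ∈ L, ∑ d ∈ dirs, (frobL (A i) (T i) - ω) ≤
      ∑ i ∈ L, ∑ d ∈ dirs, frobL (A (s i d)) (T i) := by
    refine Finset.sum_le_sum fun i hi => Finset.sum_le_sum fun d hd => ?_
    have h4 : ‖A (s i d) - A i‖ ≤ ω := by
      by_cases h : i + d ∈ L
      · simpa [s, h] using hω i hi d hd h
      · simpa [s, h] using hω0
    have h5 : |frobL (A (s i d) - A i) (T i)| ≤ ω * 1 :=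
      (abs_frobL_le _ _).trans (mul_le_mul h4 (norm_tensorSq_le _) (norm_nonneg _) hω0)
    rw [map_sub, sub_apply] at h5
    linarith [neg_le_of_abs_le h5]
  have h6 : ∑ i ∈ L, ∑ d ∈ dirs, (frobL (A i) (T i) + frobL (A i) (T (s i d))) / 2 =
      (∑ i ∈ L, ∑ d ∈ dirs, frobL (A i) (T i) + ∑ i ∈ L, ∑ d ∈ dirs, frobL (A i) (T (s i d))) / 2
      := by
    simp only [← Finset.sum_div, Finset.sum_add_distrib]
  rw [h6, h2] at h1
  have h7 (F : (Fin 2 → ℤ) → ℝ) : ∑ i ∈ L, ∑ _d ∈ dirs, F i = 4 * ∑ i ∈ L, F i := by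
    rw [Finset.mul_sum]
    exact Finset.sum_congr rfl fun i _ => by simp [card_dirs]
  rw [h7] at h1 h3
  rw [Finset.sum_sub_distrib, Finset.sum_const, nsmul_eq_mul] at h3
  linarith

/-- The square of `n × n` lattice points with lower left corner `c`. -/
def box (c : Fin 2 → ℤ) (n : ℕ) : Finset (Fin 2 → ℤ) :=
  Fintype.piFinset fun a => Finset.Ico (c a) (c a + n)

theorem mem_box {c i : Fin 2 → ℤ} {n : ℕ} : i ∈ box c n ↔ ∀ a, c a ≤ i a ∧ i a < c a + n := by
  simp [box, Fintype.mem_piFinset]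

theorem sum_box {M : Type*} [AddCommMonoid M] (c : Fin 2 → ℤ) (n : ℕ) (g : (Fin 2 → ℤ) → M) :
    ∑ i ∈ box c n, g i =
      ∑ p ∈ Finset.range n, ∑ q ∈ Finset.range n, g ![c 0 + p, c 1 + q] := by
  rw [← Finset.sum_product']
  refine Finset.sum_nbij' (fun i => ((i 0 - c 0).toNat, (i 1 - c 1).toNat))
    (fun p => ![c 0 + p.1, c 1 + p.2]) ?_ ?_ ?_ ?_ ?_
  · intro i hi
    rw [mem_box] at hi
    have h0 := hi 0
    have h1 := hi 1
    simp only [Finset.mem_product, Finset.mem_range]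
    omega
  · rintro ⟨p, q⟩ h
    simp only [Finset.mem_product, Finset.mem_range] at h
    rw [mem_box]
    intro a
    fin_cases a <;> simp <;> omega
  · intro i hi
    rw [mem_box] at hi
    have h0 := hi 0
    have h1 := hi 1
    ext a
    fin_cases a
    · change c 0 + ((i 0 - c 0).toNat : ℤ) = i 0
      omega
    · change c 1 + ((i 1 - c 1).toNat : ℤ) = i 1
      omega
  · rintro ⟨p, q⟩ -
    simp
  · intro i hi
    rw [mem_box] at hi
    have h0 := hi 0
    have h1 := hi 1
    congr 1
    ext a
    fin_cases a
    · change i 0 = c 0 + ((i 0 - c 0).toNat : ℤ)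
      omega
    · change i 1 = c 1 + ((i 1 - c 1).toNat : ℤ)
      omega

theorem card_box (c : Fin 2 → ℤ) (n : ℕ) : (box c n).card = n ^ 2 := by
  simp [box, Fintype.card_piFinset, sq]

/-- In each of the four directions only the points of one side, at most n of them, leave the square.
-/
theorem boundaryCount_box_le (c : Fin 2 → ℤ) (n : ℕ) : boundaryCount (box c n) ≤ 4 * n := by
  have key (k : ℕ) : ∑ p ∈ Finset.range n, (if p = k then (1 : ℝ) else 0) ≤ 1 := by
    rw [Finset.sum_ite_eq']
    split_ifs <;> norm_num
  have e (p q : ℕ) (x y : ℤ) : (![c 0 + p, c 1 + q] : Fin 2 → ℤ) + ![x, y] ∈ box c n ↔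
      (0 ≤ p + x ∧ p + x < n) ∧ (0 ≤ q + y ∧ q + y < n) := by
    rw [mem_box]
    constructor
    · intro h
      have h0 := h 0
      have h1 := h 1
      simp at h0 h1
      omega
    · intro h a
      fin_cases a <;> simp <;> omega
  have hle : boundaryCount (box c n) ≤ ∑ p ∈ Finset.range n, ∑ q ∈ Finset.range n,
      (((if p = n - 1 then (1 : ℝ) else 0) + (if p = 0 then (1 : ℝ) else 0)) +
      ((if q = n - 1 then (1 : ℝ) else 0) + (if q = 0 then (1 : ℝ) else 0))) := by
    rw [boundaryCount, sum_box]
    refine Finset.sum_le_sum fun p hp => Finset.sum_le_sum fun q hq => ?_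
    rw [Finset.mem_range] at hp hq
    rw [sum_dirs]
    simp only [e]
    have ite_le (P R : Prop) [Decidable P] [Decidable R] (h : ¬P → R) :
        (if P then (0 : ℝ) else 1) ≤ if R then 1 else 0 := by
      by_cases hP : P
      · rw [if_pos hP]; split_ifs <;> norm_num
      · rw [if_neg hP, if_pos (h hP)]
    rw [← add_assoc]
    refine add_le_add (add_le_add ?_ ?_) (add_le_add ?_ ?_) <;> apply ite_le <;> omega
  refine hle.trans ?_
  simp only [Finset.sum_add_distrib, Finset.sum_const, Finset.card_range, nsmul_eq_mul,
    ← Finset.mul_sum]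
  have hn : (0 : ℝ) ≤ n := Nat.cast_nonneg n
  have k1 := mul_le_mul_of_nonneg_left (key (n - 1)) hn
  have k2 := mul_le_mul_of_nonneg_left (key 0) hn
  linarith

end bonds

/-! ## Stripe patterns on a square of lattice points -/

section pattern

variable {f : Circ → Circ → ℝ} {C : ℝ}

/-- An alternating sum is half the sum of the two terms times the length, up to one term. -/
theorem norm_sum_alternating_le {E : Type*} [NormedAddCommGroup E] [NormedSpace ℝ E] {a b : E}
    (ha : ‖a‖ ≤ 1) (hb : ‖b‖ ≤ 1) (s : ℤ) (n : ℕ) :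
    ‖∑ q ∈ Finset.range n, (if Even (s + q) then a else b) -
      (n : ℝ) • (1 / 2 : ℝ) • (a + b)‖ ≤ 1 := by
  -- The exact remainder: none for even length, half the difference of the two terms for odd length,
  -- with sign given by the parity of the start `s`.
  have key : ∑ q ∈ Finset.range n, (if Even (s + q) then a else b) -
      (n : ℝ) • (1 / 2 : ℝ) • (a + b) =
      if Even n then 0 else (if Even s then (1 / 2 : ℝ) • (a - b) else (1 / 2 : ℝ) • (b - a)) := by
    induction n with
    | zero => simp
    | succ n ih =>
      rw [Finset.sum_range_succ, Nat.cast_succ, add_smul, one_smul, add_sub_add_comm, ih]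
      simp only [Int.even_add, Int.even_coe_nat, Nat.even_add_one]
      by_cases h1 : Even n <;> by_cases h2 : Even s <;> simp only [h1, h2] <;> simp <;> module
  rw [key]
  have h (x y : E) (hx : ‖x‖ ≤ 1) (hy : ‖y‖ ≤ 1) : ‖(1 / 2 : ℝ) • (x - y)‖ ≤ 1 := by
    rw [norm_smul, Real.norm_of_nonneg (by norm_num)]
    linarith [norm_sub_le x y]
  split_ifs
  · simp
  · exact h _ _ ha hb
  · exact h _ _ hb ha

/-- Integers can be distributed into consecutive strips with given proportions. -/
theorem exists_strips (M : ℕ) (w : ℕ → ℝ) (hw : ∀ j, 0 ≤ w j)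
    (hw1 : ∑ j ∈ Finset.range M, w j = 1) (n : ℕ) : ∃ m : ℤ → ℕ, Monotone m ∧ (∀ k, m k ≤ M) ∧
      ∀ {E : Type} [NormedAddCommGroup E] [NormedSpace ℝ E] (g : ℕ → E) (B : ℝ),
        (∀ j, ‖g j‖ ≤ B) → ‖∑ k ∈ Finset.range n, g (m k) -
          (n : ℝ) • ∑ j ∈ Finset.range M, w j • g j‖ ≤ M * B := by
  let c : ℕ → ℝ := fun j => n * ∑ i ∈ Finset.range j, w i
  let N : ℕ → ℕ := fun j => ⌈c j⌉₊
  have hc0 (j : ℕ) : 0 ≤ c j := mul_nonneg (Nat.cast_nonneg n) (Finset.sum_nonneg fun i _ => hw i)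
  have hcs (j : ℕ) : c (j + 1) = c j + n * w j := by
    simp only [c, Finset.sum_range_succ, mul_add]
  have hc : Monotone c := monotone_nat_of_le_succ fun j => by
    rw [hcs]
    exact le_add_of_nonneg_right (mul_nonneg (Nat.cast_nonneg n) (hw j))
  have hN : Monotone N := fun i j h => Nat.ceil_mono (hc h)
  have hN0 : N 0 = 0 := by simp [N, c]
  have hNM : N M = n := by simp [N, c, hw1]
  -- The strip of column k is the number of strips that end at or before k. This is defined and
  -- monotone on all of ℤ, as needed for columns adjacent to the square, where the value is 0 on the
  -- left and M on the right.
  let m : ℤ → ℕ := fun k => ((Finset.range M).filter fun j => (N (j + 1) : ℤ) ≤ k).card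
  have hm : Monotone m := fun k l h => Finset.card_le_card fun j hj => by
    simp only [Finset.mem_filter] at hj ⊢
    exact ⟨hj.1, hj.2.trans h⟩
  have hmM (k : ℤ) : m k ≤ M := (Finset.card_filter_le _ _).trans (Finset.card_range M).le
  have hmj (j : ℕ) (hj : j < M) (k : ℕ) (hk : k ∈ Finset.Ico (N j) (N (j + 1))) : m k = j := by
    rw [Finset.mem_Ico] at hk
    have : (Finset.range M).filter (fun i => (N (i + 1) : ℤ) ≤ k) = Finset.range j := by
      ext i
      simp only [Finset.mem_filter, Finset.mem_range, Nat.cast_le]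
      constructor
      · rintro ⟨-, h⟩
        by_contra! hij
        have := hN (Nat.succ_le_succ hij)
        simp only [Nat.succ_eq_add_one] at this
        omega
      · intro h
        have := hN (Nat.succ_le_of_lt h)
        simp only [Nat.succ_eq_add_one] at this
        exact ⟨h.trans hj, this.trans hk.1⟩
    simp only [m, this, Finset.card_range]
  refine ⟨m, hm, hmM, fun {E} _ _ g B hB => ?_⟩
  have hsum (J : ℕ) (hJ : J ≤ M) : ∑ k ∈ Finset.range (N J), g (m k) =
      ∑ j ∈ Finset.range J, ((N (j + 1) : ℝ) - N j) • g j := by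
    induction J with
    | zero => simp [hN0]
    | succ J ih =>
      rw [Finset.sum_range_succ, ← ih (by omega), Finset.range_eq_Ico, Finset.range_eq_Ico,
        ← Finset.sum_Ico_consecutive _ (Nat.zero_le _) (hN (Nat.le_succ J)),
        Finset.sum_congr (s₁ := Finset.Ico (N J) _) rfl
          fun k hk => congrArg g (hmj J (by omega) k hk), Finset.sum_const, Nat.card_Ico,
        ← Nat.cast_smul_eq_nsmul ℝ, Nat.cast_sub (hN (Nat.le_succ J))]
  rw [← hNM, hsum M le_rfl, hNM, Finset.smul_sum, ← Finset.sum_sub_distrib]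
  refine (norm_sum_le_of_le _ (f := fun j => _) (n := fun _ => B) fun j hj => ?_).trans ?_
  · rw [smul_smul, ← sub_smul, norm_smul]
    have h1 := Nat.le_ceil (c j)
    have h2 := Nat.ceil_lt_add_one (hc0 j)
    have h3 := Nat.le_ceil (c (j + 1))
    have h4 := Nat.ceil_lt_add_one (hc0 (j + 1))
    -- Both ends are rounded up by less than one, so the width of a strip is off by at most one.
    have h5 : ‖((N (j + 1) : ℝ) - N j) - n * w j‖ ≤ 1 := by
      rw [Real.norm_eq_abs, abs_le]
      rw [hcs] at h3 h4
      constructor <;> simp only [N, hcs] <;> linarith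
    calc _ ≤ 1 * B := mul_le_mul h5 (hB j) (norm_nonneg _) zero_le_one
      _ = B := one_mul B
  · simp

/-- Restricting a configuration to a square changes the energy by a boundary term. -/
theorem bondSum_box_le (hC : ∀ u v, |f u v| ≤ C) {c : Fin 2 → ℤ} {n : ℕ}
    {L : Finset (Fin 2 → ℤ)} (hL : box c n ⊆ L) {u z : (Fin 2 → ℤ) → Circ}
    (huz : ∀ i ∈ box c n, u i = z i) :
    bondSum f (box c n) L u ≤ ∑ i ∈ box c n, ∑ d ∈ dirs, f (z i) (z (i + d)) + 8 * C * n := by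
  have hC0 : 0 ≤ C := (abs_nonneg _).trans (hC (z 0) (z 0))
  -- A bond that leaves the square may see values other than those of `z`, or be absent; either
  -- changes the sum by at most 2C, and there are at most 4n such bonds.
  have h1 : bondSum f (box c n) L u ≤
      ∑ i ∈ box c n, ∑ d ∈ dirs, f (z i) (z (i + d)) + 2 * C * boundaryCount (box c n) := by
    rw [boundaryCount, bondSum, Finset.mul_sum, ← Finset.sum_add_distrib]
    refine Finset.sum_le_sum fun i hi => ?_
    rw [Finset.mul_sum, ← Finset.sum_add_distrib]
    refine Finset.sum_le_sum fun d _ => ?_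
    by_cases hd : i + d ∈ box c n
    · rw [if_pos (hL hd), if_pos hd, huz _ hd, huz _ hi]
      linarith
    · rw [if_neg hd]
      have h2 := neg_le_of_abs_le (hC (z i) (z (i + d)))
      have h3 := le_of_abs_le (hC (u i) (u (i + d)))
      split_ifs <;> linarith
  have h2 := mul_le_mul_of_nonneg_left (boundaryCount_box_le c n) (mul_nonneg zero_le_two hC0)
  linarith

/-- Every value of the envelope is attained, up to boundary terms, by a pattern of stripes, in
each of which two vectors alternate. -/
theorem exists_pattern (hC : ∀ u v, |f u v| ≤ C) (hf_exchange : ∀ u v, f u v = f v u) :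
    ∃ D : ℝ, 0 ≤ D ∧ ∀ Q ∈ tensorBody, ∀ n : ℕ, 0 < n → ∀ c : Fin 2 → ℤ,
      ∃ z : (Fin 2 → ℤ) → Circ,
        ‖∑ i ∈ box c n, tensorSq (z i) - (n : ℝ) ^ 2 • Q‖ ≤ D * n ∧
        ∀ (L : Finset (Fin 2 → ℤ)) (u : (Fin 2 → ℤ) → Circ), box c n ⊆ L →
          (∀ i ∈ box c n, u i = z i) →
          bondSum f (box c n) L u ≤ 4 * n ^ 2 * supMinorants f Q + D * n := by
  obtain ⟨N, hN⟩ := exists_convex_combination hC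
  have hC0 : 0 ≤ C := (abs_nonneg _).trans (hC (circAngle 0) (circAngle 0))
  -- A common constant for both estimates: the tensor sum needs 2 + N, the energy 4 + 8NC + 8C.
  refine ⟨6 + N + 8 * N * C + 8 * C, by positivity, fun Q hQ n hn c => ?_⟩
  have hn' : (0 : ℝ) < n := Nat.cast_pos.mpr hn
  -- The tolerance 1/n, multiplied by the n² sites, is again of order n.
  obtain ⟨M, w, U, V, hMN, hw, hw1, hwQ, hwf⟩ := hN Q hQ (1 / n) (by positivity)
  obtain ⟨m, hm, hmM, hms⟩ := exists_strips M w hw hw1 n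
  have hMN' : (M : ℝ) ≤ N := Nat.cast_le.mpr hMN
  -- The strip depends on the first coordinate and the choice within its pair on the parity of the
  -- coordinate sum, so nearest neighbours in a strip always carry the two different vectors of its
  -- pair.
  let z : (Fin 2 → ℤ) → Circ := fun i =>
    if Even (i 0 + i 1) then U (m (i 0 - c 0)) else V (m (i 0 - c 0))
  refine ⟨z, ?_, fun L u hL hu => (bondSum_box_le hC hL hu).trans ?_⟩
  · have e1 (p : ℕ) : ‖∑ q ∈ Finset.range n, tensorSq (z ![c 0 + p, c 1 + q]) -
        (n : ℝ) • pairTensor (U (m p)) (V (m p))‖ ≤ 1 := by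
      have h := norm_sum_alternating_le (norm_tensorSq_le (U (m p))) (norm_tensorSq_le (V (m p)))
        (c 0 + p + c 1) n
      rw [← pairTensor] at h
      convert h using 5 with q
      simp only [z, Matrix.cons_val_zero, Matrix.cons_val_one, apply_ite tensorSq,
        add_sub_cancel_left, add_assoc]
    have e2 := hms (fun j => pairTensor (U j) (V j)) 1
      fun j => norm_le_one_of_mem_tensorBody (pairTensor_mem _ _)
    set S := ∑ j ∈ Finset.range M, w j • pairTensor (U j) (V j)
    have e3 : ‖∑ p ∈ Finset.range n, (∑ q ∈ Finset.range n, tensorSq (z ![c 0 + p, c 1 + q]) -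
        (n : ℝ) • pairTensor (U (m p)) (V (m p)))‖ ≤ n := by
      refine (norm_sum_le_of_le _ fun p _ => e1 p).trans ?_
      simp
    -- Three errors, each of order n: the parity remainder in each column, the rounding of the
    -- widths, and the approximation of Q by the convex combination.
    have e4 : ∑ i ∈ box c n, tensorSq (z i) - (n : ℝ) ^ 2 • Q =
        ∑ p ∈ Finset.range n, (∑ q ∈ Finset.range n, tensorSq (z ![c 0 + p, c 1 + q]) -
          (n : ℝ) • pairTensor (U (m p)) (V (m p))) +
        (n : ℝ) • (∑ p ∈ Finset.range n, pairTensor (U (m p)) (V (m p)) - (n : ℝ) • S) +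
        (n : ℝ) ^ 2 • (S - Q) := by
      rw [sum_box, Finset.sum_sub_distrib, ← Finset.smul_sum]
      module
    rw [e4]
    have e5 : ‖(n : ℝ) • (∑ p ∈ Finset.range n, pairTensor (U (m p)) (V (m p)) - (n : ℝ) • S)‖ ≤
        n * (M * 1) := by
      rw [norm_smul, Real.norm_of_nonneg hn'.le]
      gcongr
    have e6 : ‖(n : ℝ) ^ 2 • (S - Q)‖ ≤ n := by
      rw [norm_smul, Real.norm_of_nonneg (by positivity)]
      calc (n : ℝ) ^ 2 * ‖S - Q‖ ≤ (n : ℝ) ^ 2 * (1 / n) := by gcongr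
        _ = (n : ℝ) := by field_simp
    have e7 : (n : ℝ) * (M * 1) ≤ n * N := by rw [mul_one]; gcongr
    have e8 : 0 ≤ (4 + 8 * N * C + 8 * C) * n := by positivity
    refine (norm_add₃_le).trans ?_
    linarith
  · let g : ℕ → ℝ := fun j => f (U j) (V j)
    have e1 (i : Fin 2 → ℤ) : ∑ d ∈ dirs, f (z i) (z (i + d)) ≤ 4 * g (m (i 0 - c 0)) +
        2 * C * (m (i 0 - c 0 + 1) - m (i 0 - c 0 - 1)) := by
      have hvert (y : ℤ) (hy : Odd y) : f (z i) (z (i + ![0, y])) = g (m (i 0 - c 0)) := by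
        have hpar : Even (i 0 + (i 1 + y)) ↔ ¬ Even (i 0 + i 1) := by
          rw [← add_assoc, Int.even_add, ← Int.not_odd_iff_even (n := y)]
          simp [hy]
        simp only [z, Pi.add_apply, Matrix.cons_val_zero, Matrix.cons_val_one, add_zero, hpar]
        by_cases h : Even (i 0 + i 1)
        · simp [h, g]
        · simp [h, g, hf_exchange]
      -- A horizontal bond either stays in its strip and has the energy of the pair, or crosses an
      -- interface. The latter costs at most 2C and is charged to the increment t ≥ 1 of the strip
      -- index.
      have hhor (x : ℤ) (hx : Odd x) (t : ℝ) (ht : 0 ≤ t)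
          (hmx : m (i 0 - c 0 + x) ≠ m (i 0 - c 0) → 1 ≤ t) :
          f (z i) (z (i + ![x, 0])) ≤ g (m (i 0 - c 0)) + 2 * C * t := by
        by_cases hmm : m (i 0 - c 0 + x) = m (i 0 - c 0)
        · have hpar : Even (i 0 + x + i 1) ↔ ¬ Even (i 0 + i 1) := by
            rw [add_right_comm, Int.even_add, ← Int.not_odd_iff_even (n := x)]
            simp [hx]
          have : f (z i) (z (i + ![x, 0])) = g (m (i 0 - c 0)) := by
            simp only [z, Pi.add_apply, Matrix.cons_val_zero, Matrix.cons_val_one, add_zero, hpar,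
              add_sub_right_comm, hmm]
            by_cases h : Even (i 0 + i 1)
            · simp [h, g]
            · simp [h, g, hf_exchange]
          rw [this]
          have := mul_nonneg hC0 ht
          linarith
        · have h1 := mul_le_mul_of_nonneg_left (hmx hmm) hC0
          have h2 := le_of_abs_le (hC (z i) (z (i + ![x, 0])))
          have h3 := neg_le_of_abs_le (hC (U (m (i 0 - c 0))) (V (m (i 0 - c 0))))
          simp only [g]
          linarith
      have hm1 : m (i 0 - c 0) ≤ m (i 0 - c 0 + 1) := hm (by omega)
      have hm2 : m (i 0 - c 0 - 1) ≤ m (i 0 - c 0) := hm (by omega)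
      have h1 := hhor 1 (by decide) (m (i 0 - c 0 + 1) - m (i 0 - c 0))
        (sub_nonneg.mpr (Nat.cast_le.mpr hm1)) fun h => by
          rw [le_sub_iff_add_le, add_comm]
          exact_mod_cast lt_of_le_of_ne hm1 h.symm
      have h2 := hhor (-1) (by decide) (m (i 0 - c 0) - m (i 0 - c 0 - 1))
        (sub_nonneg.mpr (Nat.cast_le.mpr hm2)) fun h => by
          rw [le_sub_iff_add_le, add_comm]
          exact_mod_cast lt_of_le_of_ne hm2 h
      rw [sum_dirs, hvert 1 (by decide), hvert (-1) (by decide)]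
      linarith
    have e2 := hms g C fun j => hC _ _
    rw [Real.norm_eq_abs] at e2
    -- The increments of the monotone index telescope, so along a row all crossings together cost
    -- O(M), independently of n.
    have e3 : ∑ p ∈ Finset.range n, ((m (p + 1) : ℝ) - m ((p : ℤ) - 1)) ≤ 2 * M := by
      have h1 := Finset.sum_range_sub (fun k : ℕ => (m k : ℝ) + m ((k : ℤ) - 1)) n
      have h2 : ∀ p : ℕ, (m (p + 1) : ℝ) - m ((p : ℤ) - 1) =
          (fun k : ℕ => (m k : ℝ) + m ((k : ℤ) - 1)) (p + 1) -
            (fun k : ℕ => (m k : ℝ) + m ((k : ℤ) - 1)) p := by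
        intro p
        simp only [Nat.cast_add, Nat.cast_one, add_sub_cancel_right]
        ring
      rw [Finset.sum_congr rfl fun p _ => h2 p, h1]
      have h3 : (m n : ℝ) ≤ M := Nat.cast_le.mpr (hmM n)
      have h4 : (m ((n : ℤ) - 1) : ℝ) ≤ M := Nat.cast_le.mpr (hmM _)
      have h5 : (0 : ℝ) ≤ (m (0 : ℕ) : ℝ) + m (((0 : ℕ) : ℤ) - 1) := by positivity
      linarith
    have e4 : ∑ i ∈ box c n, ∑ d ∈ dirs, f (z i) (z (i + d)) ≤
        n * (4 * ∑ p ∈ Finset.range n, g (m p) + 2 * C *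
          ∑ p ∈ Finset.range n, ((m (p + 1) : ℝ) - m ((p : ℤ) - 1))) := by
      refine (Finset.sum_le_sum fun i _ => e1 i).trans ?_
      rw [sum_box]
      simp only [Matrix.cons_val_zero, add_sub_cancel_left, Finset.sum_const, Finset.card_range,
        nsmul_eq_mul, ← Finset.mul_sum, Finset.sum_add_distrib]
      exact le_rfl
    have e5 : ∑ p ∈ Finset.range n, g (m p) ≤ n * supMinorants f Q + 1 + M * C := by
      have h1 := le_of_abs_le e2
      have h2 := mul_le_mul_of_nonneg_left hwf hn'.le
      rw [mul_add, mul_one_div_cancel hn'.ne'] at h2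
      simp only [smul_eq_mul] at h1
      linarith
    have e6 : (n : ℝ) * (4 * ∑ p ∈ Finset.range n, g (m p) + 2 * C *
          ∑ p ∈ Finset.range n, ((m (p + 1) : ℝ) - m ((p : ℤ) - 1))) ≤
        n * (4 * (n * supMinorants f Q + 1 + M * C) + 2 * C * (2 * M)) := by gcongr
    have e7 : (M : ℝ) * C * n ≤ N * C * n := by gcongr
    have e8 : 0 ≤ (2 + (N : ℝ)) * n := by positivity
    linarith

end pattern

/-! ## The homogenization formula -/

section homogenization

variable {f : Circ → Circ → ℝ} {C : ℝ}

/-- The mean of the tensor squares of `u` over a finite set of lattice points. -/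
def meanTensor (L : Finset (Fin 2 → ℤ)) (u : (Fin 2 → ℤ) → Circ) : SymMat :=
  (L.card : ℝ)⁻¹ • ∑ i ∈ L, tensorSq (u i)

theorem meanTensor_mem {L : Finset (Fin 2 → ℤ)} (hL : 0 < L.card) (u : (Fin 2 → ℤ) → Circ) :
    meanTensor L u ∈ tensorBody := by
  rw [meanTensor, Finset.smul_sum]
  refine convex_tensorBody.sum_mem (fun _ _ => by positivity) ?_ fun i _ => tensorSq_mem _
  have : (L.card : ℝ) ≠ 0 := by positivity
  simp [this]

/-- With a constant minorant the oscillation term disappears and the sum of tensors becomes their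
mean; then the supremum over minorants is taken. -/
theorem supMinorants_meanTensor_le (hC : ∀ u v, |f u v| ≤ C) {L : Finset (Fin 2 → ℤ)}
    (hL : 0 < L.card) (u : (Fin 2 → ℤ) → Circ) :
    4 * L.card * supMinorants f (meanTensor L u) ≤ bondSum f L L u + C * boundaryCount L := by
  have hL' : (0 : ℝ) < L.card := Nat.cast_pos.mpr hL
  rw [mul_comm, ← le_div_iff₀ (by positivity)]
  refine supMinorants_le hC fun A hA => ?_
  have h := sum_minorants_le_bondSum hC (L := L) (A := fun _ => A) (fun _ => hA) le_rfl
    (fun _ _ _ _ _ => by simp) u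
  rw [le_div_iff₀ (by positivity), meanTensor, map_smul, map_sum, smul_eq_mul]
  have e : (L.card : ℝ)⁻¹ * (∑ i ∈ L, frobL A (tensorSq (u i))) * (4 * L.card) =
      4 * ∑ i ∈ L, frobL A (tensorSq (u i)) := by field_simp
  rw [e]
  linarith

/-- The number of lattice points on a side of the cube of side `h`. -/
def sideCount (h : ℝ) : ℕ := (⌈h / 2⌉ - ⌈-(h / 2)⌉).toNat

theorem sideCount_cast {h : ℝ} (hh : 0 ≤ h) :
    (sideCount h : ℤ) = ⌈h / 2⌉ - ⌈-(h / 2)⌉ := by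
  refine Int.toNat_of_nonneg (sub_nonneg.mpr (Int.ceil_mono ?_))
  linarith

theorem abs_sideCount_sub_le {h : ℝ} (hh : 0 ≤ h) : |(sideCount h : ℝ) - h| ≤ 1 := by
  have h1 : (sideCount h : ℝ) = (⌈h / 2⌉ : ℝ) - (⌈-(h / 2)⌉ : ℝ) := by
    exact_mod_cast congrArg (Int.cast (R := ℝ)) (sideCount_cast hh)
  have a1 := Int.le_ceil (h / 2)
  have a2 := Int.ceil_lt_add_one (h / 2)
  have a3 := Int.le_ceil (-(h / 2))
  have a4 := Int.ceil_lt_add_one (-(h / 2))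
  rw [h1, abs_le]
  constructor <;> linarith

/-- The lattice points of the cube of side `h`. -/
def cubeBox (h : ℝ) : Finset (Fin 2 → ℤ) := box (fun _ => ⌈-(h / 2)⌉) (sideCount h)

theorem mem_cubeBox {h : ℝ} (hh : 0 ≤ h) (i : Fin 2 → ℤ) :
    i ∈ cubeBox h ↔ i ∈ latticePoints 1 (bigCube h) := by
  rw [cubeBox, mem_box]
  simp only [sideCount_cast hh, latticePoints, bigCube, mem_ofPred_eq, one_mul,
    add_sub_cancel, Int.ceil_le, Int.lt_ceil]

theorem card_cubeBox (h : ℝ) : ((cubeBox h).card : ℝ) = (sideCount h : ℝ) ^ 2 := by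
  rw [cubeBox, card_box, Nat.cast_pow]

theorem discreteAverage_bigCube {h : ℝ} (hh : 0 ≤ h) (u : (Fin 2 → ℤ) → Circ) :
    discreteAverage (bigCube h) u = meanTensor (cubeBox h) u := by
  have hset : latticePoints 1 (bigCube h) = (cubeBox h : Set (Fin 2 → ℤ)) := by
    ext i
    exact (mem_cubeBox hh i).symm
  rw [discreteAverage, hset, finsum_mem_coe_finset, ncard_coe_finset, meanTensor]

/-- Replacing the number of points on a side by the side length. -/
theorem abs_sq_div_sub_le {n h x C : ℝ} (hh : 1 ≤ h) (hn : 0 ≤ n) (hnh : |n - h| ≤ 1)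
    (hx : |x| ≤ C) : |n ^ 2 * x / h ^ 2 - x| ≤ 3 * C / h := by
  have h0 : 0 < h := by linarith
  have e : n ^ 2 * x / h ^ 2 - x = (n - h) * (n + h) * x / h ^ 2 := by field_simp; ring
  rw [e, abs_div, abs_mul, abs_mul, abs_of_nonneg (by positivity : 0 ≤ n + h),
    abs_of_pos (by positivity : 0 < h ^ 2), div_le_div_iff₀ (by positivity) h0]
  have h1 : n + h ≤ 3 * h := by linarith [le_of_abs_le hnh]
  calc |n - h| * (n + h) * |x| * h ≤ 1 * (3 * h) * C * h := by gcongr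
    _ = 3 * C * h ^ 2 := by ring

/-- The mean of a competitor lies in K and in the ball, so its envelope value bounds the energy.
Replacing n² by h² costs 12C/h and the boundary bonds cost 8C/h. -/
theorem cellProblem_ge (hC : ∀ u v, |f u v| ≤ C) {Q : SymMat} {ρ h μ : ℝ} (hh : 1 < h)
    (hμ : ∀ A ∈ tensorBody ∩ Metric.closedBall Q ρ, μ ≤ 4 * supMinorants f A) :
    ((μ - 20 * C / h : ℝ) : EReal) ≤ cellProblem f Q ρ h := by
  have h0 : 0 < h := by linarith
  have hn := abs_sideCount_sub_le h0.le
  set n := sideCount h with hn_def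
  have hn1 : (0 : ℝ) < n := by linarith [neg_le_of_abs_le hn]
  have hn2 : (n : ℝ) ≤ 2 * h := by linarith [le_of_abs_le hn]
  have hcard : 0 < (cubeBox h).card := by
    have : (0 : ℝ) < (cubeBox h).card := by rw [card_cubeBox]; positivity
    exact_mod_cast this
  refine le_iInf₂ fun u hu => EReal.coe_le_coe_iff.mpr ?_
  have hC0 : 0 ≤ C := (abs_nonneg _).trans (hC (u 0) (u 0))
  rw [discreteAverage_bigCube h0.le] at hu
  set A := meanTensor (cubeBox h) u
  have hA : A ∈ tensorBody := meanTensor_mem hcard u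
  have h1 := supMinorants_meanTensor_le hC hcard u
  rw [card_cubeBox, ← hn_def] at h1
  have h2 := mul_le_mul_of_nonneg_left (boundaryCount_box_le (fun _ => ⌈-(h / 2)⌉) n) hC0
  rw [spinEnergy_eq_bondSum (mem_cubeBox h0.le), one_pow, one_mul, one_div_mul_eq_div]
  have h3 : (4 * n ^ 2 * supMinorants f A - C * (4 * n)) / h ^ 2 ≤
      bondSum f (cubeBox h) (cubeBox h) u / h ^ 2 := by
    gcongr
    exact sub_le_iff_le_add.mpr (h1.trans (add_le_add_right h2 _))
  refine le_trans ?_ h3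
  have h4 := neg_le_of_abs_le (abs_sq_div_sub_le hh.le hn1.le hn (abs_supMinorants_le hC hA))
  have h5 : C * (4 * n) / h ^ 2 ≤ 8 * C / h := by
    rw [div_le_div_iff₀ (by positivity) h0]
    calc C * (4 * n) * h ≤ C * (4 * (2 * h)) * h := by gcongr
      _ = 8 * C * h ^ 2 := by ring
  have h6 := hμ A ⟨hA, hu⟩
  have h7 : (4 * n ^ 2 * supMinorants f A - C * (4 * n)) / h ^ 2 =
      4 * (n ^ 2 * supMinorants f A / h ^ 2) - C * (4 * n) / h ^ 2 := by ring
  have h8 : 20 * C / h = 4 * (3 * C / h) + 8 * C / h := by ring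
  rw [h7, h8]
  linarith

/-- The pattern for A is a competitor for Q once h is large: the strict inequality ‖A - Q‖ < ρ
leaves room for the error D/n of its mean. -/
theorem eventually_cellProblem_lt (hC : ∀ u v, |f u v| ≤ C)
    (hf_exchange : ∀ u v, f u v = f v u) {Q A : SymMat} {ρ b : ℝ} (hA : A ∈ tensorBody)
    (hAρ : ‖A - Q‖ < ρ) (hb : 4 * supMinorants f A < b) :
    ∀ᶠ h in atTop, cellProblem f Q ρ h < b := by
  obtain ⟨D, hD0, hD⟩ := exists_pattern hC hf_exchange
  have l1 : Tendsto (fun h : ℝ => D / (h - 1)) atTop (𝓝 0) :=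
    tendsto_const_nhds.div_atTop (tendsto_atTop_add_const_right _ _ tendsto_id)
  have l2 : Tendsto (fun h : ℝ => 4 * supMinorants f A + (12 * C + 2 * D) / h) atTop
      (𝓝 (4 * supMinorants f A + 0)) :=
    tendsto_const_nhds.add (tendsto_const_nhds.div_atTop tendsto_id)
  rw [add_zero] at l2
  filter_upwards [eventually_gt_atTop 1, l1.eventually (gt_mem_nhds (sub_pos.mpr hAρ)),
    l2.eventually (gt_mem_nhds hb)] with h hh hh1 hh2
  have h0 : 0 < h := by linarith
  have hn := abs_sideCount_sub_le h0.le
  set n := sideCount h with hn_def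
  have hn1 : h - 1 ≤ n := by linarith [neg_le_of_abs_le hn]
  have hn0 : (0 : ℝ) < n := by linarith
  have hn2 : (n : ℝ) ≤ 2 * h := by linarith [le_of_abs_le hn]
  obtain ⟨z, hz1, hz2⟩ := hD A hA n (Nat.cast_pos.mp hn0) (fun _ => ⌈-(h / 2)⌉)
  have hmem : discreteAverage (bigCube h) z ∈ Metric.closedBall Q ρ := by
    rw [discreteAverage_bigCube h0.le, mem_closedBall_iff_norm, meanTensor, card_cubeBox,
      ← hn_def]
    have e : ((n : ℝ) ^ 2)⁻¹ • ∑ i ∈ cubeBox h, tensorSq (z i) - Q =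
        ((n : ℝ) ^ 2)⁻¹ • (∑ i ∈ cubeBox h, tensorSq (z i) - (n : ℝ) ^ 2 • A) + (A - Q) := by
      rw [smul_sub, inv_smul_smul₀ (by positivity)]
      abel
    rw [e]
    refine (norm_add_le _ _).trans ?_
    rw [norm_smul, Real.norm_of_nonneg (by positivity)]
    have e2 : ((n : ℝ) ^ 2)⁻¹ * ‖∑ i ∈ cubeBox h, tensorSq (z i) - (n : ℝ) ^ 2 • A‖ ≤
        ((n : ℝ) ^ 2)⁻¹ * (D * n) := by gcongr; exact hz1
    have e3 : ((n : ℝ) ^ 2)⁻¹ * (D * n) = D / n := by field_simp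
    have e4 : D / n ≤ D / (h - 1) := by gcongr
    linarith
  refine (iInf₂_le z hmem).trans_lt (EReal.coe_lt_coe_iff.mpr (lt_of_le_of_lt ?_ hh2))
  rw [spinEnergy_eq_bondSum (mem_cubeBox h0.le), one_pow, one_mul, one_div_mul_eq_div]
  have h1 := hz2 (cubeBox h) z (Finset.Subset.refl _) fun _ _ => rfl
  have h3 : bondSum f (cubeBox h) (cubeBox h) z / h ^ 2 ≤
      (4 * n ^ 2 * supMinorants f A + D * n) / h ^ 2 := by
    gcongr
    exact h1
  refine h3.trans ?_
  have h4 := le_of_abs_le (abs_sq_div_sub_le hh.le hn0.le hn (abs_supMinorants_le hC hA))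
  have h5 : D * n / h ^ 2 ≤ 2 * D / h := by
    rw [div_le_div_iff₀ (by positivity) h0]
    calc D * n * h ≤ D * (2 * h) * h := by gcongr
      _ = 2 * D * h ^ 2 := by ring
  have h7 : (4 * n ^ 2 * supMinorants f A + D * n) / h ^ 2 =
      4 * (n ^ 2 * supMinorants f A / h ^ 2) + D * n / h ^ 2 := by ring
  have h8 : (12 * C + 2 * D) / h = 4 * (3 * C / h) + 2 * D / h := by ring
  rw [h7, h8]
  linarith

/-- The inner limit is the infimum of 4 f̂** over the part of K in the ball of radius ρ about Q. It
tends to 4 f̂**(Q) as ρ → 0, because f̂** is a supremum of continuous functions and Q belongs to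
every ball. -/
theorem hasHomogenizedDensity (hC : ∀ u v, |f u v| ≤ C)
    (hf_exchange : ∀ u v, f u v = f v u) {Q : SymMat} (hQ : Q ∈ tensorBody) :
    HasHomogenizedDensity f Q (4 * supMinorants f Q) := by
  let S : ℝ → Set ℝ := fun ρ =>
    (fun A => 4 * supMinorants f A) '' (tensorBody ∩ Metric.closedBall Q ρ)
  have hne (ρ : ℝ) (hρ : 0 < ρ) : (S ρ).Nonempty :=
    ⟨_, Q, ⟨hQ, Metric.mem_closedBall_self hρ.le⟩, rfl⟩
  have hbdd (ρ : ℝ) : BddBelow (S ρ) := by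
    refine ⟨-(4 * C), ?_⟩
    rintro _ ⟨A, ⟨hA, -⟩, rfl⟩
    have := neg_le_of_abs_le (abs_supMinorants_le hC hA)
    simp only
    linarith
  refine ⟨fun ρ => ((sInf (S ρ) : ℝ) : EReal), fun ρ hρ => ?_, ?_⟩
  · rw [tendsto_order]
    constructor
    · intro a ha
      have l1 : Tendsto (fun h : ℝ => sInf (S ρ) - 20 * C / h) atTop (𝓝 (sInf (S ρ) - 0)) :=
        tendsto_const_nhds.sub (tendsto_const_nhds.div_atTop tendsto_id)
      rw [sub_zero] at l1
      have l2 := (continuous_coe_real_ereal.tendsto (sInf (S ρ))).comp l1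
      filter_upwards [eventually_gt_atTop 1, l2.eventually (lt_mem_nhds ha)] with h hh hh2
      exact hh2.trans_le (cellProblem_ge hC hh fun A hA => csInf_le (hbdd ρ) ⟨A, hA, rfl⟩)
    · intro b hb
      obtain ⟨b', hb1, hb2⟩ := EReal.lt_iff_exists_real_btwn.mp hb
      rw [EReal.coe_lt_coe_iff] at hb1
      obtain ⟨_, ⟨A, ⟨hA, hAρ⟩, rfl⟩, hAb⟩ := exists_lt_of_csInf_lt (hne ρ hρ) hb1
      rw [mem_closedBall_iff_norm] at hAρ
      -- A nearly optimal A may lie on the sphere of radius ρ, where the pattern has no room for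
      -- error. It is moved slightly towards Q; convexity of the envelope keeps the value below b'.
      have l1 : Tendsto (fun t : ℝ => 4 * ((1 - t) * supMinorants f A + t * supMinorants f Q))
          (𝓝[>] 0) (𝓝 (4 * ((1 - 0) * supMinorants f A + 0 * supMinorants f Q))) :=
        (Continuous.tendsto (by fun_prop) 0).mono_left nhdsWithin_le_nhds
      have l2 : 4 * ((1 - 0) * supMinorants f A + 0 * supMinorants f Q) < b' := by
        simpa using hAb
      obtain ⟨t, ht1, ht2⟩ := ((l1.eventually (gt_mem_nhds l2)).and
        (Ioo_mem_nhdsGT zero_lt_one)).exists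
      have hconv := convexOn_supMinorants hC
      have hmem : (1 - t) • A + t • Q ∈ tensorBody :=
        convex_tensorBody hA hQ (by linarith [ht2.2]) ht2.1.le (by ring)
      have hle := hconv.2 hA hQ (by linarith [ht2.2] : 0 ≤ 1 - t) ht2.1.le (by ring)
      simp only [smul_eq_mul] at hle
      have hnorm : ‖(1 - t) • A + t • Q - Q‖ < ρ := by
        have e : (1 - t) • A + t • Q - Q = (1 - t) • (A - Q) := by module
        rw [e, norm_smul, Real.norm_of_nonneg (by linarith [ht2.2])]
        nlinarith [ht2.1, ht2.2, norm_nonneg (A - Q)]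
      filter_upwards [eventually_cellProblem_lt hC hf_exchange hmem hnorm
        (b := b') (by linarith)] with h hh
      exact hh.trans hb2
  · refine (continuous_coe_real_ereal.tendsto _).comp ?_
    rw [tendsto_order]
    constructor
    · intro a ha
      -- A single minorant that is nearly optimal at Q varies by at most ‖A‖ρ on the ball and bounds
      -- the envelope from below there.
      obtain ⟨A, hA, hA2⟩ := exists_lt_frobL hC (Q := Q) (t := a / 4) (by linarith)
      have l1 : Tendsto (fun ρ : ℝ => 4 * (frobL A Q - ‖A‖ * ρ)) (𝓝[>] 0)
          (𝓝 (4 * (frobL A Q - ‖A‖ * 0))) :=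
        (Continuous.tendsto (by fun_prop) 0).mono_left nhdsWithin_le_nhds
      have l2 : a < 4 * (frobL A Q - ‖A‖ * 0) := by
        rw [mul_zero, sub_zero]
        linarith
      filter_upwards [l1.eventually (lt_mem_nhds l2), self_mem_nhdsWithin] with ρ hρ1 hρ2
      refine hρ1.trans_le (le_csInf (hne ρ hρ2) ?_)
      rintro _ ⟨B, ⟨hB, hBρ⟩, rfl⟩
      rw [mem_closedBall_iff_norm] at hBρ
      have h1 := le_supMinorants hC hA hB
      have h2 : |frobL A (B - Q)| ≤ ‖A‖ * ρ :=
        (abs_frobL_le _ _).trans (mul_le_mul_of_nonneg_left hBρ (norm_nonneg _))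
      rw [map_sub] at h2
      have h3 := neg_le_of_abs_le h2
      simp only
      linarith
    · intro b hb
      filter_upwards [self_mem_nhdsWithin] with ρ hρ
      exact (csInf_le (hbdd ρ) ⟨Q, ⟨hQ, Metric.mem_closedBall_self (le_of_lt hρ)⟩, rfl⟩).trans_lt hb

end homogenization

/-! ## Cells and the boundary layer -/

section geometry

/-- The lattice point `ε i`. -/
def latticePt (ε : ℝ) (i : Fin 2 → ℤ) : Plane := WithLp.toLp 2 fun a => ε * (i a : ℝ)

theorem mem_latticePoints {ε : ℝ} {Ω : Set Plane} {i : Fin 2 → ℤ} :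
    i ∈ latticePoints ε Ω ↔ latticePt ε i ∈ Ω := Iff.rfl

/-- The index of the cell that contains a point. -/
def cellIndex (ε : ℝ) (x : Plane) : Fin 2 → ℤ := fun a => ⌊x a / ε + 1 / 2⌋

/-- The half-open cells are the fibres of a rounding map, so they partition the plane, and unions of
cells become preimages of sets of indices. -/
theorem mem_cell_iff {ε : ℝ} (hε : 0 < ε) {i : Fin 2 → ℤ} {x : Plane} :
    x ∈ cell ε i ↔ cellIndex ε x = i := by
  rw [cell, mem_ofPred_eq, funext_iff]
  refine forall_congr' fun a => ?_
  rw [cellIndex, Int.floor_eq_iff, ← sub_le_iff_le_add, le_div_iff₀' hε, ← lt_sub_iff_add_lt,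
    div_lt_iff₀' hε]
  ring_nf

theorem measurable_cellIndex (ε : ℝ) : Measurable (cellIndex ε) := by
  refine measurable_pi_lambda _ fun a => ?_
  have : Measurable fun x : Plane => x a := (EuclideanSpace.proj (𝕜 := ℝ) a).continuous.measurable
  exact Int.measurable_floor.comp ((this.div_const ε).add_const _)

theorem measurableSet_cell {ε : ℝ} (hε : 0 < ε) (i : Fin 2 → ℤ) : MeasurableSet (cell ε i) := by
  have : cell ε i = cellIndex ε ⁻¹' {i} := by
    ext x
    exact mem_cell_iff hε
  rw [this]
  exact measurable_cellIndex ε (measurableSet_singleton i)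

theorem volume_cell {ε : ℝ} (hε : 0 < ε) (i : Fin 2 → ℤ) :
    volume (cell ε i) = ENNReal.ofReal (ε ^ 2) := by
  have h : cell ε i = (WithLp.ofLp : Plane → (Fin 2 → ℝ)) ⁻¹'
      (Set.pi univ fun a => Ico (ε * ((i a : ℝ) - 1 / 2)) (ε * ((i a : ℝ) + 1 / 2))) := by
    ext x
    simp [cell]
  rw [h, (PiLp.volume_preserving_ofLp (Fin 2)).measure_preimage
    (MeasurableSet.univ_pi fun a => measurableSet_Ico).nullMeasurableSet, Real.volume_pi_Ico]
  have : ∀ a, ε * ((i a : ℝ) + 1 / 2) - ε * ((i a : ℝ) - 1 / 2) = ε := fun a => by ring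
  simp only [this, Fin.prod_univ_two]
  rw [← ENNReal.ofReal_mul hε.le, sq]

theorem volume_real_cell {ε : ℝ} (hε : 0 < ε) (i : Fin 2 → ℤ) :
    volume.real (cell ε i) = ε ^ 2 := by
  rw [Measure.real, volume_cell hε, ENNReal.toReal_ofReal (by positivity)]

/-- The union of the cells of a finite set of indices. -/
def cells (ε : ℝ) (J : Finset (Fin 2 → ℤ)) : Set Plane := {x | cellIndex ε x ∈ J}

theorem cells_eq_biUnion {ε : ℝ} (hε : 0 < ε) (J : Finset (Fin 2 → ℤ)) :
    cells ε J = ⋃ i ∈ J, cell ε i := by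
  ext x
  simp [cells, mem_cell_iff hε]

theorem measurableSet_cells (ε : ℝ) (J : Finset (Fin 2 → ℤ)) : MeasurableSet (cells ε J) :=
  measurable_cellIndex ε J.finite_toSet.measurableSet

theorem pairwiseDisjoint_cell {ε : ℝ} (hε : 0 < ε) (J : Set (Fin 2 → ℤ)) :
    J.PairwiseDisjoint (cell ε) := fun _ _ _ _ hij =>
  Set.disjoint_left.mpr fun _ hi hj =>
    hij (((mem_cell_iff hε).mp hi).symm.trans ((mem_cell_iff hε).mp hj))

theorem volume_cells {ε : ℝ} (hε : 0 < ε) (J : Finset (Fin 2 → ℤ)) :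
    volume (cells ε J) = J.card * ENNReal.ofReal (ε ^ 2) := by
  rw [cells_eq_biUnion hε, measure_biUnion_finset (pairwiseDisjoint_cell hε _)
    fun i _ => measurableSet_cell hε i]
  simp [volume_cell hε]

theorem volume_real_cells {ε : ℝ} (hε : 0 < ε) (J : Finset (Fin 2 → ℤ)) :
    volume.real (cells ε J) = ε ^ 2 * J.card := by
  rw [Measure.real, volume_cells hε, ENNReal.toReal_mul, ENNReal.toReal_ofReal (by positivity)]
  simp [mul_comm]

theorem setIntegral_cells {E : Type*} [NormedAddCommGroup E] [NormedSpace ℝ E] [CompleteSpace E]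
    {ε : ℝ} (hε : 0 < ε) (J : Finset (Fin 2 → ℤ)) (g : (Fin 2 → ℤ) → E) :
    ∫ x in cells ε J, g (cellIndex ε x) = ε ^ 2 • ∑ i ∈ J, g i := by
  have hcongr (i : Fin 2 → ℤ) : EqOn (fun x => g (cellIndex ε x)) (fun _ => g i) (cell ε i) :=
    fun x hx => congrArg g ((mem_cell_iff hε).mp hx)
  rw [cells_eq_biUnion hε, integral_biUnion_finset J (fun i _ => measurableSet_cell hε i)
    (pairwiseDisjoint_cell hε _), Finset.smul_sum]
  · refine Finset.sum_congr rfl fun i _ => ?_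
    rw [setIntegral_congr_fun (measurableSet_cell hε i) (hcongr i), setIntegral_const,
      volume_real_cell hε]
  · intro i _
    refine IntegrableOn.congr_fun ?_ (hcongr i).symm (measurableSet_cell hε i)
    exact integrableOn_const (by rw [volume_cell hε]; exact ENNReal.ofReal_ne_top)

theorem dist_le_of_abs_le {x y : Plane} {r : ℝ} (h : ∀ a, |x a - y a| ≤ r) :
    dist x y ≤ 2 * r := by
  have hr : 0 ≤ r := (abs_nonneg _).trans (h 0)
  rw [EuclideanSpace.dist_eq, Fin.sum_univ_two, Real.dist_eq, Real.dist_eq]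
  apply Real.sqrt_le_iff.mpr ⟨by positivity, _⟩
  nlinarith [h 0, h 1, abs_nonneg (x 0 - y 0), abs_nonneg (x 1 - y 1)]

theorem dist_latticePt_le {ε : ℝ} {i : Fin 2 → ℤ} {x : Plane} (hx : x ∈ cell ε i) :
    dist x (latticePt ε i) ≤ ε := by
  have h := dist_le_of_abs_le (x := x) (y := latticePt ε i) (r := ε / 2) fun a => by
    have h1 := hx a
    change |x a - ε * (i a : ℝ)| ≤ ε / 2
    rw [abs_le]
    constructor <;> linarith [h1.1, h1.2]
  linarith

theorem latticePt_mem_cell {ε : ℝ} (hε : 0 < ε) (i : Fin 2 → ℤ) : latticePt ε i ∈ cell ε i := by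
  intro a
  change ε * ((i a : ℝ) - 1 / 2) ≤ ε * (i a : ℝ) ∧ ε * (i a : ℝ) < ε * ((i a : ℝ) + 1 / 2)
  constructor <;> nlinarith

theorem dist_latticePt_add_dirs {ε : ℝ} (hε : 0 ≤ ε) {d : Fin 2 → ℤ} (hd : d ∈ dirs)
    (i : Fin 2 → ℤ) : dist (latticePt ε (i + d)) (latticePt ε i) = ε := by
  rw [mem_dirs_iff] at hd
  have h : ∑ a, ((latticePt ε (i + d)) a - (latticePt ε i) a) ^ 2 = ε ^ 2 := by
    have h1 : ∀ a, (latticePt ε (i + d)) a - (latticePt ε i) a = ε * (d a : ℝ) := fun a => by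
      change ε * (((i + d) a : ℤ) : ℝ) - ε * (i a : ℝ) = _
      rw [Pi.add_apply]
      push_cast
      ring
    simp only [h1, mul_pow, ← Finset.mul_sum]
    have h2 : ∑ a, (d a : ℝ) ^ 2 = 1 := by exact_mod_cast congrArg (Int.cast (R := ℝ)) hd
    rw [h2, mul_one]
  rw [EuclideanSpace.dist_eq]
  simp only [Real.dist_eq, sq_abs]
  rw [h, Real.sqrt_sq hε]

/-- A point at distance at most `r` from a point on the other side of `∂Ω` has distance at most
`r` from `∂Ω`. -/
theorem mem_cthickening_frontier {Ω : Set Plane} {x y : Plane} {r : ℝ} (hx : x ∈ Ω) (hy : y ∉ Ω)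
    (hxy : dist x y ≤ r) {z : Plane} {s : ℝ} (hz : dist z x ≤ s) :
    z ∈ Metric.cthickening (r + s) (frontier Ω) := by
  -- The segment from x to y is connected; if it missed ∂Ω, it would lie in the interior of Ω or in
  -- that of the complement.
  have hseg : IsPreconnected (segment ℝ x y) := (convex_segment x y).isPreconnected
  obtain ⟨w, hw, hwf⟩ : (segment ℝ x y ∩ frontier Ω).Nonempty := by
    by_contra hemp
    have h1 : segment ℝ x y ⊆ interior Ω ∪ interior Ωᶜ := fun w hw => by
      by_contra hcon
      rw [mem_union, not_or, interior_compl, notMem_compl_iff] at hcon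
      exact hemp ⟨w, hw, hcon.2, hcon.1⟩
    have h2 := hseg.subset_or_subset isOpen_interior isOpen_interior
      (disjoint_compl_right.mono interior_subset interior_subset) h1
    rcases h2 with h2 | h2
    · exact hy (interior_subset (h2 (right_mem_segment ℝ x y)))
    · exact interior_subset (h2 (left_mem_segment ℝ x y)) hx
  refine Metric.mem_cthickening_of_dist_le z w _ _ hwf ?_
  have h3 : dist x w ≤ dist x y := by
    have := (convex_closedBall x (dist x y)).segment_subset
      (Metric.mem_closedBall_self dist_nonneg) (Metric.mem_closedBall'.mpr le_rfl) hw
    exact Metric.mem_closedBall'.mp this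
  linarith [dist_triangle z x w]

/-- The area of the layer of width `r` around `∂Ω`. -/
def layerArea (Ω : Set Plane) (r : ℝ) : ℝ := volume.real (Metric.cthickening r (frontier Ω))

theorem isCompact_frontier {Ω : Set Plane} (hΩ : Bornology.IsBounded Ω) :
    IsCompact (frontier Ω) :=
  Metric.isCompact_of_isClosed_isBounded isClosed_frontier
    (hΩ.closure.subset frontier_subset_closure)

theorem volume_cthickening_lt_top {Ω : Set Plane} (hΩ : Bornology.IsBounded Ω) (r : ℝ) :
    volume (Metric.cthickening r (frontier Ω)) < ∞ :=
  ((isCompact_frontier hΩ).isBounded.cthickening).measure_lt_top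

theorem volume_real_le_layerArea {Ω A : Set Plane} (hΩ : Bornology.IsBounded Ω) {r : ℝ}
    (hA : A ⊆ Metric.cthickening r (frontier Ω)) : volume.real A ≤ layerArea Ω r :=
  measureReal_mono hA (volume_cthickening_lt_top hΩ r).ne

/-- The graph of a continuous function is a null set of the plane. -/
theorem volume_graph_eq_zero {γ : ℝ → ℝ} (hγ : Continuous γ) :
    volume {y : Plane | γ (y 0) = y 1} = 0 := by
  have e : {y : Plane | γ (y 0) = y 1} = (WithLp.ofLp : Plane → (Fin 2 → ℝ)) ⁻¹'
      ((MeasurableEquiv.finTwoArrow : (Fin 2 → ℝ) ≃ᵐ ℝ × ℝ) ⁻¹' {p | γ p.1 = p.2}) := by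
    ext y
    simp [MeasurableEquiv.finTwoArrow]
  have hm : MeasurableSet {p : ℝ × ℝ | γ p.1 = p.2} :=
    (isClosed_eq (hγ.comp continuous_fst) continuous_snd).measurableSet
  rw [e, (PiLp.volume_preserving_ofLp (Fin 2)).measure_preimage
      ((MeasurableEquiv.measurable _) hm).nullMeasurableSet,
    (volume_preserving_finTwoArrow ℝ).measure_preimage hm.nullMeasurableSet,
    Measure.volume_eq_prod, Measure.measure_prod_null hm]
  -- By Fubini's theorem: each vertical slice of the graph is a single point.
  refine Eventually.of_forall fun x => ?_
  have : Prod.mk x ⁻¹' {p : ℝ × ℝ | γ p.1 = p.2} = {γ x} := by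
    ext t
    simp [eq_comm]
  change volume (Prod.mk x ⁻¹' {p : ℝ × ℝ | γ p.1 = p.2}) = 0
  rw [this]
  exact Real.volume_singleton

/-- This is where the Lipschitz property enters. In the local chart, points strictly above or below
the graph are interior to Ω or to its complement, so ∂Ω lies in the graph. -/
theorem volume_frontier_eq_zero {Ω : Set Plane} (hΩ : HasLipschitzBoundary Ω) :
    volume (frontier Ω) = 0 := by
  refine measure_null_of_locally_null _ fun x hx => ?_
  obtain ⟨T, γ, K, r, hγ, hr, h⟩ := hΩ x hx
  refine ⟨frontier Ω ∩ Metric.ball x r,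
    inter_mem_nhdsWithin _ (Metric.ball_mem_nhds x hr), ?_⟩
  have hsub : frontier Ω ∩ Metric.ball x r ⊆ T ⁻¹' {y : Plane | γ (y 0) = y 1} := by
    rintro y ⟨hyf, hyb⟩
    have hc0 : Continuous fun y : Plane => γ (T y 0) :=
      hγ.continuous.comp ((EuclideanSpace.proj (𝕜 := ℝ) (0 : Fin 2)).continuous.comp T.continuous)
    have hc1 : Continuous fun y : Plane => T y 1 :=
      (EuclideanSpace.proj (𝕜 := ℝ) (1 : Fin 2)).continuous.comp T.continuous
    have hball := Metric.isOpen_ball.mem_nhds hyb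
    change γ (T y 0) = T y 1
    rcases lt_trichotomy (γ (T y 0)) (T y 1) with hlt | heq | hgt
    · exfalso
      refine hyf.2 (mem_interior_iff_mem_nhds.mpr ?_)
      filter_upwards [hball, (isOpen_lt hc0 hc1).mem_nhds hlt] with w hw1 hw2
      exact (h w hw1).mpr hw2
    · exact heq
    · exfalso
      have : Ωᶜ ∈ 𝓝 y := by
        filter_upwards [hball, (isOpen_lt hc1 hc0).mem_nhds hgt] with w hw1 hw2 hwΩ
        exact lt_asymm ((h w hw1).mp hwΩ) hw2
      obtain ⟨w, hw1, hw2⟩ := mem_closure_iff_nhds.mp hyf.1 _ this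
      exact hw1 hw2
  refine measure_mono_null hsub ?_
  have hcl : IsClosed {y : Plane | γ (y 0) = y 1} :=
    isClosed_eq (hγ.continuous.comp (EuclideanSpace.proj (𝕜 := ℝ) (0 : Fin 2)).continuous)
      (EuclideanSpace.proj (𝕜 := ℝ) (1 : Fin 2)).continuous
  rw [T.measurePreserving.measure_preimage hcl.nullMeasurableSet]
  exact volume_graph_eq_zero hγ.continuous

/-- The closed neighbourhoods of the compact null set ∂Ω have measures that shrink to zero. All
boundary errors below are multiples of such an area. -/
theorem tendsto_layerArea {Ω : Set Plane} (hΩ : Bornology.IsBounded Ω)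
    (hlip : HasLipschitzBoundary Ω) : Tendsto (layerArea Ω) (𝓝 0) (𝓝 0) := by
  have h := tendsto_measure_cthickening_of_isCompact (μ := volume) (isCompact_frontier hΩ)
  rw [volume_frontier_eq_zero hlip] at h
  exact (ENNReal.tendsto_toReal ENNReal.zero_ne_top).comp h

theorem finite_latticePoints {ε : ℝ} (hε : 0 < ε) {Ω : Set Plane} (hΩ : Bornology.IsBounded Ω) :
    (latticePoints ε Ω).Finite := by
  obtain ⟨R, hR⟩ := hΩ.subset_closedBall 0
  refine (Set.Finite.pi' fun _ : Fin 2 => Set.finite_Icc (-⌈R / ε⌉) ⌈R / ε⌉).subset fun i hi a => ?_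
  have h1 : ‖latticePt ε i‖ ≤ R := mem_closedBall_zero_iff.mp (hR hi)
  have h2 : |ε * (i a : ℝ)| ≤ R := (PiLp.norm_apply_le (latticePt ε i) a).trans h1
  rw [abs_mul, abs_of_pos hε, ← le_div_iff₀' hε, abs_le] at h2
  have h3 := Int.le_ceil (R / ε)
  constructor
  · have : ((-⌈R / ε⌉ : ℤ) : ℝ) ≤ i a := by push_cast; linarith
    exact_mod_cast this
  · have : (i a : ℝ) ≤ ⌈R / ε⌉ := by linarith
    exact_mod_cast this

open Classical in
/-- The lattice points of `Ω`, as a finite set. -/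
def latticeFinset (ε : ℝ) (Ω : Set Plane) : Finset (Fin 2 → ℤ) :=
  if h : (latticePoints ε Ω).Finite then h.toFinset else ∅

theorem mem_latticeFinset {ε : ℝ} (hε : 0 < ε) {Ω : Set Plane} (hΩ : Bornology.IsBounded Ω)
    (i : Fin 2 → ℤ) : i ∈ latticeFinset ε Ω ↔ i ∈ latticePoints ε Ω := by
  rw [latticeFinset, dif_pos (finite_latticePoints hε hΩ), Set.Finite.mem_toFinset]

/-- The cells of lattice points of `Ω` that are not contained in `Ω` lie in the layer. -/
theorem cells_diff_subset {ε : ℝ} (hε : 0 < ε) {Ω : Set Plane} (hΩ : Bornology.IsBounded Ω) :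
    cells ε (latticeFinset ε Ω) \ Ω ⊆ Metric.cthickening (2 * ε) (frontier Ω) := by
  rintro x ⟨hx, hxΩ⟩
  have hi : latticePt ε (cellIndex ε x) ∈ Ω := (mem_latticeFinset hε hΩ _).mp hx
  have hd := dist_latticePt_le ((mem_cell_iff hε).mpr rfl : x ∈ cell ε (cellIndex ε x))
  rw [two_mul]
  exact mem_cthickening_frontier hi hxΩ (by rwa [dist_comm]) hd

theorem diff_cells_subset {ε : ℝ} (hε : 0 < ε) {Ω : Set Plane} (hΩ : Bornology.IsBounded Ω) :
    Ω \ cells ε (latticeFinset ε Ω) ⊆ Metric.cthickening (2 * ε) (frontier Ω) := by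
  rintro x ⟨hxΩ, hx⟩
  have hi : latticePt ε (cellIndex ε x) ∉ Ω := fun h => hx ((mem_latticeFinset hε hΩ _).mpr h)
  have hd := dist_latticePt_le ((mem_cell_iff hε).mpr rfl : x ∈ cell ε (cellIndex ε x))
  rw [two_mul]
  exact mem_cthickening_frontier hxΩ hi hd (by rw [dist_self]; exact hε.le)

theorem card_latticeFinset_le {ε : ℝ} (hε : 0 < ε) {Ω : Set Plane} (hΩ : Bornology.IsBounded Ω) :
    ε ^ 2 * (latticeFinset ε Ω).card ≤ volume.real Ω + layerArea Ω (2 * ε) := by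
  rw [← volume_real_cells hε]
  calc volume.real (cells ε (latticeFinset ε Ω))
      ≤ volume.real (Ω ∪ (cells ε (latticeFinset ε Ω) \ Ω)) := by
        refine measureReal_mono (fun x hx => ?_) ?_
        · by_cases h : x ∈ Ω
          · exact Or.inl h
          · exact Or.inr ⟨hx, h⟩
        · refine (measure_union_lt_top hΩ.measure_lt_top ?_).ne
          exact (measure_mono (cells_diff_subset hε hΩ)).trans_lt (volume_cthickening_lt_top hΩ _)
    _ ≤ volume.real Ω + volume.real (cells ε (latticeFinset ε Ω) \ Ω) := measureReal_union_le _ _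
    _ ≤ _ := by
        gcongr
        exact volume_real_le_layerArea hΩ (cells_diff_subset hε hΩ)

/-- A finite family of cells inside the layer is small. -/
theorem card_le_layerArea {ε : ℝ} (hε : 0 < ε) {Ω : Set Plane} (hΩ : Bornology.IsBounded Ω)
    {J : Finset (Fin 2 → ℤ)} {r : ℝ} (hJ : ∀ i ∈ J, cell ε i ⊆ Metric.cthickening r (frontier Ω)) :
    ε ^ 2 * J.card ≤ layerArea Ω r := by
  rw [← volume_real_cells hε]
  refine volume_real_le_layerArea hΩ fun x hx => hJ _ hx ((mem_cell_iff hε).mpr rfl)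

/-- A site with a neighbour outside Ω is within ε of the complement, so its whole cell lies in the
layer of width 2ε; it loses at most four bonds. -/
theorem boundaryCount_latticeFinset_le {ε : ℝ} (hε : 0 < ε) {Ω : Set Plane}
    (hΩ : Bornology.IsBounded Ω) :
    ε ^ 2 * boundaryCount (latticeFinset ε Ω) ≤ 4 * layerArea Ω (2 * ε) := by
  set L := latticeFinset ε Ω
  let J := L.filter fun i => ∃ d ∈ dirs, i + d ∉ L
  have h1 : boundaryCount L ≤ 4 * J.card := by
    have h2 : ∀ i ∈ L, (∑ d ∈ dirs, if i + d ∈ L then (0 : ℝ) else 1) ≤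
        if ∃ d ∈ dirs, i + d ∉ L then 4 else 0 := by
      intro i _
      split_ifs with h
      · calc (∑ d ∈ dirs, if i + d ∈ L then (0 : ℝ) else 1) ≤ ∑ d ∈ dirs, (1 : ℝ) :=
            Finset.sum_le_sum fun d _ => by split_ifs <;> norm_num
          _ = 4 := by simp [card_dirs]
      · push Not at h
        exact (Finset.sum_eq_zero fun d hd => if_pos (h d hd)).le
    refine (Finset.sum_le_sum h2).trans ?_
    rw [← Finset.sum_filter, Finset.sum_const, nsmul_eq_mul, mul_comm]
  have h3 : ε ^ 2 * J.card ≤ layerArea Ω (2 * ε) := by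
    refine card_le_layerArea hε hΩ fun i hi x hx => ?_
    obtain ⟨hiL, d, hd, hid⟩ := Finset.mem_filter.mp hi
    rw [mem_latticeFinset hε hΩ, mem_latticePoints] at hiL hid
    rw [two_mul]
    refine mem_cthickening_frontier hiL hid ?_ (dist_latticePt_le hx)
    rw [dist_comm, dist_latticePt_add_dirs hε.le hd]
  have h4 := mul_le_mul_of_nonneg_left h1 (sq_nonneg ε)
  linarith

end geometry

/-! ## The lower bound -/

section lower

variable {f : Circ → Circ → ℝ} {C : ℝ} {Ω : Set Plane}

theorem integrable_frobL {μ : Measure Plane} {Φ Q : Plane → SymMat} {B : ℝ} (hΦ : Integrable Φ μ)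
    (hQ : AEStronglyMeasurable Q μ) (hB : ∀ᵐ x ∂μ, ‖Q x‖ ≤ B) :
    Integrable (fun x => frobL (Φ x) (Q x)) μ := by
  refine Integrable.mono' (g := fun x => ‖Φ x‖ * B) (hΦ.norm.mul_const B)
    (frobL.aestronglyMeasurable_comp₂ hΦ.aestronglyMeasurable hQ) ?_
  filter_upwards [hB] with x hx
  rw [Real.norm_eq_abs]
  exact (abs_frobL_le _ _).trans (mul_le_mul_of_nonneg_left hx (norm_nonneg _))

theorem LinftySym.stronglyMeasurable (Q : LinftySym Ω) : StronglyMeasurable Q :=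
  Lp.stronglyMeasurable Q.toLp

theorem LinftySym.integrable (hΩ : Bornology.IsBounded Ω) (Q : LinftySym Ω) :
    Integrable Q (volume.restrict Ω) := by
  have : IsFiniteMeasure (volume.restrict Ω) :=
    ⟨by rw [Measure.restrict_apply_univ]; exact hΩ.measure_lt_top⟩
  exact (Lp.memLp Q.toLp).integrable le_top

theorem continuous_weak_pairing {Φ : Plane → SymMat} (hΦ : Integrable Φ (volume.restrict Ω)) :
    Continuous fun R : LinftySym Ω => ∫ x in Ω, frobL (Φ x) (R x) := by
  have h1 : Continuous fun (R : LinftySym Ω)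
      (Φ : {Φ : Plane → SymMat // Integrable Φ (volume.restrict Ω)}) =>
      ∫ x in Ω, frobInner (Φ.1 x) (R x) := continuous_induced_dom
  exact (continuous_apply (⟨Φ, hΦ⟩ : {Φ : Plane → SymMat //
    Integrable Φ (volume.restrict Ω)})).comp h1

theorem integrable_of_continuous_of_bounded (hΩ : Bornology.IsBounded Ω) {A : Plane → SymMat}
    (hA : Continuous A) {M : ℝ} (hM : ∀ x, ‖A x‖ ≤ M) : Integrable A (volume.restrict Ω) := by
  have : IsFiniteMeasure (volume.restrict Ω) :=
    ⟨by rw [Measure.restrict_apply_univ]; exact hΩ.measure_lt_top⟩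
  exact Integrable.of_bound hA.aestronglyMeasurable M (Eventually.of_forall hM)

/-- There are countably many cells, so their exceptional null sets merge into one. -/
theorem IsInterpolation.ae_eq {ε : ℝ} (hε : 0 < ε) {u : (Fin 2 → ℤ) → Circ} {R : LinftySym Ω}
    (h : IsInterpolation ε Ω u R) : ∀ᵐ x ∂(volume.restrict Ω),
      cellIndex ε x ∈ latticePoints ε Ω → R x = tensorSq (u (cellIndex ε x)) := by
  have h1 := (ae_ball_iff (Set.to_countable (latticePoints ε Ω))).mpr h.2
  filter_upwards [h1] with x hx hi
  exact hx _ hi ((mem_cell_iff hε).mpr rfl)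

/-- The lower bound of the energy by a field of affine minorants, for a fixed lattice spacing. -/
theorem field_le_spinEnergy (hC : ∀ u v, |f u v| ≤ C) (hΩo : IsOpen Ω)
    (hΩ : Bornology.IsBounded Ω) {A : Plane → SymMat} (hA : Continuous A)
    (hAf : ∀ x, A x ∈ minorants f) {M : ℝ} (hM : ∀ x, ‖A x‖ ≤ M) {ε ω : ℝ} (hε : 0 < ε)
    (hω : ∀ x ∈ Ω, ∀ y, dist x y ≤ ε → ‖A x - A y‖ ≤ ω) (hω0 : 0 ≤ ω)
    {u : (Fin 2 → ℤ) → Circ} {R : LinftySym Ω} (hR : IsInterpolation ε Ω u R) :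
    4 * ∫ x in Ω, frobL (A x) (R x) ≤ spinEnergy f ε Ω u +
      ((4 * C + 2 * ω + 8 * M) * layerArea Ω (2 * ε) + 6 * ω * volume.real Ω) := by
  set L := latticeFinset ε Ω
  set U := cells ε L
  have hM0 : 0 ≤ M := (norm_nonneg _).trans (hM 0)
  have hC0 : 0 ≤ C := (abs_nonneg _).trans (hC (u 0) (u 0))
  let g : (Fin 2 → ℤ) → ℝ := fun i => frobL (A (latticePt ε i)) (tensorSq (u i))
  have hg (i : Fin 2 → ℤ) : ‖g i‖ ≤ M := by
    refine (abs_frobL_le _ _).trans ?_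
    calc _ ≤ M * 1 := mul_le_mul (hM _) (norm_tensorSq_le _) (norm_nonneg _) hM0
      _ = M := mul_one M
  have hUm : MeasurableSet U := measurableSet_cells ε L
  have hUfin : volume U < ∞ := by
    rw [volume_cells hε]
    exact ENNReal.mul_lt_top (ENNReal.natCast_lt_top _) ENNReal.ofReal_lt_top
  have hGm : Measurable fun x => g (cellIndex ε x) :=
    (measurable_of_countable g).comp (measurable_cellIndex ε)
  have hGU : IntegrableOn (fun x => g (cellIndex ε x)) U := by
    refine Measure.integrableOn_of_bounded hUfin.ne hGm.aestronglyMeasurable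
      (Eventually.of_forall fun x => hg _)
  have hGΩ : IntegrableOn (fun x => g (cellIndex ε x)) Ω :=
    Measure.integrableOn_of_bounded hΩ.measure_lt_top.ne hGm.aestronglyMeasurable
      (Eventually.of_forall fun x => hg _)
  have hRb : ∀ᵐ x ∂(volume.restrict Ω), ‖R x‖ ≤ 1 := by
    filter_upwards [hR.1] with x hx
    exact norm_le_one_of_mem_tensorBody hx
  have hpb : ∀ᵐ x ∂(volume.restrict Ω), ‖frobL (A x) (R x)‖ ≤ M := by
    filter_upwards [hRb] with x hx
    refine (abs_frobL_le _ _).trans ?_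
    calc _ ≤ M * 1 := mul_le_mul (hM _) hx (norm_nonneg _) hM0
      _ = M := mul_one M
  have hpi : IntegrableOn (fun x => frobL (A x) (R x)) Ω :=
    integrable_frobL (integrable_of_continuous_of_bounded hΩ hA hM)
      R.stronglyMeasurable.aestronglyMeasurable hRb
  -- The integral over Ω is compared with the sum over lattice points, that is, the integral of `g`
  -- over `U`. The parts outside Ω ∩ U cost M times the layer area each, and the field differs from
  -- its lattice samples by ω on Ω ∩ U. The factor 4 gives 8M and 4ω; the remaining 2ω and 4C come
  -- from the bond estimate.
  have s1 := integral_inter_add_sdiff hUm hpi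
  have s2 := integral_inter_add_sdiff hΩo.measurableSet hGU
  have b1 : ‖∫ x in Ω \ U, frobL (A x) (R x)‖ ≤ M * layerArea Ω (2 * ε) := by
    refine (norm_setIntegral_le_of_norm_le_const_ae' (C := M)
      ((measure_mono sdiff_subset).trans_lt hΩ.measure_lt_top) ?_).trans
      (mul_le_mul_of_nonneg_left (volume_real_le_layerArea hΩ (diff_cells_subset hε hΩ)) hM0)
    have := (ae_restrict_iff' hΩo.measurableSet).mp hpb
    filter_upwards [this] with x hx hx2
    exact hx hx2.1
  have b2 : ‖∫ x in U \ Ω, g (cellIndex ε x)‖ ≤ M * layerArea Ω (2 * ε) :=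
    (norm_setIntegral_le_of_norm_le_const ((measure_mono sdiff_subset).trans_lt hUfin)
      (fun x _ => hg _)).trans
      (mul_le_mul_of_nonneg_left (volume_real_le_layerArea hΩ (cells_diff_subset hε hΩ)) hM0)
  have b3 : ‖∫ x in Ω ∩ U, (frobL (A x) (R x) - g (cellIndex ε x))‖ ≤
      ω * volume.real (Ω ∩ U) := by
    refine norm_setIntegral_le_of_norm_le_const_ae'
      ((measure_mono inter_subset_left).trans_lt hΩ.measure_lt_top) ?_
    have h1 := (ae_restrict_iff' hΩo.measurableSet).mp (hR.ae_eq hε)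
    filter_upwards [h1] with x hx ⟨hxΩ, hxU⟩
    rw [hx hxΩ ((mem_latticeFinset hε hΩ _).mp hxU)]
    have h2 := hω x hxΩ _
      (dist_latticePt_le ((mem_cell_iff hε).mpr rfl : x ∈ cell ε (cellIndex ε x)))
    have e : frobL (A x) (tensorSq (u (cellIndex ε x))) - g (cellIndex ε x) =
        frobL (A x - A (latticePt ε (cellIndex ε x))) (tensorSq (u (cellIndex ε x))) := by
      rw [map_sub, sub_apply]
    rw [e]
    refine (abs_frobL_le _ _).trans ?_
    calc _ ≤ ω * 1 := mul_le_mul h2 (norm_tensorSq_le _) (norm_nonneg _) hω0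
      _ = ω := mul_one ω
  rw [integral_sub (hpi.mono_set inter_subset_left) (hGΩ.mono_set inter_subset_left)] at b3
  have b4 : ω * volume.real (Ω ∩ U) ≤ ω * volume.real Ω :=
    mul_le_mul_of_nonneg_left (measureReal_mono inter_subset_left hΩ.measure_lt_top.ne) hω0
  rw [setIntegral_cells hε, inter_comm, smul_eq_mul] at s2
  have b5 := sum_minorants_le_bondSum hC (L := L) (A := fun i => A (latticePt ε i))
    (fun i => hAf _) hω0 (fun i hi d hd _ => by
      rw [norm_sub_rev]
      refine hω (latticePt ε i) ((mem_latticeFinset hε hΩ i).mp hi) _ ?_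
      rw [dist_comm, dist_latticePt_add_dirs hε.le hd]) u
  have b6 := mul_le_mul_of_nonneg_left b5 (sq_nonneg ε)
  rw [spinEnergy_eq_bondSum (mem_latticeFinset hε hΩ)]
  have b7 := mul_le_mul_of_nonneg_left (boundaryCount_latticeFinset_le hε hΩ) hC0
  have b8 := mul_le_mul_of_nonneg_left (card_latticeFinset_le hε hΩ) hω0
  rw [Real.norm_eq_abs] at b1 b2 b3
  change ε ^ 2 * (4 * ∑ i ∈ L, g i) ≤ _ at b6
  linarith [le_of_abs_le b1, neg_le_of_abs_le b2, le_of_abs_le b3]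

/-- The threshold for ε is uniform in the configuration, as a lower limit taken jointly in ε and R
requires. -/
theorem eventually_field_le_spinEnergy (hC : ∀ u v, |f u v| ≤ C) (hΩo : IsOpen Ω)
    (hΩ : Bornology.IsBounded Ω) (hlip : HasLipschitzBoundary Ω) {A : Plane → SymMat}
    (hA : Continuous A) (hAf : ∀ x, A x ∈ minorants f) {M : ℝ} (hM : ∀ x, ‖A x‖ ≤ M) {δ : ℝ}
    (hδ : 0 < δ) : ∀ᶠ ε in 𝓝[>] (0 : ℝ), ∀ (u : (Fin 2 → ℤ) → Circ) (R : LinftySym Ω),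
      IsInterpolation ε Ω u R → 4 * ∫ x in Ω, frobL (A x) (R x) ≤ spinEnergy f ε Ω u + δ := by
  -- Lattice points near cells that meet Ω may lie outside Ω, so uniform continuity is taken on a
  -- compact neighbourhood of Ω.
  have hK : IsCompact (Metric.cthickening 1 Ω) :=
    Metric.isCompact_of_isClosed_isBounded Metric.isClosed_cthickening hΩ.cthickening
  have hV : 0 ≤ volume.real Ω := measureReal_nonneg
  set ω := δ / (2 * (6 * volume.real Ω + 1)) with hω
  have hω0 : 0 < ω := by positivity
  obtain ⟨η, hη, hη2⟩ := Metric.uniformContinuousOn_iff_le.mp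
    (hK.uniformContinuousOn_of_continuous hA.continuousOn) ω hω0
  have l1 : Tendsto (fun ε : ℝ => (4 * C + 2 * ω + 8 * M) * layerArea Ω (2 * ε)) (𝓝[>] 0)
      (𝓝 ((4 * C + 2 * ω + 8 * M) * 0)) := by
    refine tendsto_const_nhds.mul ((tendsto_layerArea hΩ hlip).comp ?_)
    have : Tendsto (fun ε : ℝ => 2 * ε) (𝓝 0) (𝓝 (2 * 0)) := by
      exact (continuous_const.mul continuous_id).tendsto 0
    rw [mul_zero] at this
    exact this.mono_left nhdsWithin_le_nhds
  rw [mul_zero] at l1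
  filter_upwards [l1.eventually (gt_mem_nhds (half_pos hδ)), Ioo_mem_nhdsGT (lt_min hη one_pos)]
    with ε hε1 hε2 u R hR
  have hosc : ∀ x ∈ Ω, ∀ y, dist x y ≤ ε → ‖A x - A y‖ ≤ ω := fun x hx y hxy => by
    rw [← dist_eq_norm]
    refine hη2 x (Metric.self_subset_cthickening _ hx) y
      (Metric.mem_cthickening_of_dist_le y x _ _ hx ?_) (hxy.trans ?_)
    · rw [dist_comm]
      exact hxy.trans (hε2.2.le.trans (min_le_right _ _))
    · exact hε2.2.le.trans (min_le_left _ _)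
  have h := field_le_spinEnergy hC hΩo hΩ hA hAf hM hε2.1 hosc hω0.le hR
  have h2 : 6 * ω * volume.real Ω ≤ δ / 2 := by
    have : ω * (6 * volume.real Ω + 1) = δ / 2 := by rw [hω]; field_simp
    linarith
  linarith

end lower

/-! ## Approximation of the limit energy by fields of affine minorants -/

section fields

variable {f : Circ → Circ → ℝ} {C : ℝ} {Ω : Set Plane}

/-- Countably many affine minorants suffice. -/
theorem exists_seq_tendsto_supMinorants (hC : ∀ u v, |f u v| ≤ C) :
    ∃ a : ℕ → SymMat, (∀ k, a k ∈ minorants f) ∧ ∀ P ∈ tensorBody,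
      Tendsto (fun n => partialSups (fun k => frobL (a k) P) n) atTop
        (𝓝 (supMinorants f P)) := by
  have : Nonempty (minorants f) := ⟨⟨_, const_mem_minorants hC⟩⟩
  have : ProperSpace SymMat := FiniteDimensional.proper ℝ SymMat
  -- A dense sequence suffices, since A ↦ A : P is continuous for each fixed P.
  let a := TopologicalSpace.denseSeq (minorants f)
  refine ⟨fun k => a k, fun k => (a k).2, fun P hP => tendsto_order.mpr ⟨fun t ht => ?_,
    fun t ht => Eventually.of_forall fun n => ?_⟩⟩
  · obtain ⟨A, hA, hAt⟩ := exists_lt_frobL hC ht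
    have hopen : IsOpen {B : minorants f | t < frobL (B : SymMat) P} :=
      isOpen_lt continuous_const ((frobL.flip P).continuous.comp continuous_subtype_val)
    obtain ⟨k, hk⟩ := (TopologicalSpace.denseRange_denseSeq (minorants f)).exists_mem_open hopen
      ⟨⟨A, hA⟩, hAt⟩
    filter_upwards [eventually_ge_atTop k] with n hn
    exact lt_of_lt_of_le hk (le_partialSups_of_le (fun k => frobL (a k : SymMat) P) hn)
  · refine lt_of_le_of_lt (partialSups_le _ _ _ fun k _ => ?_) ht
    exact le_supMinorants hC (a k).2 hP

theorem abs_partialSups_le {a : ℕ → SymMat} (ha : ∀ k, a k ∈ minorants f)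
    (hC : ∀ u v, |f u v| ≤ C) {P : SymMat} (hP : P ∈ tensorBody) (n : ℕ) :
    |partialSups (fun k => frobL (a k) P) n| ≤ C + ‖a 0‖ := by
  have hC0 : 0 ≤ C := (abs_nonneg _).trans (abs_supMinorants_le hC hP)
  have h1 : partialSups (fun k => frobL (a k) P) n ≤ C :=
    partialSups_le _ _ _ fun k _ => minorants_le hC (ha k) hP
  have h2 : frobL (a 0) P ≤ partialSups (fun k => frobL (a k) P) n :=
    le_partialSups_of_le (fun k => frobL (a k) P) (Nat.zero_le n)
  have h3 : |frobL (a 0) P| ≤ ‖a 0‖ * 1 := (abs_frobL_le _ _).trans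
    (mul_le_mul_of_nonneg_left (norm_le_one_of_mem_tensorBody hP) (norm_nonneg _))
  rw [abs_le]
  constructor <;> linarith [neg_le_of_abs_le h3, norm_nonneg (a 0)]

theorem measurable_frobL_comp {Q : Plane → SymMat} (hQ : StronglyMeasurable Q) (A : SymMat) :
    Measurable fun x => frobL A (Q x) :=
  ((frobL A).continuous.comp_stronglyMeasurable hQ).measurable

theorem measurable_partialSups {Q : Plane → SymMat} (hQ : StronglyMeasurable Q)
    (a : ℕ → SymMat) (n : ℕ) :
    Measurable fun x => partialSups (fun k => frobL (a k) (Q x)) n := by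
  induction n with
  | zero => simpa only [partialSups_zero] using measurable_frobL_comp hQ (a 0)
  | succ n ih =>
    simp only [partialSups_add_one]
    exact ih.sup (measurable_frobL_comp hQ _)

/-- Measurability is the point: along Q the envelope is an a.e. limit of finite suprema of
measurable functions. -/
theorem integrableOn_supMinorants (hC : ∀ u v, |f u v| ≤ C) (hΩ : Bornology.IsBounded Ω)
    {Q : Plane → SymMat} (hQ : StronglyMeasurable Q)
    (hQK : ∀ᵐ x ∂(volume.restrict Ω), Q x ∈ tensorBody) :
    IntegrableOn (fun x => supMinorants f (Q x)) Ω := by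
  obtain ⟨a, ha, hlim⟩ := exists_seq_tendsto_supMinorants hC
  have hfin : IsFiniteMeasure (volume.restrict Ω) :=
    ⟨by rw [Measure.restrict_apply_univ]; exact hΩ.measure_lt_top⟩
  refine Integrable.of_bound
    (aestronglyMeasurable_of_tendsto_ae atTop
      (f := fun n x => partialSups (fun k => frobL (a k) (Q x)) n)
      (fun n => (measurable_partialSups hQ a n).aestronglyMeasurable) ?_) C ?_
  · filter_upwards [hQK] with x hx
    exact hlim _ hx
  · filter_upwards [hQK] with x hx
    exact abs_supMinorants_le hC hx

/-- Indicators are approximated in `L¹` by continuous functions with values in `[0, 1]`. -/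
theorem exists_continuous_cutoff (hΩo : IsOpen Ω) (hΩ : Bornology.IsBounded Ω) {E : Set Plane}
    (hE : MeasurableSet E) {δ : ℝ} (hδ : 0 < δ) : ∃ ψ : Plane → ℝ, Continuous ψ ∧
      (∀ x, ψ x ∈ Icc (0 : ℝ) 1) ∧ ∫ x in Ω, |E.indicator 1 x - ψ x| ≤ δ := by
  have hint : Integrable ((E ∩ Ω).indicator (1 : Plane → ℝ)) :=
    (integrable_indicator_iff (hE.inter hΩo.measurableSet)).mpr
      (integrableOn_const ((measure_mono inter_subset_right).trans_lt hΩ.measure_lt_top).ne)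
  obtain ⟨g, -, hg2, hgc, hgi⟩ := hint.exists_hasCompactSupport_integral_sub_le hδ
  -- Clipping to [0, 1] does not increase the distance to a function with values 0 and 1.
  refine ⟨fun x => max 0 (min 1 (g x)), by fun_prop,
    fun x => ⟨le_max_left _ _, max_le zero_le_one (min_le_left _ _)⟩, ?_⟩
  refine le_trans ?_ hg2
  refine le_trans ?_ (setIntegral_le_integral (s := Ω) (hint.sub hgi).norm
    (Eventually.of_forall fun x => norm_nonneg _))
  refine integral_mono_of_nonneg (Eventually.of_forall fun x => abs_nonneg _)
    (hint.sub hgi).norm.integrableOn ?_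
  filter_upwards [ae_restrict_mem hΩo.measurableSet] with x hx
  have h : (E ∩ Ω).indicator (1 : Plane → ℝ) x = E.indicator 1 x := by
    by_cases hxE : x ∈ E <;> simp [indicator, hxE, hx]
  simp only [h, Real.norm_eq_abs]
  have h01 : E.indicator (1 : Plane → ℝ) x = 0 ∨ E.indicator (1 : Plane → ℝ) x = 1 := by
    by_cases hxE : x ∈ E <;> simp [indicator, hxE]
  rcases h01 with h0 | h0 <;> rw [h0]
  · rw [zero_sub, zero_sub, abs_neg, abs_neg, abs_of_nonneg (le_max_left _ _)]
    exact max_le (abs_nonneg _) ((min_le_right _ _).trans (le_abs_self _))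
  · rcases le_total (g x) 1 with h1 | h1
    · rw [min_eq_right h1, abs_of_nonneg (sub_nonneg.mpr (max_le zero_le_one h1)),
        abs_of_nonneg (sub_nonneg.mpr h1)]
      linarith [le_max_right 0 (g x)]
    · simp [min_eq_left h1]

/-- A finite supremum of affine minorants along `Q` is approximated by continuous fields. -/
theorem exists_field_partialSups (hC : ∀ u v, |f u v| ≤ C) (hΩo : IsOpen Ω)
    (hΩ : Bornology.IsBounded Ω) {Q : Plane → SymMat} (hQ : StronglyMeasurable Q)
    (hQK : ∀ᵐ x ∂(volume.restrict Ω), Q x ∈ tensorBody) {a : ℕ → SymMat}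
    (ha : ∀ k, a k ∈ minorants f) (n : ℕ) : ∀ δ > 0, ∃ (A : Plane → SymMat) (M : ℝ),
      Continuous A ∧ (∀ x, A x ∈ minorants f) ∧ (∀ x, ‖A x‖ ≤ M) ∧
      ∫ x in Ω, |partialSups (fun k => frobL (a k) (Q x)) n - frobL (A x) (Q x)| ≤ δ := by
  have hQ1 : ∀ᵐ x ∂(volume.restrict Ω), ‖Q x‖ ≤ 1 := by
    filter_upwards [hQK] with x hx
    exact norm_le_one_of_mem_tensorBody hx
  have hfin : IsFiniteMeasure (volume.restrict Ω) :=
    ⟨by rw [Measure.restrict_apply_univ]; exact hΩ.measure_lt_top⟩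
  induction n with
  | zero =>
    intro δ hδ
    exact ⟨fun _ => a 0, ‖a 0‖, continuous_const, fun _ => ha 0, fun _ => le_rfl,
      by simpa using hδ.le⟩
  | succ n ih =>
    intro δ hδ
    obtain ⟨A, M, hA, hAf, hM, hAi⟩ := ih (δ / 2) (half_pos hδ)
    have hM0 : 0 ≤ M := (norm_nonneg _).trans (hM 0)
    set b := a (n + 1)
    let g : Plane → ℝ := fun x => partialSups (fun k => frobL (a k) (Q x)) n
    have hg : Measurable g := measurable_partialSups hQ a n
    have hgi : Integrable g (volume.restrict Ω) := by
      refine Integrable.of_bound hg.aestronglyMeasurable (C + ‖a 0‖) ?_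
      filter_upwards [hQK] with x hx
      exact abs_partialSups_le ha hC hx n
    have hpi : Integrable (fun x => frobL (A x) (Q x)) (volume.restrict Ω) :=
      integrable_frobL (integrable_of_continuous_of_bounded hΩ hA hM)
        hQ.aestronglyMeasurable hQ1
    have hbm : Measurable fun x => frobL b (Q x) := measurable_frobL_comp hQ b
    -- On `E` the earlier supremum wins, off it the new minorant b. The exact selector is the
    -- indicator of `E`, which is replaced by a continuous cutoff.
    set E := {x | frobL b (Q x) ≤ g x} with hE_def
    have hE : MeasurableSet E := measurableSet_le hbm hg
    set m := M + ‖b‖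
    have hm : 0 ≤ m := add_nonneg hM0 (norm_nonneg _)
    obtain ⟨ψ, hψ, hψ01, hψi⟩ :=
      exists_continuous_cutoff hΩo hΩ hE (δ := δ / (2 * (m + 1))) (by positivity)
    have hψint : Integrable (fun x => |E.indicator 1 x - ψ x|) (volume.restrict Ω) := by
      refine Integrable.of_bound (C := 1)
        ((measurable_one.indicator hE).sub hψ.measurable).abs.aestronglyMeasurable
        (Eventually.of_forall fun x => ?_)
      have := hψ01 x
      rw [Real.norm_eq_abs, abs_abs, abs_le]
      by_cases hx : x ∈ E <;> simp only [indicator, hx, if_true, if_false, Pi.one_apply] <;>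
        constructor <;> linarith [this.1, this.2]
    refine ⟨fun x => ψ x • A x + (1 - ψ x) • b, m, by fun_prop, fun x =>
      convex_minorants (hAf x) (ha _) (hψ01 x).1 (by linarith [(hψ01 x).2]) (by ring),
      fun x => ?_, ?_⟩
    · refine (norm_add_le _ _).trans ?_
      have h01 := hψ01 x
      rw [norm_smul, norm_smul, Real.norm_of_nonneg h01.1,
        Real.norm_of_nonneg (by linarith [h01.2])]
      refine add_le_add ?_ ?_
      · exact (mul_le_of_le_one_left (norm_nonneg _) h01.2).trans (hM x)
      · exact mul_le_of_le_one_left (norm_nonneg _) (by linarith [h01.1])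
    · have key : ∀ᵐ x ∂(volume.restrict Ω),
          |partialSups (fun k => frobL (a k) (Q x)) (n + 1) -
            frobL (ψ x • A x + (1 - ψ x) • b) (Q x)| ≤
          |g x - frobL (A x) (Q x)| + m * |E.indicator 1 x - ψ x| := by
        filter_upwards [hQ1] with x hx
        have e1 : partialSups (fun k => frobL (a k) (Q x)) (n + 1) =
            E.indicator 1 x * g x + (1 - E.indicator 1 x) * frobL b (Q x) := by
          rw [partialSups_add_one]
          change max (g x) (frobL b (Q x)) = _
          by_cases hxE : x ∈ E
          · rw [max_eq_left hxE]
            simp [indicator, hxE]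
          · have : g x ≤ frobL b (Q x) := (not_le.mp hxE).le
            rw [max_eq_right this]
            simp [indicator, hxE]
        have e2 : frobL (ψ x • A x + (1 - ψ x) • b) (Q x) =
            ψ x * frobL (A x) (Q x) + (1 - ψ x) * frobL b (Q x) := by
          simp only [map_add, map_smul, add_apply, smul_apply, smul_eq_mul]
        -- The error splits into that of the earlier field, kept only on `E`, and the cutoff error
        -- times a difference of pairings bounded by m.
        have e3 : partialSups (fun k => frobL (a k) (Q x)) (n + 1) -
            frobL (ψ x • A x + (1 - ψ x) • b) (Q x) =
            E.indicator 1 x * (g x - frobL (A x) (Q x)) +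
            (E.indicator 1 x - ψ x) * (frobL (A x) (Q x) - frobL b (Q x)) := by
          rw [e1, e2]
          ring
        have hbd (B : SymMat) : |frobL B (Q x)| ≤ ‖B‖ :=
          (abs_frobL_le _ _).trans (mul_le_of_le_one_right (norm_nonneg _) hx)
        have e4 : |frobL (A x) (Q x) - frobL b (Q x)| ≤ m :=
          (abs_sub _ _).trans (add_le_add ((hbd _).trans (hM x)) (hbd _))
        have e5 : |E.indicator (1 : Plane → ℝ) x| ≤ 1 := by
          by_cases hxE : x ∈ E <;> simp [indicator, hxE]
        rw [e3]
        refine (abs_add_le _ _).trans (add_le_add ?_ ?_)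
        · rw [abs_mul]
          exact mul_le_of_le_one_left (abs_nonneg _) e5
        · rw [abs_mul, mul_comm m]
          exact mul_le_mul_of_nonneg_left e4 (abs_nonneg _)
      have hi1 : Integrable (fun x => |g x - frobL (A x) (Q x)|) (volume.restrict Ω) :=
        (hgi.sub hpi).abs
      refine (integral_mono_of_nonneg (Eventually.of_forall fun x => abs_nonneg _)
        (hi1.add (hψint.const_mul m)) key).trans ?_
      simp only [Pi.add_apply]
      rw [integral_add hi1 (hψint.const_mul m), integral_const_mul]
      have h1 : m * ∫ x in Ω, |E.indicator 1 x - ψ x| ≤ m * (δ / (2 * (m + 1))) :=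
        mul_le_mul_of_nonneg_left hψi hm
      have h2 : m * (δ / (2 * (m + 1))) ≤ δ / 2 := by
        rw [mul_div_assoc', div_le_div_iff₀ (by positivity) two_pos]
        nlinarith
      linarith

/-- The limit energy is the supremum over continuous fields of affine minorants. -/
theorem exists_field (hC : ∀ u v, |f u v| ≤ C) (hΩo : IsOpen Ω)
    (hΩ : Bornology.IsBounded Ω) {Q : Plane → SymMat} (hQ : StronglyMeasurable Q)
    (hQK : ∀ᵐ x ∂(volume.restrict Ω), Q x ∈ tensorBody) {δ : ℝ} (hδ : 0 < δ) :
    ∃ (A : Plane → SymMat) (M : ℝ), Continuous A ∧ (∀ x, A x ∈ minorants f) ∧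
      (∀ x, ‖A x‖ ≤ M) ∧ ∫ x in Ω, supMinorants f (Q x) ≤ (∫ x in Ω, frobL (A x) (Q x)) + δ := by
  obtain ⟨a, ha, hlim⟩ := exists_seq_tendsto_supMinorants hC
  have hfin : IsFiniteMeasure (volume.restrict Ω) :=
    ⟨by rw [Measure.restrict_apply_univ]; exact hΩ.measure_lt_top⟩
  have hbd (n : ℕ) : ∀ᵐ x ∂(volume.restrict Ω),
      ‖partialSups (fun k => frobL (a k) (Q x)) n‖ ≤ C + ‖a 0‖ := by
    filter_upwards [hQK] with x hx
    exact abs_partialSups_le ha hC hx n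
  -- Finite suprema converge boundedly to the envelope on the bounded set Ω, so one finite stage is
  -- enough.
  have hconv : Tendsto (fun n => ∫ x in Ω, partialSups (fun k => frobL (a k) (Q x)) n) atTop
      (𝓝 (∫ x in Ω, supMinorants f (Q x))) := by
    refine tendsto_integral_of_dominated_convergence (fun _ => C + ‖a 0‖)
      (fun n => (measurable_partialSups hQ a n).aestronglyMeasurable) (integrable_const _) hbd ?_
    filter_upwards [hQK] with x hx
    exact hlim _ hx
  obtain ⟨n, hn⟩ := (hconv.eventually (lt_mem_nhds (sub_lt_self _ (half_pos hδ)))).exists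
  obtain ⟨A, M, hA, hAf, hM, hAi⟩ :=
    exists_field_partialSups hC hΩo hΩ hQ hQK ha n (δ / 2) (half_pos hδ)
  refine ⟨A, M, hA, hAf, hM, ?_⟩
  have hgi : Integrable (fun x => partialSups (fun k => frobL (a k) (Q x)) n)
      (volume.restrict Ω) :=
    Integrable.of_bound (measurable_partialSups hQ a n).aestronglyMeasurable _ (hbd n)
  have hpi : Integrable (fun x => frobL (A x) (Q x)) (volume.restrict Ω) :=
    integrable_frobL (integrable_of_continuous_of_bounded hΩ hA hM) hQ.aestronglyMeasurable (by
      filter_upwards [hQK] with x hx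
      exact norm_le_one_of_mem_tensorBody hx)
  have h1 := (le_abs_self _).trans ((abs_integral_le_integral_abs (μ := volume.restrict Ω)
    (f := fun x => partialSups (fun k => frobL (a k) (Q x)) n - frobL (A x) (Q x))).trans hAi)
  rw [integral_sub hgi hpi] at h1
  linarith

end fields

/-! ## The lower bound of the Gamma-limit -/

section liminf

variable {f : Circ → Circ → ℝ} {C : ℝ} {Ω : Set Plane}

/-- Rational test vectors are dense, so K is cut out by countably many half-spaces, with the trace
condition written as two inequalities. This lets "almost every x" be exchanged with "every
half-space". -/
theorem mem_tensorBody_of_rat {Q : SymMat} (h1 : 1 ≤ frobL (symOf 1 0 1) Q)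
    (h2 : -1 ≤ frobL (symOf (-1) 0 (-1)) Q)
    (h3 : ∀ p q : ℚ, 0 ≤ frobL (symOf ((p : ℝ) ^ 2) (p * q) ((q : ℝ) ^ 2)) Q) :
    Q ∈ tensorBody := by
  simp only [frobL_apply, frobInner_eq, symOf_zero_zero, symOf_zero_one, symOf_one_one] at *
  refine mem_tensorBody_iff.mpr ⟨by linarith, fun a b => ?_⟩
  have hcl : IsClosed {p : ℝ × ℝ | 0 ≤ p.1 ^ 2 * Q.toMatrix 0 0 +
      2 * (p.1 * p.2 * Q.toMatrix 0 1) + p.2 ^ 2 * Q.toMatrix 1 1} :=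
    isClosed_le continuous_const (by fun_prop)
  have hd : DenseRange (Prod.map ((↑) : ℚ → ℝ) ((↑) : ℚ → ℝ)) :=
    Rat.denseRange_cast.prodMap Rat.denseRange_cast
  exact hd.induction_on (p := fun p : ℝ × ℝ => 0 ≤ p.1 ^ 2 * Q.toMatrix 0 0 +
      2 * (p.1 * p.2 * Q.toMatrix 0 1) + p.2 ^ 2 * Q.toMatrix 1 1) (a, b) hcl fun p => h3 p.1 p.2

/-- A function with values outside `K` on a set of positive measure is separated from the
`K`-valued ones by a weak* continuous functional. -/
theorem exists_separating_pairing (hΩ : Bornology.IsBounded Ω) (Q : LinftySym Ω)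
    (hQ : ¬ ∀ᵐ x ∂(volume.restrict Ω), Q x ∈ tensorBody) :
    ∃ (Φ : Plane → SymMat) (c : ℝ), Integrable Φ (volume.restrict Ω) ∧
      ∫ x in Ω, frobL (Φ x) (Q x) < c ∧ ∀ R : LinftySym Ω,
        (∀ᵐ x ∂(volume.restrict Ω), R x ∈ tensorBody) → c ≤ ∫ x in Ω, frobL (Φ x) (R x) := by
  have hfin : IsFiniteMeasure (volume.restrict Ω) :=
    ⟨by rw [Measure.restrict_apply_univ]; exact hΩ.measure_lt_top⟩
  -- Otherwise Q would lie almost everywhere in each of countably many half-spaces that cut out K.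
  obtain ⟨A, c, hAK, hAQ⟩ : ∃ (A : SymMat) (c : ℝ), (∀ P ∈ tensorBody, c ≤ frobL A P) ∧
      ¬ ∀ᵐ x ∂(volume.restrict Ω), c ≤ frobL A (Q x) := by
    by_contra! h
    have h1 := h (symOf 1 0 1) 1 fun P hP => (frobL_symOf_of_mem 1 hP).ge
    have h2 := h (symOf (-1) 0 (-1)) (-1) fun P hP => (frobL_symOf_of_mem (-1) hP).ge
    have h3 : ∀ᵐ x ∂(volume.restrict Ω), ∀ p : ℚ × ℚ,
        0 ≤ frobL (symOf ((p.1 : ℝ) ^ 2) (p.1 * p.2) ((p.2 : ℝ) ^ 2)) (Q x) := by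
      refine ae_all_iff.mpr fun p => h _ 0 fun P hP => ?_
      have := (mem_tensorBody_iff.mp hP).2 p.1 p.2
      simpa only [frobL_apply, frobInner_eq, symOf_zero_zero, symOf_zero_one, symOf_one_one]
        using this
    apply hQ
    filter_upwards [h1, h2, h3] with x hx1 hx2 hx3
    exact mem_tensorBody_of_rat hx1 hx2 fun p q => hx3 (p, q)
  have hint (R : LinftySym Ω) : Integrable (fun x => frobL A (R x)) (volume.restrict Ω) :=
    (frobL A).integrable_comp (R.integrable hΩ)
  -- Integrating A : Q - c over a set where the half-space condition fails on average makes the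
  -- pointwise separation a weak* one; the test function is A times the indicator of s.
  obtain ⟨s, hs, hsneg⟩ : ∃ s, MeasurableSet s ∧
      ∫ x in s, (frobL A (Q x) - c) ∂(volume.restrict Ω) < 0 := by
    by_contra! h
    apply hAQ
    filter_upwards [ae_nonneg_of_forall_setIntegral_nonneg ((hint Q).sub (integrable_const c))
      fun s hs _ => h s hs] with x hx
    exact sub_nonneg.mp hx
  have hpair (R : LinftySym Ω) : ∫ x in Ω, frobL (s.indicator (fun _ => A) x) (R x) =
      ∫ x in s, frobL A (R x) ∂(volume.restrict Ω) := by
    rw [← integral_indicator hs]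
    refine integral_congr_ae (Eventually.of_forall fun x => ?_)
    by_cases hx : x ∈ s <;> simp [indicator, hx]
  refine ⟨s.indicator fun _ => A, ∫ x in s, c ∂(volume.restrict Ω),
    (integrable_const A).indicator hs, ?_, fun R hR => ?_⟩
  · rw [hpair, ← sub_neg, ← integral_sub (hint Q).integrableOn (integrable_const c)]
    exact hsneg
  · rw [hpair]
    refine integral_mono_ae (integrable_const c) (hint R).integrableOn ?_
    filter_upwards [ae_restrict_of_ae hR] with x hx
    exact hAK _ hx

theorem discreteFunctional_eq_top {ε : ℝ} {R : LinftySym Ω}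
    (hR : ¬ ∀ᵐ x ∂(volume.restrict Ω), R x ∈ tensorBody) : discreteFunctional f Ω ε R = ⊤ :=
  iInf₂_eq_top.mpr fun _ h => absurd h.1 hR

theorem limitFunctional_of_mem (hC : ∀ u v, |f u v| ≤ C) (hf_exchange : ∀ u v, f u v = f v u)
    (hf_headtail : ∀ u v, f u (-v) = f u v ∧ f (-u) v = f u v) {Q : LinftySym Ω}
    (hQ : ∀ᵐ x ∂(volume.restrict Ω), Q x ∈ tensorBody) :
    limitFunctional f Ω Q = ((4 * ∫ x in Ω, supMinorants f (Q x) : ℝ) : EReal) := by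
  rw [limitFunctional, if_pos hQ, integral_congr_ae]
  filter_upwards [hQ] with x hx
  exact fHatEnvelope_eq hC hf_exchange hf_headtail hx

theorem limitFunctional_le_liminf (hC : ∀ u v, |f u v| ≤ C)
    (hf_exchange : ∀ u v, f u v = f v u)
    (hf_headtail : ∀ u v, f u (-v) = f u v ∧ f (-u) v = f u v) (hΩo : IsOpen Ω)
    (hΩ : Bornology.IsBounded Ω) (hlip : HasLipschitzBoundary Ω) (Q : LinftySym Ω) :
    limitFunctional f Ω Q ≤ liminf (fun p : ℝ × LinftySym Ω => discreteFunctional f Ω p.1 p.2)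
      (𝓝[>] (0 : ℝ) ×ˢ 𝓝 Q) := by
  by_cases hQ : ∀ᵐ x ∂(volume.restrict Ω), Q x ∈ tensorBody
  · rw [limitFunctional_of_mem hC hf_exchange hf_headtail hQ]
    by_contra! hlt
    obtain ⟨b, hb1, hb2⟩ := EReal.lt_iff_exists_real_btwn.mp hlt
    rw [EReal.coe_lt_coe_iff] at hb2
    refine hb1.not_ge (le_liminf_of_le (by isBoundedDefault) ?_)
    set δ := (4 * ∫ x in Ω, supMinorants f (Q x)) - b with hδ_def
    have hδ : 0 < δ := sub_pos.mpr hb2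
    -- Error budget: the field and the weak* neighbourhood cost 4 · δ/16 each and the lattice
    -- spacing δ/4, in total less than δ.
    obtain ⟨A, M, hA, hAf, hM, hAQ⟩ := exists_field hC hΩo hΩ Q.stronglyMeasurable hQ
      (δ := δ / 16) (by positivity)
    have h1 := eventually_field_le_spinEnergy hC hΩo hΩ hlip hA hAf hM (δ := δ / 4)
      (by positivity)
    have hδ16 : (∫ x in Ω, frobL (A x) (Q x)) - δ / 16 < ∫ x in Ω, frobL (A x) (Q x) := by
      linarith
    have h2 : ∀ᶠ R in 𝓝 Q,
        (∫ x in Ω, frobL (A x) (Q x)) - δ / 16 < ∫ x in Ω, frobL (A x) (R x) :=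
      (continuous_weak_pairing (integrable_of_continuous_of_bounded hΩ hA hM)).continuousAt
        |>.eventually (lt_mem_nhds hδ16)
    filter_upwards [h1.prod_mk h2] with p ⟨hp1, hp2⟩
    refine le_iInf₂ fun u hu => EReal.coe_le_coe_iff.mpr ?_
    have := hp1 u p.2 hu
    linarith
  · obtain ⟨Φ, c, hΦ, hΦQ, hΦK⟩ := exists_separating_pairing hΩ Q hQ
    -- Near Q no function is K-valued almost everywhere, so the discrete functionals are identically
    -- `⊤` there.
    refine le_top.trans (le_liminf_of_le (by isBoundedDefault) ?_)
    have h2 : ∀ᶠ R in 𝓝 Q, ∫ x in Ω, frobL (Φ x) (R x) < c :=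
      (continuous_weak_pairing hΦ).continuousAt.eventually (gt_mem_nhds hΦQ)
    filter_upwards [tendsto_snd.eventually h2] with p hp
    rw [discreteFunctional_eq_top fun h => hp.not_ge (hΦK _ h)]

end liminf

/-! ## Recovery families -/

section blocks

variable {Ω : Set Plane}

/-- The index of the `n × n` block that contains a lattice point. -/
def blockIndex (n : ℕ) (i : Fin 2 → ℤ) : Fin 2 → ℤ := fun a => i a / n

/-- The block with a given index. -/
def block (n : ℕ) (b : Fin 2 → ℤ) : Finset (Fin 2 → ℤ) := box (fun a => n * b a) n

theorem mem_block {n : ℕ} (hn : 0 < n) {b i : Fin 2 → ℤ} : i ∈ block n b ↔ blockIndex n i = b := by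
  have hn' : (0 : ℤ) < n := by exact_mod_cast hn
  rw [block, mem_box, funext_iff]
  refine forall_congr' fun a => ?_
  -- Integer division by n > 0 rounds down also at negative coordinates, so the blocks tile the
  -- whole lattice.
  rw [blockIndex, Int.ediv_eq_iff_of_pos hn', mul_comm (b a)]

open Classical in
/-- The blocks whose cells are contained in `Ω`. -/
def innerBlocks (ε : ℝ) (n : ℕ) (Ω : Set Plane) : Finset (Fin 2 → ℤ) :=
  ((latticeFinset ε Ω).image (blockIndex n)).filter fun b => cells ε (block n b) ⊆ Ω

theorem block_subset_latticeFinset {ε : ℝ} (hε : 0 < ε) (hΩ : Bornology.IsBounded Ω) {n : ℕ}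
    {b : Fin 2 → ℤ} (hb : cells ε (block n b) ⊆ Ω) : block n b ⊆ latticeFinset ε Ω := by
  intro i hi
  rw [mem_latticeFinset hε hΩ, mem_latticePoints]
  apply hb
  have : cellIndex ε (latticePt ε i) = i := (mem_cell_iff hε).mp (latticePt_mem_cell hε i)
  change cellIndex ε (latticePt ε i) ∈ block n b
  rwa [this]

/-- The image in the definition only ensures finiteness: a block inside Ω has its corner among the
lattice points of Ω. -/
theorem mem_innerBlocks {ε : ℝ} (hε : 0 < ε) (hΩ : Bornology.IsBounded Ω) {n : ℕ} (hn : 0 < n)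
    {b : Fin 2 → ℤ} : b ∈ innerBlocks ε n Ω ↔ cells ε (block n b) ⊆ Ω := by
  classical
  rw [innerBlocks, Finset.mem_filter, and_iff_right_iff_imp, Finset.mem_image]
  intro h
  have hi : (fun a => (n : ℤ) * b a) ∈ block n b := by
    rw [block, mem_box]
    intro a
    have : (0 : ℤ) < n := by exact_mod_cast hn
    constructor <;> linarith
  exact ⟨_, block_subset_latticeFinset hε hΩ h hi, (mem_block hn).mp hi⟩

theorem dist_le_of_mem_block {ε : ℝ} (hε : 0 < ε) {n : ℕ} {b : Fin 2 → ℤ} {x y : Plane}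
    (hx : x ∈ cells ε (block n b)) (hy : y ∈ cells ε (block n b)) :
    dist x y ≤ 2 * (ε * n) := by
  have h (w : Plane) (hw : w ∈ cells ε (block n b)) (a : Fin 2) :
      ε * (n * b a - 1 / 2) ≤ w a ∧ w a ≤ ε * (n * b a + n - 1 / 2) := by
    have h1 := (mem_box.mp hw) a
    have h2 := ((mem_cell_iff hε).mpr rfl : w ∈ cell ε (cellIndex ε w)) a
    have h3 : (n * b a : ℝ) ≤ cellIndex ε w a := by exact_mod_cast h1.1
    have h4 : (cellIndex ε w a : ℝ) + 1 ≤ n * b a + n := by exact_mod_cast h1.2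
    constructor
    · refine le_trans ?_ h2.1
      gcongr
    · refine h2.2.le.trans ?_
      gcongr
      linarith
  refine dist_le_of_abs_le fun a => ?_
  have h1 := h x hx a
  have h2 := h y hy a
  rw [abs_le]
  constructor <;> nlinarith [h1.1, h1.2, h2.1, h2.2]

/-- The lattice points of the inner blocks. -/
def innerPoints (ε : ℝ) (n : ℕ) (Ω : Set Plane) : Finset (Fin 2 → ℤ) :=
  (innerBlocks ε n Ω).biUnion (block n)

theorem pairwiseDisjoint_block {n : ℕ} (hn : 0 < n) (B : Set (Fin 2 → ℤ)) :
    B.PairwiseDisjoint (block n) := fun _ _ _ _ h =>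
  Finset.disjoint_left.mpr fun _ hi hj =>
    h (((mem_block hn).mp hi).symm.trans ((mem_block hn).mp hj))

theorem mem_innerPoints {ε : ℝ} (hε : 0 < ε) (hΩ : Bornology.IsBounded Ω) {n : ℕ} (hn : 0 < n)
    {i : Fin 2 → ℤ} : i ∈ innerPoints ε n Ω ↔ cells ε (block n (blockIndex n i)) ⊆ Ω := by
  rw [innerPoints, Finset.mem_biUnion]
  simp only [mem_block hn]
  constructor
  · rintro ⟨b, hb, rfl⟩
    exact (mem_innerBlocks hε hΩ hn).mp hb
  · intro h
    exact ⟨_, (mem_innerBlocks hε hΩ hn).mpr h, rfl⟩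

theorem cells_innerPoints_eq {ε : ℝ} {n : ℕ} :
    cells ε (innerPoints ε n Ω) = ⋃ b ∈ innerBlocks ε n Ω, cells ε (block n b) := by
  ext x
  simp [cells, innerPoints]

theorem cells_innerPoints_subset {ε : ℝ} (hε : 0 < ε) (hΩ : Bornology.IsBounded Ω) {n : ℕ}
    (hn : 0 < n) : cells ε (innerPoints ε n Ω) ⊆ Ω := by
  rw [cells_innerPoints_eq]
  exact iUnion₂_subset fun b hb => (mem_innerBlocks hε hΩ hn).mp hb

/-- Points of `Ω` that belong to no inner block lie near `∂Ω`. -/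
theorem mem_layer_of_notMem_inner {ε : ℝ} (hε : 0 < ε) (hΩ : Bornology.IsBounded Ω) {n : ℕ}
    (hn : 0 < n) {x z : Plane} (hx : x ∈ Ω) (hxi : cellIndex ε x ∉ innerPoints ε n Ω)
    (hz : dist z x ≤ ε) : z ∈ Metric.cthickening (3 * (ε * n)) (frontier Ω) := by
  rw [mem_innerPoints hε hΩ hn, not_subset] at hxi
  obtain ⟨y, hy, hyΩ⟩ := hxi
  have hxb : x ∈ cells ε (block n (blockIndex n (cellIndex ε x))) := (mem_block hn).mpr rfl
  have h := mem_cthickening_frontier hx hyΩ (dist_le_of_mem_block hε hxb hy) hz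
  -- The block has diameter at most 2εn, and z is at most ε ≤ εn away from x.
  have hn1 : (1 : ℝ) ≤ n := by exact_mod_cast hn
  refine Metric.cthickening_mono ?_ _ h
  nlinarith

theorem diff_inner_subset {ε : ℝ} (hε : 0 < ε) (hΩ : Bornology.IsBounded Ω) {n : ℕ}
    (hn : 0 < n) : Ω \ cells ε (innerPoints ε n Ω) ⊆
      Metric.cthickening (3 * (ε * n)) (frontier Ω) := fun x hx =>
  mem_layer_of_notMem_inner hε hΩ hn hx.1 hx.2 (by rw [dist_self]; exact hε.le)

theorem card_sdiff_innerPoints_le {ε : ℝ} (hε : 0 < ε) (hΩ : Bornology.IsBounded Ω) {n : ℕ}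
    (hn : 0 < n) : ε ^ 2 * (latticeFinset ε Ω \ innerPoints ε n Ω).card ≤
      layerArea Ω (3 * (ε * n)) := by
  refine card_le_layerArea hε hΩ fun i hi x hx => ?_
  rw [Finset.mem_sdiff, mem_latticeFinset hε hΩ, mem_latticePoints] at hi
  refine mem_layer_of_notMem_inner hε hΩ hn hi.1 ?_ (dist_latticePt_le hx)
  rw [(mem_cell_iff hε).mp (latticePt_mem_cell hε i)]
  exact hi.2

theorem volume_real_block {ε : ℝ} (hε : 0 < ε) (n : ℕ) (b : Fin 2 → ℤ) :
    volume.real (cells ε (block n b)) = ε ^ 2 * n ^ 2 := by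
  rw [volume_real_cells hε, block, card_box, Nat.cast_pow]

theorem sum_volume_block_le {ε : ℝ} (hε : 0 < ε) (hΩ : Bornology.IsBounded Ω) {n : ℕ}
    (hn : 0 < n) : ∑ _b ∈ innerBlocks ε n Ω, ε ^ 2 * (n : ℝ) ^ 2 ≤ volume.real Ω := by
  have h : ε ^ 2 * ((innerPoints ε n Ω).card : ℝ) ≤ volume.real Ω := by
    rw [← volume_real_cells hε]
    exact measureReal_mono (cells_innerPoints_subset hε hΩ hn) hΩ.measure_lt_top.ne
  rw [innerPoints, Finset.card_biUnion (pairwiseDisjoint_block hn _)] at h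
  simp only [block, card_box] at h
  push_cast at h
  rwa [Finset.mul_sum] at h

theorem integral_innerBlocks {E : Type*} [NormedAddCommGroup E] [NormedSpace ℝ E]
    {ε : ℝ} (hε : 0 < ε) (hΩ : Bornology.IsBounded Ω) {n : ℕ} (hn : 0 < n) {g : Plane → E}
    (hg : IntegrableOn g Ω) : ∫ x in cells ε (innerPoints ε n Ω), g x =
      ∑ b ∈ innerBlocks ε n Ω, ∫ x in cells ε (block n b), g x := by
  rw [cells_innerPoints_eq, integral_biUnion_finset _ fun b _ => measurableSet_cells ε _]
  · exact fun b _ c _ h => Set.disjoint_left.mpr fun x hb hc =>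
      h (((mem_block hn).mp hb).symm.trans ((mem_block hn).mp hc))
  · exact fun b hb => hg.mono_set ((mem_innerBlocks hε hΩ hn).mp hb)

end blocks

/-! ### Stripe patterns adapted to the block averages of Q -/

section recovery

variable {f : Circ → Circ → ℝ} {C : ℝ} {Ω : Set Plane}

theorem setAverage_mem_tensorBody {Q : Plane → SymMat} {s : Set Plane} (hs0 : volume s ≠ 0)
    (hs : volume s ≠ ∞) (hQ : ∀ᵐ x ∂(volume.restrict s), Q x ∈ tensorBody)
    (hQi : IntegrableOn Q s) : ⨍ x in s, Q x ∈ tensorBody :=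
  convex_tensorBody.set_average_mem isClosed_tensorBody hs0 hs hQ hQi

/-- Jensen's inequality for the envelope. -/
theorem supMinorants_setAverage_le (hC : ∀ u v, |f u v| ≤ C) {Q : Plane → SymMat} {s : Set Plane}
    (hs0 : 0 < volume.real s) (hQ : ∀ᵐ x ∂(volume.restrict s), Q x ∈ tensorBody)
    (hQi : IntegrableOn Q s) (hH : IntegrableOn (fun x => supMinorants f (Q x)) s) :
    volume.real s * supMinorants f (⨍ x in s, Q x) ≤ ∫ x in s, supMinorants f (Q x) := by
  rw [mul_comm, ← le_div_iff₀ hs0]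
  -- For each single minorant the inequality is linear and integrates directly.
  refine supMinorants_le hC fun A hA => ?_
  rw [setAverage_eq, map_smul, ← (frobL A).integral_comp_comm hQi, smul_eq_mul, le_div_iff₀ hs0,
    mul_comm _ (volume.real s), mul_inv_cancel_left₀ hs0.ne']
  refine integral_mono_ae ((frobL A).integrable_comp hQi) hH ?_
  filter_upwards [hQ] with x hx
  exact le_supMinorants hC hA hx

/-- The element of `L^∞` with nodal values `u_i ⊗ u_i`. -/
theorem exists_interpolation {ε : ℝ} (hε : 0 < ε) (u : (Fin 2 → ℤ) → Circ) :
    ∃ R : LinftySym Ω, IsInterpolation ε Ω u R ∧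
      ∀ᵐ x ∂(volume.restrict Ω), R x = tensorSq (u (cellIndex ε x)) := by
  have hm : StronglyMeasurable fun x => tensorSq (u (cellIndex ε x)) :=
    (StronglyMeasurable.of_discrete (f := fun i => tensorSq (u i))).comp_measurable
      (measurable_cellIndex ε)
  have hL : MemLp (fun x => tensorSq (u (cellIndex ε x))) ∞ (volume.restrict Ω) :=
    memLp_top_of_bound hm.aestronglyMeasurable 1 (Eventually.of_forall fun x => norm_tensorSq_le _)
  have h : ∀ᵐ x ∂(volume.restrict Ω), (hL.toLp _ : Plane → SymMat) x =
      tensorSq (u (cellIndex ε x)) := hL.coeFn_toLp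
  refine ⟨hL.toLp _, ⟨?_, fun i _ => ?_⟩, h⟩
  · filter_upwards [h] with x hx
    exact hx.symm ▸ tensorSq_mem _
  · filter_upwards [h] with x hx hxi
    rw [mem_cell_iff hε] at hxi
    exact hx.trans (by rw [hxi])

/-- Patterns of stripes in square blocks: for each lattice spacing and block size, there is an
interpolation whose energy is close to the limit energy and which is close to `Q` on average. -/
theorem exists_block_recovery (hC : ∀ u v, |f u v| ≤ C) (hf_exchange : ∀ u v, f u v = f v u)
    (hΩo : IsOpen Ω) (hΩ : Bornology.IsBounded Ω) (Q : LinftySym Ω)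
    (hQ : ∀ᵐ x ∂(volume.restrict Ω), Q x ∈ tensorBody) :
    ∃ D : ℝ, 0 ≤ D ∧ ∀ ε > 0, ∀ n : ℕ, 0 < n →
      ∃ (u : (Fin 2 → ℤ) → Circ) (R : LinftySym Ω), IsInterpolation ε Ω u R ∧
        spinEnergy f ε Ω u ≤ (4 * ∫ x in Ω, supMinorants f (Q x)) +
          (8 * C * layerArea Ω (3 * (ε * n)) + D / n * volume.real Ω) ∧
        ∀ (φ : Plane → SymMat) (M ω : ℝ), Continuous φ → (∀ x, ‖φ x‖ ≤ M) → 0 ≤ ω →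
          (∀ x y, dist x y ≤ 2 * (ε * n) → ‖φ x - φ y‖ ≤ ω) →
          |(∫ x in Ω, frobL (φ x) (R x)) - ∫ x in Ω, frobL (φ x) (Q x)| ≤
            (2 * ω + M * (D / n)) * volume.real Ω + 2 * M * layerArea Ω (3 * (ε * n)) := by
  obtain ⟨D, hD0, hD⟩ := exists_pattern hC hf_exchange
  refine ⟨D, hD0, fun ε hε n hn => ?_⟩
  have hn' : (0 : ℝ) < n := Nat.cast_pos.mpr hn
  have hC0 : 0 ≤ C := (abs_nonneg _).trans (hC (circAngle 0) (circAngle 0))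
  set G := innerBlocks ε n Ω
  set J := innerPoints ε n Ω
  set L := latticeFinset ε Ω
  have hQi : IntegrableOn Q Ω := Q.integrable hΩ
  have hHi : IntegrableOn (fun x => supMinorants f (Q x)) Ω :=
    integrableOn_supMinorants hC hΩ Q.stronglyMeasurable hQ
  have hvol (b : Fin 2 → ℤ) : volume.real (cells ε (block n b)) = ε ^ 2 * n ^ 2 :=
    volume_real_block hε n b
  have hvpos (b : Fin 2 → ℤ) : 0 < volume.real (cells ε (block n b)) := by
    rw [hvol]
    positivity
  have hsub {b : Fin 2 → ℤ} (hb : b ∈ G) : cells ε (block n b) ⊆ Ω :=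
    (mem_innerBlocks hε hΩ hn).mp hb
  have hQb {b : Fin 2 → ℤ} (hb : b ∈ G) :
      ∀ᵐ x ∂(volume.restrict (cells ε (block n b))), Q x ∈ tensorBody :=
    ae_restrict_of_ae_restrict_of_subset (hsub hb) hQ
  let P : (Fin 2 → ℤ) → SymMat := fun b => ⨍ x in cells ε (block n b), Q x
  -- Patterns are needed on inner blocks only; elsewhere the configuration is arbitrary, and its
  -- bonds are charged to the layer.
  have hz : ∀ b, ∃ z : (Fin 2 → ℤ) → Circ, b ∈ G →
      ‖∑ i ∈ block n b, tensorSq (z i) - (n : ℝ) ^ 2 • P b‖ ≤ D * n ∧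
        ∀ (L : Finset (Fin 2 → ℤ)) (u : (Fin 2 → ℤ) → Circ), block n b ⊆ L →
          (∀ i ∈ block n b, u i = z i) →
          bondSum f (block n b) L u ≤ 4 * n ^ 2 * supMinorants f (P b) + D * n := by
    intro b
    by_cases hb : b ∈ G
    · have hPb : P b ∈ tensorBody := setAverage_mem_tensorBody
        (fun h => (hvpos b).ne' (by rw [Measure.real, h, ENNReal.toReal_zero]))
        ((measure_mono (hsub hb)).trans_lt hΩ.measure_lt_top).ne (hQb hb)
        (hQi.mono_set (hsub hb))
      obtain ⟨z, hz⟩ := hD _ hPb n hn fun a => n * b a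
      exact ⟨z, fun _ => hz⟩
    · exact ⟨fun _ => circAngle 0, fun h => absurd h hb⟩
  choose z hz using hz
  let u : (Fin 2 → ℤ) → Circ := fun i => z (blockIndex n i) i
  have huz (b : Fin 2 → ℤ) : ∀ i ∈ block n b, u i = z b i := fun i hi => by
    simp only [u, (mem_block hn).mp hi]
  obtain ⟨R, hR, hRu⟩ := exists_interpolation (Ω := Ω) hε u
  have hJm : MeasurableSet (cells ε J) := measurableSet_cells ε J
  have hJsub : cells ε J ⊆ Ω := cells_innerPoints_subset hε hΩ hn
  have hlayer : volume.real (Ω \ cells ε J) ≤ layerArea Ω (3 * (ε * n)) :=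
    volume_real_le_layerArea hΩ (diff_inner_subset hε hΩ hn)
  have hlfin : volume (Ω \ cells ε J) < ∞ := (measure_mono sdiff_subset).trans_lt hΩ.measure_lt_top
  have hsplit {g : Plane → ℝ} (hg : IntegrableOn g Ω) : ∫ x in Ω, g x =
      (∑ b ∈ G, ∫ x in cells ε (block n b), g x) + ∫ x in Ω \ cells ε J, g x := by
    rw [← integral_innerBlocks hε hΩ hn hg, ← integral_inter_add_sdiff hJm hg,
      inter_eq_right.mpr hJsub]
  have hrem {g : Plane → ℝ} {B : ℝ} (hB : 0 ≤ B)
      (hg : ∀ᵐ x ∂(volume.restrict Ω), ‖g x‖ ≤ B) :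
      ‖∫ x in Ω \ cells ε J, g x‖ ≤ B * layerArea Ω (3 * (ε * n)) := by
    refine (norm_setIntegral_le_of_norm_le_const_ae' hlfin ?_).trans
      (mul_le_mul_of_nonneg_left hlayer hB)
    filter_upwards [(ae_restrict_iff' hΩo.measurableSet).mp hg] with x hx hx2
    exact hx hx2.1
  have hnum : D / n * (ε ^ 2 * n ^ 2) = ε ^ 2 * (D * n) := by field_simp
  refine ⟨u, R, hR, ?_, fun φ M ω hφ hM hω0 hω => ?_⟩
  · have hJL : J ⊆ L := Finset.biUnion_subset.mpr fun b hb =>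
      block_subset_latticeFinset hε hΩ (hsub hb)
    have e1 : bondSum f L L u = bondSum f (L \ J) L u + ∑ b ∈ G, bondSum f (block n b) L u := by
      rw [bondSum, ← Finset.sum_sdiff hJL]
      congr 1
      exact Finset.sum_biUnion (pairwiseDisjoint_block hn _)
    -- Sites outside the inner blocks have four bonds of energy at most C and, after scaling, fill
    -- at most the layer.
    have e2 : bondSum f (L \ J) L u ≤ 4 * C * (L \ J).card := by
      calc bondSum f (L \ J) L u ≤ ∑ _i ∈ L \ J, ∑ _d ∈ dirs, C :=
            Finset.sum_le_sum fun i _ => Finset.sum_le_sum fun d _ => by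
              split_ifs
              exacts [le_of_abs_le (hC _ _), hC0]
        _ = 4 * C * (L \ J).card := by
          simp [card_dirs]
          ring
    have e3 (b : Fin 2 → ℤ) (hb : b ∈ G) : ε ^ 2 * bondSum f (block n b) L u ≤
        4 * (∫ x in cells ε (block n b), supMinorants f (Q x)) + D / n * (ε ^ 2 * n ^ 2) := by
      have h1 := (hz b hb).2 L u (block_subset_latticeFinset hε hΩ (hsub hb)) (huz b)
      have h2 := mul_le_mul_of_nonneg_left h1 (sq_nonneg ε)
      have h3 := supMinorants_setAverage_le hC (hvpos b) (hQb hb) (hQi.mono_set (hsub hb))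
        (hHi.mono_set (hsub hb))
      rw [hvol] at h3
      rw [hnum]
      change _ * supMinorants f (P b) ≤ _ at h3
      linarith
    have e4 := Finset.sum_le_sum e3
    rw [Finset.sum_add_distrib, ← Finset.mul_sum, ← Finset.mul_sum, ← Finset.mul_sum] at e4
    have e5 := mul_le_mul_of_nonneg_left (sum_volume_block_le hε hΩ hn)
      (div_nonneg hD0 hn'.le)
    have e6 := mul_le_mul_of_nonneg_left (card_sdiff_innerPoints_le hε hΩ hn) hC0
    have e7 := mul_le_mul_of_nonneg_left e2 (sq_nonneg ε)
    have e8 := hsplit hHi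
    -- The limit energy on the part of Ω not covered may be negative, but is at least -4C times the
    -- layer area; together with the sites there this gives 8C.
    have e9 := hrem hC0 (g := fun x => supMinorants f (Q x)) (by
      filter_upwards [hQ] with x hx
      exact abs_supMinorants_le hC hx)
    rw [Real.norm_eq_abs] at e9
    rw [spinEnergy_eq_bondSum (mem_latticeFinset hε hΩ), e1, mul_add]
    linarith [neg_le_of_abs_le e9]
  · have hM0 : 0 ≤ M := (norm_nonneg _).trans (hM 0)
    have hφi := integrable_of_continuous_of_bounded hΩ hφ hM
    have hRi : IntegrableOn R Ω := R.integrable hΩ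
    have hd1 : ∀ᵐ x ∂(volume.restrict Ω), ‖R x - Q x‖ ≤ 2 := by
      filter_upwards [hR.1, hQ] with x h1 h2
      have h3 := norm_le_one_of_mem_tensorBody h1
      have h4 := norm_le_one_of_mem_tensorBody h2
      linarith [norm_sub_le (R x) (Q x)]
    have hdm : AEStronglyMeasurable (fun x => R x - Q x) (volume.restrict Ω) :=
      (R.stronglyMeasurable.sub Q.stronglyMeasurable).aestronglyMeasurable
    have hQ1 : ∀ᵐ x ∂(volume.restrict Ω), ‖Q x‖ ≤ 1 := by
      filter_upwards [hQ] with x hx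
      exact norm_le_one_of_mem_tensorBody hx
    have hR1 : ∀ᵐ x ∂(volume.restrict Ω), ‖R x‖ ≤ 1 := by
      filter_upwards [hR.1] with x hx
      exact norm_le_one_of_mem_tensorBody hx
    have hdi : IntegrableOn (fun x => frobL (φ x) (R x - Q x)) Ω := integrable_frobL hφi hdm hd1
    have e0 : (∫ x in Ω, frobL (φ x) (R x)) - ∫ x in Ω, frobL (φ x) (Q x) =
        ∫ x in Ω, frobL (φ x) (R x - Q x) := by
      rw [← integral_sub
        (integrable_frobL hφi R.stronglyMeasurable.aestronglyMeasurable hR1)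
        (integrable_frobL hφi Q.stronglyMeasurable.aestronglyMeasurable hQ1)]
      simp only [map_sub]
    have e1 (b : Fin 2 → ℤ) (hb : b ∈ G) :
        ‖∫ x in cells ε (block n b), frobL (φ x) (R x - Q x)‖ ≤
          (2 * ω + M * (D / n)) * (ε ^ 2 * n ^ 2) := by
      set B := cells ε (block n b)
      have hBfin : volume B < ∞ := (measure_mono (hsub hb)).trans_lt hΩ.measure_lt_top
      obtain ⟨x₀, hx₀⟩ : B.Nonempty := by
        by_contra hemp
        rw [not_nonempty_iff_eq_empty] at hemp
        have := hvpos b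
        change 0 < volume.real B at this
        rw [hemp, measureReal_empty] at this
        exact lt_irrefl _ this
      have hdB : IntegrableOn (fun x => R x - Q x) B := (hRi.sub hQi).mono_set (hsub hb)
      have hcB : IntegrableOn (fun x => frobL (φ x₀) (R x - Q x)) B :=
        (frobL (φ x₀)).integrable_comp hdB
      -- The test function is frozen at a point of the block. What remains is the integral of R - Q,
      -- which is small because the pattern has nearly the mean of Q on the block.
      have k1 : ∫ x in B, frobL (φ x) (R x - Q x) =
          (∫ x in B, (frobL (φ x) (R x - Q x) - frobL (φ x₀) (R x - Q x))) +
            frobL (φ x₀) (∫ x in B, (R x - Q x)) := by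
        rw [integral_sub (hdi.mono_set (hsub hb)) hcB, ← (frobL (φ x₀)).integral_comp_comm hdB]
        ring
      have k2 : ‖∫ x in B, (frobL (φ x) (R x - Q x) - frobL (φ x₀) (R x - Q x))‖ ≤
          (ω * 2) * volume.real B := by
        refine norm_setIntegral_le_of_norm_le_const_ae' hBfin ?_
        filter_upwards [(ae_restrict_iff' hΩo.measurableSet).mp hd1] with x hx hxB
        rw [← sub_apply, ← map_sub, Real.norm_eq_abs]
        exact (abs_frobL_le _ _).trans (mul_le_mul (hω _ _ (dist_le_of_mem_block hε hxB hx₀))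
          (hx (hsub hb hxB)) (norm_nonneg _) hω0)
      have k3 : ∫ x in B, (R x - Q x) =
          ε ^ 2 • (∑ i ∈ block n b, tensorSq (z b i) - (n : ℝ) ^ 2 • P b) := by
        rw [integral_sub (hRi.mono_set (hsub hb)) (hQi.mono_set (hsub hb))]
        have h1 : ∫ x in B, R x = ε ^ 2 • ∑ i ∈ block n b, tensorSq (z b i) := by
          rw [← Finset.sum_congr rfl fun i hi => congrArg tensorSq (huz b i hi),
            ← setIntegral_cells hε]
          exact integral_congr_ae (ae_restrict_of_ae_restrict_of_subset (hsub hb) hRu)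
        have h2 : ∫ x in B, Q x = (ε ^ 2 * (n : ℝ) ^ 2) • P b := by
          simp only [P]
          rw [setAverage_eq, ← hvol b, smul_inv_smul₀ (hvpos b).ne']
        rw [h1, h2, smul_sub, smul_smul]
      have k4 : ‖∫ x in B, (R x - Q x)‖ ≤ ε ^ 2 * (D * n) := by
        rw [k3, norm_smul, Real.norm_of_nonneg (sq_nonneg ε)]
        exact mul_le_mul_of_nonneg_left (hz b hb).1 (sq_nonneg ε)
      have k5 : |frobL (φ x₀) (∫ x in B, (R x - Q x))| ≤ M * (ε ^ 2 * (D * n)) :=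
        (abs_frobL_le _ _).trans (mul_le_mul (hM _) k4 (norm_nonneg _) hM0)
      rw [k1]
      refine (norm_add_le _ _).trans ((add_le_add k2 k5).trans (le_of_eq ?_))
      have : volume.real B = ε ^ 2 * n ^ 2 := hvol b
      rw [this, ← hnum]
      ring
    have e2 := hrem (B := M * 2) (by positivity) (g := fun x => frobL (φ x) (R x - Q x)) (by
      filter_upwards [hd1] with x hx
      exact (abs_frobL_le _ _).trans (mul_le_mul (hM x) hx (norm_nonneg _) hM0))
    rw [e0, hsplit hdi, ← Real.norm_eq_abs]
    refine (norm_add_le _ _).trans ?_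
    have e3 : ‖∑ b ∈ G, ∫ x in cells ε (block n b), frobL (φ x) (R x - Q x)‖ ≤
        (2 * ω + M * (D / n)) * volume.real Ω := by
      refine (norm_sum_le_of_le G e1).trans ?_
      rw [← Finset.mul_sum]
      exact mul_le_mul_of_nonneg_left (sum_volume_block_le hε hΩ hn) (by positivity)
    linarith

end recovery

/-! ### Weak* convergence and the choice of the block size -/

section conclusion

variable {f : Circ → Circ → ℝ} {C : ℝ} {Ω : Set Plane}

/-- Weak* convergence is tested against L¹ functions, while the block estimate needs a uniformly
continuous test function. -/
theorem exists_hasCompactSupport_setIntegral_le (hΩo : IsOpen Ω) {Φ : Plane → SymMat}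
    (hΦ : Integrable Φ (volume.restrict Ω)) {δ : ℝ} (hδ : 0 < δ) :
    ∃ φ : Plane → SymMat, HasCompactSupport φ ∧ Continuous φ ∧
      Integrable φ (volume.restrict Ω) ∧ ∫ x in Ω, ‖Φ x - φ x‖ ≤ δ := by
  have hint : Integrable (Ω.indicator Φ) := (integrable_indicator_iff hΩo.measurableSet).mpr hΦ
  obtain ⟨φ, hφs, hφ, hφc, hφi⟩ := hint.exists_hasCompactSupport_integral_sub_le hδ
  refine ⟨φ, hφs, hφc, hφi.integrableOn, le_trans ?_ hφ⟩
  refine le_trans (le_of_eq ?_) (setIntegral_le_integral (s := Ω) (hint.sub hφi).norm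
    (Eventually.of_forall fun x => norm_nonneg _))
  exact setIntegral_congr_fun hΩo.measurableSet fun x hx => by simp [indicator_of_mem hx]

theorem abs_pairing_sub_le {μ : Measure Plane} {Φ φ Q R : Plane → SymMat} (hΦ : Integrable Φ μ)
    (hφ : Integrable φ μ) (hQ : AEStronglyMeasurable Q μ) (hQ1 : ∀ᵐ x ∂μ, ‖Q x‖ ≤ 1)
    (hR : AEStronglyMeasurable R μ) (hR1 : ∀ᵐ x ∂μ, ‖R x‖ ≤ 1) :
    |(∫ x, frobL (Φ x) (R x) ∂μ) - ∫ x, frobL (Φ x) (Q x) ∂μ| ≤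
      |(∫ x, frobL (φ x) (R x) ∂μ) - ∫ x, frobL (φ x) (Q x) ∂μ| + 2 * ∫ x, ‖Φ x - φ x‖ ∂μ := by
  have key {T : Plane → SymMat} (hT : AEStronglyMeasurable T μ) (hT1 : ∀ᵐ x ∂μ, ‖T x‖ ≤ 1) :
      |(∫ x, frobL (Φ x) (T x) ∂μ) - ∫ x, frobL (φ x) (T x) ∂μ| ≤ ∫ x, ‖Φ x - φ x‖ ∂μ := by
    rw [← integral_sub (integrable_frobL hΦ hT hT1) (integrable_frobL hφ hT hT1),
      ← Real.norm_eq_abs]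
    refine norm_integral_le_of_norm_le (hΦ.sub hφ).norm ?_
    filter_upwards [hT1] with x hx
    rw [← sub_apply, ← map_sub, Real.norm_eq_abs]
    exact (abs_frobL_le _ _).trans (mul_le_of_le_one_right (norm_nonneg _) hx)
  have h1 := key hQ hQ1
  have h2 := key hR hR1
  have h3 : (∫ x, frobL (Φ x) (R x) ∂μ) - ∫ x, frobL (Φ x) (Q x) ∂μ =
      ((∫ x, frobL (φ x) (R x) ∂μ) - ∫ x, frobL (φ x) (Q x) ∂μ) +
      (((∫ x, frobL (Φ x) (R x) ∂μ) - ∫ x, frobL (φ x) (R x) ∂μ) -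
        ((∫ x, frobL (Φ x) (Q x) ∂μ) - ∫ x, frobL (φ x) (Q x) ∂μ)) := by ring
  rw [h3]
  refine (abs_add_le _ _).trans (add_le_add le_rfl ((abs_sub _ _).trans ?_))
  linarith

/-- The number of lattice points on the side of a block, for the lattice spacing `ε`. -/
def blockSize (ε : ℝ) : ℕ := ⌈1 / √ε⌉₊

theorem blockSize_pos {ε : ℝ} (hε : 0 < ε) : 0 < blockSize ε :=
  Nat.ceil_pos.mpr (by positivity)

/-- Blocks must contain many sites, so that the O(n) errors of the patterns are negligible against
n². -/
theorem tendsto_div_blockSize (D : ℝ) :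
    Tendsto (fun ε => D / (blockSize ε : ℝ)) (𝓝[>] 0) (𝓝 0) := by
  refine tendsto_const_nhds.div_atTop (tendsto_atTop_mono (fun ε => Nat.le_ceil (1 / √ε)) ?_)
  simp only [one_div]
  refine tendsto_inv_nhdsGT_zero.comp (tendsto_nhdsWithin_iff.mpr ⟨?_, ?_⟩)
  · have : Tendsto (fun ε : ℝ => √ε) (𝓝 0) (𝓝 (√0)) := Real.continuous_sqrt.tendsto 0
    rw [Real.sqrt_zero] at this
    exact this.mono_left nhdsWithin_le_nhds
  · filter_upwards [self_mem_nhdsWithin] with ε hε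
    exact Real.sqrt_pos.mpr hε

/-- Blocks must also shrink, so that test functions are nearly constant on them and the layer of
uncovered points vanishes. The size of order ε^(-1/2) meets both demands. -/
theorem tendsto_mul_blockSize (c : ℝ) :
    Tendsto (fun ε : ℝ => c * (ε * blockSize ε)) (𝓝[>] 0) (𝓝 0) := by
  have h : Tendsto (fun ε : ℝ => ε * (blockSize ε : ℝ)) (𝓝[>] 0) (𝓝 0) := by
    have hlim : Tendsto (fun ε : ℝ => √ε + ε) (𝓝[>] 0) (𝓝 0) := by
      have : Tendsto (fun ε : ℝ => √ε + ε) (𝓝 0) (𝓝 (√0 + 0)) :=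
        (Real.continuous_sqrt.add continuous_id).tendsto 0
      rw [Real.sqrt_zero, add_zero] at this
      exact this.mono_left nhdsWithin_le_nhds
    refine tendsto_of_tendsto_of_tendsto_of_le_of_le' tendsto_const_nhds hlim ?_ ?_
    · filter_upwards [self_mem_nhdsWithin] with ε hε
      exact mul_nonneg (le_of_lt hε) (Nat.cast_nonneg _)
    · filter_upwards [self_mem_nhdsWithin] with ε hε
      have hε : 0 < ε := hε
      have h1 : (blockSize ε : ℝ) ≤ 1 / √ε + 1 := (Nat.ceil_lt_add_one (by positivity)).le
      calc ε * blockSize ε ≤ ε * (1 / √ε + 1) := by gcongr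
        _ = √ε + ε := by rw [mul_add, mul_one_div, Real.div_sqrt, mul_one]
  simpa using h.const_mul c

theorem exists_recovery (hC : ∀ u v, |f u v| ≤ C) (hf_exchange : ∀ u v, f u v = f v u)
    (hf_headtail : ∀ u v, f u (-v) = f u v ∧ f (-u) v = f u v) (hΩo : IsOpen Ω)
    (hΩ : Bornology.IsBounded Ω) (hlip : HasLipschitzBoundary Ω) (Q : LinftySym Ω) :
    ∃ y : ℝ → LinftySym Ω, Tendsto y (𝓝[>] 0) (𝓝 Q) ∧
      limsup (fun ε => discreteFunctional f Ω ε (y ε)) (𝓝[>] 0) ≤ limitFunctional f Ω Q := by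
  by_cases hQ : ∀ᵐ x ∂(volume.restrict Ω), Q x ∈ tensorBody
  swap
  · refine ⟨fun _ => Q, tendsto_const_nhds, ?_⟩
    rw [limitFunctional, if_neg hQ]
    exact le_top
  obtain ⟨D, hD0, hD⟩ := exists_block_recovery hC hf_exchange hΩo hΩ Q hQ
  have hex : ∀ ε : ℝ, ∃ R : LinftySym Ω, 0 < ε → ∃ u, IsInterpolation ε Ω u R ∧
      spinEnergy f ε Ω u ≤ (4 * ∫ x in Ω, supMinorants f (Q x)) +
        (8 * C * layerArea Ω (3 * (ε * blockSize ε)) + D / blockSize ε * volume.real Ω) ∧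
      ∀ (φ : Plane → SymMat) (M ω : ℝ), Continuous φ → (∀ x, ‖φ x‖ ≤ M) → 0 ≤ ω →
        (∀ x y, dist x y ≤ 2 * (ε * blockSize ε) → ‖φ x - φ y‖ ≤ ω) →
        |(∫ x in Ω, frobL (φ x) (R x)) - ∫ x in Ω, frobL (φ x) (Q x)| ≤
          (2 * ω + M * (D / blockSize ε)) * volume.real Ω +
            2 * M * layerArea Ω (3 * (ε * blockSize ε)) := by
    intro ε
    by_cases hε : 0 < ε
    · obtain ⟨u, R, h⟩ := hD ε hε _ (blockSize_pos hε)
      exact ⟨R, fun _ => ⟨u, h⟩⟩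
    · exact ⟨Q, fun h => absurd h hε⟩
  choose y hy using hex
  have hlayer : Tendsto (fun ε : ℝ => layerArea Ω (3 * (ε * blockSize ε))) (𝓝[>] 0) (𝓝 0) :=
    (tendsto_layerArea hΩ hlip).comp (tendsto_mul_blockSize 3)
  have hQ1 : ∀ᵐ x ∂(volume.restrict Ω), ‖Q x‖ ≤ 1 := by
    filter_upwards [hQ] with x hx
    exact norm_le_one_of_mem_tensorBody hx
  refine ⟨y, ?_, ?_⟩
  · rw [nhds_induced, tendsto_comap_iff, tendsto_pi_nhds]
    rintro ⟨Φ, hΦ⟩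
    change Tendsto (fun ε => ∫ x in Ω, frobL (Φ x) (y ε x)) (𝓝[>] 0)
      (𝓝 (∫ x in Ω, frobL (Φ x) (Q x)))
    rw [Metric.tendsto_nhds]
    intro δ hδ
    -- Error budget: replacing Φ by φ costs 2 · δ/8, the oscillation of φ at most 2 · δ/8, and the
    -- pattern and layer terms less than δ/4.
    obtain ⟨φ, hφs, hφc, hφi, hφ⟩ :=
      exists_hasCompactSupport_setIntegral_le hΩo hΦ (δ := δ / 8) (by positivity)
    obtain ⟨M, hM⟩ := hφs.exists_bound_of_continuous hφc
    have hV : 0 ≤ volume.real Ω := measureReal_nonneg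
    set ω := δ / (8 * (volume.real Ω + 1)) with hω_def
    have hω : 0 < ω := by positivity
    obtain ⟨η, hη, hη2⟩ := Metric.uniformContinuous_iff_le.mp
      (hφs.uniformContinuous_of_continuous hφc) ω hω
    have l1 : Tendsto (fun ε : ℝ => (M * (D / blockSize ε)) * volume.real Ω +
        2 * M * layerArea Ω (3 * (ε * blockSize ε))) (𝓝[>] 0) (𝓝 0) := by
      simpa using (((tendsto_div_blockSize D).const_mul M).mul_const (volume.real Ω)).add
        (hlayer.const_mul (2 * M))
    filter_upwards [self_mem_nhdsWithin, l1.eventually (gt_mem_nhds (by positivity : 0 < δ / 4)),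
      (tendsto_mul_blockSize 2).eventually (gt_mem_nhds hη)] with ε hε hε1 hε2
    obtain ⟨u, hR, -, hφR⟩ := hy ε hε
    have hR1 : ∀ᵐ x ∂(volume.restrict Ω), ‖y ε x‖ ≤ 1 := by
      filter_upwards [hR.1] with x hx
      exact norm_le_one_of_mem_tensorBody hx
    have h1 := abs_pairing_sub_le hΦ hφi Q.stronglyMeasurable.aestronglyMeasurable hQ1
      (y ε).stronglyMeasurable.aestronglyMeasurable hR1
    have h2 := hφR φ M ω hφc hM hω.le fun x x' h => by
      rw [← dist_eq_norm]
      exact hη2 (h.trans hε2.le)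
    have h3 : ω * volume.real Ω ≤ δ / 8 := by
      have : ω * (volume.real Ω + 1) = δ / 8 := by rw [hω_def]; field_simp
      linarith
    rw [Real.dist_eq]
    linarith
  · rw [limitFunctional_of_mem hC hf_exchange hf_headtail hQ]
    have l1 : Tendsto (fun ε : ℝ => (4 * ∫ x in Ω, supMinorants f (Q x)) +
        (8 * C * layerArea Ω (3 * (ε * blockSize ε)) + D / blockSize ε * volume.real Ω))
        (𝓝[>] 0) (𝓝 (4 * ∫ x in Ω, supMinorants f (Q x))) := by
      simpa using (tendsto_const_nhds (x := 4 * ∫ x in Ω, supMinorants f (Q x))).add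
        ((hlayer.const_mul (8 * C)).add ((tendsto_div_blockSize D).mul_const (volume.real Ω)))
    have l2 := (continuous_coe_real_ereal.tendsto _).comp l1
    rw [← l2.limsup_eq]
    refine limsup_le_limsup ?_ (by isBoundedDefault) (by isBoundedDefault)
    filter_upwards [self_mem_nhdsWithin] with ε hε
    obtain ⟨u, hR, hE, -⟩ := hy ε hε
    exact (iInf₂_le u hR).trans (EReal.coe_le_coe_iff.mpr hE)

end conclusion

end

theorem theorem3p8
    (Ω : Set Plane) (hΩ_open : IsOpen Ω) (hΩ_bdd : Bornology.IsBounded Ω)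
    (hΩ_lip : HasLipschitzBoundary Ω)
    (f : Circ → Circ → ℝ)
    (hf_bdd : ∃ C : ℝ, ∀ u v, |f u v| ≤ C)
    (hf_exchange : ∀ u v, f u v = f v u)
    (hf_headtail : ∀ u v, f u (-v) = f u v ∧ f (-u) v = f u v) :
    GammaConverges (𝓝[>] (0 : ℝ)) (fun ε => discreteFunctional f Ω ε) (limitFunctional f Ω) ∧
      ∀ Q ∈ tensorBody, HasHomogenizedDensity f Q (4 * fHatEnvelope f Q) := by
  obtain ⟨C, hC⟩ := hf_bdd
  refine ⟨⟨limitFunctional_le_liminf hC hf_exchange hf_headtail hΩ_open hΩ_bdd hΩ_lip,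
    exists_recovery hC hf_exchange hf_headtail hΩ_open hΩ_bdd hΩ_lip⟩, fun Q hQ => ?_⟩
  rw [fHatEnvelope_eq hC hf_exchange hf_headtail hQ]
  exact hasHomogenizedDensity hC hf_exchange hQ
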